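/- Let $K$ be a global field: either a number field, or a finitely generated extension of transcendence degree $1$ of a finite field, in which case $q$ denotes the cardinality of the field of constants of $K$ (the algebraic closure of the finite field in $K$). Let $\mathcal C_K=\mathbb A_K^\times/K^\times$ be the idele class group, with modulus $|u|=\prod_\nu|v_\nu|_\nu$ for $u=\overline v$, $v\in\mathbb A_K^\times$ (normalized absolute values). Let $d^*u$ be the Haar measure on $\mathcal C_K$ whose image under $u\mapsto|u|$ is $dt/t$ on $(0,\infty)$ (number field case), respectively which gives the subgroup $\{|u|=1\}$ total volume $1$ (function field case). Put $$a(w)=\sqrt{|w|}\,\mathbf 1_{|w|\le1}\quad\text{(number field case)},$$ $$a(w)=\sqrt{|w|}\Bigl(\sqrt q-\tfrac1{\sqrt q}\Bigr)\mathbf 1_{|w|<1}+\Bigl(1-\tfrac1{\sqrt q}\Bigr)\mathbf 1_{|w|=1}\quad\text{(function field case)}.$$ Let $H^2$ be the space of $f\in L^2(\mathcal C_K,d^*u)$ that vanish almost everywhere on $\{|u|>1\}$. **Lemma 1.10.** For every $f\in L^2(\mathcal C_K,d^*u)$ and every $u_0\in\mathcal C_K$ the integral $$(A f)(u_0)=\int_{\mathcal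 C_K}a\Bigl(\frac{u_0}{u}\Bigr)f(u)\,d^*u$$ converges absolutely, and $A$ is a bounded operator on $L^2(\mathcal C_K,d^*u)$. The operator $V=1-A$ is unitary on $L^2(\mathcal C_K,d^*u)$. It commutes with the regular action $(U(g)f)(u)=f(u/g)$ of $\mathcal C_K$ and maps $H^2$ into itself. Moreover $V$ has a spectral multiplier $m$, a function on the unitary characters $\psi$ of $\mathcal C_K$: with $\widehat f(\psi)=\int_{\mathcal C_K}f(u)\psi(u)\,d^*u$, for every $f\in L^1\cap L^2$ one has $Vf\in L^1$ and $\widehat{Vf}(\psi)=m(\psi)\widehat f(\psi)$ for all $\psi$; and if $\mathcal F$ is an isometry from $L^2(\mathcal C_K,d^*u)$ to an $L^2$ space on the dual group that extends $f\mapsto\widehat f$ from $L^1\cap L^2$, then $\mathcal F(Vf)=m\cdot\mathcal F f$ almost everywhere for all $f\in L^2$. The multiplier is given as follows. * If $\psi$ is nontrivial on $\{|u|=1\}$, then $m(\psi)=1$. * If $\psi(u)=|u|^{s-1/2}$ with $\operatorname{Re}s=\tfrac12$, then $$m(\psi)=\frac{s-1}{s}\quad\text{(number field case)},\qquad m(\psi)=\frac{1-\sqrt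 q\,z}{\sqrt q-z},\quad z=q^{-(s-1/2)}\quad\text{(function field case)}.$$ -/

import Mathlib

open MeasureTheory

/-! ### Harmonic analysis on a commutative topological group carrying a modulus `G → ℝ` -/

section Group

variable {G : Type*} [CommGroup G] [TopologicalSpace G] [IsTopologicalGroup G]
  [MeasurableSpace G] [BorelSpace G]

/-- `T` is the convolution operator `(T f)(u₀) = ∫ a(u₀ / u) f(u) dμ(u)` on `L²(G, μ)`; the
integral is required to converge absolutely for every `f` in `L²` and every `u₀`. -/
def IsConvolutionOperator (μ : Measure G) (a : G → ℝ)
    (T : Lp ℂ 2 μ →L[ℂ] Lp ℂ 2 μ) : Prop :=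
  ∀ f : Lp ℂ 2 μ,
    (∀ u₀ : G, Integrable (fun u => (a (u₀ / u) : ℂ) * f u) μ) ∧
    T f =ᵐ[μ] fun u₀ => ∫ u, (a (u₀ / u) : ℂ) * f u ∂μ

/-- The regular action of `G` on `L²(G, μ)`: `(U(g) f)(u) = f(u / g)`. -/
noncomputable def regularAction (μ : Measure G) [μ.IsMulLeftInvariant] (g : G) :
    Lp ℂ 2 μ →+ Lp ℂ 2 μ :=
  Lp.compMeasurePreserving (fun u => u / g) (measurePreserving_div_right μ g)

/-- The space `H²` of the functions in `L²(G, μ)` that vanish almost everywhere off the closed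
set `{|u| ≤ 1}`. -/
def hardySpace (μ : Measure G) (modulus : G → ℝ) : Set (Lp ℂ 2 μ) :=
  {f | ∀ᵐ u ∂μ, 1 < modulus u → f u = 0}

/-- The Fourier transform `∫ f(u) ψ(u) dμ(u)` of an integrable function at a unitary
character `ψ`. Writing `ψ = χ |·|^(s - 1/2)` with `Re s = 1/2`, this is the Fourier–Mellin
transform at `(χ, s)`. -/
noncomputable def fourierMellin (μ : Measure G) (f : G → ℂ) (ψ : PontryaginDual G) : ℂ :=
  ∫ u, f u * (ψ u : ℂ) ∂μ

/-- The bounded operator `T` on `L²(G, μ)` has spectral multiplier `m`, a function on the group of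
unitary characters: it is multiplication by `m` on the Fourier side. Both the pointwise version,
on `L¹ ∩ L²`, and the almost everywhere version, on all of `L²`, are required. In the latter
`F` is a Plancherel transform, i.e. an isometry from `L²(G, μ)` into `L²` of the dual
(for any measure `ν` on the dual that admits one) that extends the Fourier transform
on `L¹ ∩ L²`. -/
def HasSpectralMultiplier (μ : Measure G) (T : Lp ℂ 2 μ →L[ℂ] Lp ℂ 2 μ)
    (m : PontryaginDual G → ℂ) : Prop :=
  (∀ f : Lp ℂ 2 μ, Integrable f μ →
    Integrable (T f) μ ∧ ∀ ψ, fourierMellin μ (T f) ψ = m ψ * fourierMellin μ f ψ) ∧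
  ∀ (_ : MeasurableSpace (PontryaginDual G)) (_ : BorelSpace (PontryaginDual G))
    (ν : Measure (PontryaginDual G)) (F : Lp ℂ 2 μ →ₗᵢ[ℂ] Lp ℂ 2 ν),
    (∀ f : Lp ℂ 2 μ, Integrable f μ → F f =ᵐ[ν] fourierMellin μ f) →
    ∀ f : Lp ℂ 2 μ, F (T f) =ᵐ[ν] fun ψ => m ψ * F f ψ

/-- The kernel `√|w| · 1_{|w| ≤ 1}`. -/
noncomputable def numberFieldKernel (modulus : G → ℝ) (w : G) : ℝ :=
  Set.indicator {w | modulus w ≤ 1} (fun w => √(modulus w)) w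

/-- The kernel `√|w| (√q - 1/√q) · 1_{|w| < 1} + (1 - 1/√q) · 1_{|w| = 1}`. -/
noncomputable def functionFieldKernel (q : ℕ) (modulus : G → ℝ) (w : G) : ℝ :=
  Set.indicator {w | modulus w < 1} (fun w => √(modulus w) * (√q - 1 / √q)) w +
    Set.indicator {w | modulus w = 1} (fun _ => 1 - 1 / √q) w

end Group

/-! ### Number fields -/

namespace NumberField

variable (K : Type*) [Field K] [NumberField K]

/-- The subgroup `Kˣ` of principal ideles. -/
noncomputable def principalIdeles : Subgroup (AdeleRing (𝓞 K) K)ˣ :=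
  (Units.map (algebraMap K (AdeleRing (𝓞 K) K) : K →* AdeleRing (𝓞 K) K)).range

/-- The idele class group of the number field `K`. -/
def IdeleClassGroup : Type _ := (AdeleRing (𝓞 K) K)ˣ ⧸ principalIdeles K

noncomputable instance : CommGroup (IdeleClassGroup K) :=
  inferInstanceAs (CommGroup ((AdeleRing (𝓞 K) K)ˣ ⧸ principalIdeles K))

noncomputable instance : TopologicalSpace (IdeleClassGroup K) :=
  inferInstanceAs (TopologicalSpace ((AdeleRing (𝓞 K) K)ˣ ⧸ principalIdeles K))

instance : IsTopologicalGroup (IdeleClassGroup K) :=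
  inferInstanceAs (IsTopologicalGroup ((AdeleRing (𝓞 K) K)ˣ ⧸ principalIdeles K))

noncomputable instance : MeasurableSpace (IdeleClassGroup K) := borel _

instance : BorelSpace (IdeleClassGroup K) := ⟨rfl⟩

variable {K}

/-- The modulus `∏ |v_ν|_ν` of an idele, over all places `ν`, with normalized absolute values
(the square of the usual one at a complex place, `N(ν)^(-ord)` at a finite place). -/
noncomputable def ideleModulus (v : (AdeleRing (𝓞 K) K)ˣ) : ℝ :=
  (∏ w : InfinitePlace K, ‖v.val.1 w‖ ^ w.mult) *
    ∏ᶠ p : IsDedekindDomain.HeightOneSpectrum (𝓞 K), ‖v.val.2 p‖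

/-- The modulus of an idele class, i.e. of any idele representing it (all representatives have the
same modulus, by the product formula). -/
noncomputable def classModulus (u : IdeleClassGroup K) : ℝ :=
  ideleModulus (Quotient.out (show (AdeleRing (𝓞 K) K)ˣ ⧸ principalIdeles K from u))

/-- The normalization of the Haar measure `μ` on the idele class group of the number field `K`:
its image under the modulus is `dt / t` on `(0, ∞)`. -/
def IsNormalized (μ : Measure (IdeleClassGroup K)) : Prop :=
  μ.map classModulus = (volume.restrict (Set.Ioi (0 : ℝ))).withDensity fun t => ENNReal.ofReal t⁻¹

end NumberField

/-! ### Function fields -/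

namespace GlobalFunctionField

/-- A place of a function field `K` in one variable over a finite field, given by its valuation
ring: a valuation ring of `K` other than `K` itself. (All such rings are discrete valuation rings
with finite residue field, and contain the constants.) -/
structure Place (K : Type*) [Field K] where
  /-- The valuation ring of the place. -/
  ring : ValuationSubring K
  ring_ne_top : ring ≠ ⊤

variable {K : Type*} [Field K]

namespace Place

/-- The completion of `K` at the place `v`. -/
abbrev Completion (v : Place K) : Type _ := v.ring.valuation.Completion

/-- The ring of integers of the completion of `K` at the place `v`. -/
noncomputable def integers (v : Place K) : ValuationSubring v.Completion :=
  (Valued.v : Valuation v.Completion v.ring.ValueGroup).valuationSubring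

/-- The cardinality of the residue field at the place `v`. -/
noncomputable def residueCard (v : Place K) : ℕ := Nat.card (IsLocalRing.ResidueField v.ring)

/-- `n` is the order of `x` at the place `v`: `x` has the valuation of `ϖ ^ n`, for a uniformizer
`ϖ`. -/
def IsOrd (v : Place K) (x : v.Completion) (n : ℤ) : Prop :=
  ∃ ϖ : v.ring, Irreducible ϖ ∧ Valued.v x = v.ring.valuation (ϖ : K) ^ n

open Classical in
/-- The normalized absolute value `|x|_v = q_v ^ (-ord_v x)`, and `|0|_v = 0`. -/
noncomputable def abv (v : Place K) (x : v.Completion) : ℝ :=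
  if x = 0 then 0 else (v.residueCard : ℝ) ^ (-Classical.epsilon (v.IsOrd x))

end Place

open scoped RestrictedProduct

variable (K)

/-- The adele ring of a function field: the restricted product of the completions at all places,
with respect to their rings of integers. -/
abbrev AdeleRing : Type _ := Πʳ v : Place K, [v.Completion, v.integers]

instance : Fact (∀ v : Place K, IsOpen (v.integers : Set v.Completion)) :=
  ⟨fun _ => Valued.isOpen_valuationSubring _⟩

/-- The subgroup `Kˣ` of principal ideles: the ideles that have the same nonzero `x` in `K` as
component at all places. -/
noncomputable def principalIdeles : Subgroup (AdeleRing K)ˣ where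
  carrier := {a | ∃ x : Kˣ, ∀ v : Place K, a.val v = ((x : K) : v.Completion)}
  one_mem' := ⟨1, fun v => by
    simp only [Units.val_one, map_one]
    exact (UniformSpace.Completion.coe_one _).symm⟩
  mul_mem' := by
    rintro a b ⟨x, hx⟩ ⟨y, hy⟩
    refine ⟨x * y, fun v => ?_⟩
    have h : (a * b).val v = a.val v * b.val v := rfl
    rw [h, hx v, hy v, Units.val_mul, map_mul, UniformSpace.Completion.coe_mul]
  inv_mem' := by
    rintro a ⟨x, hx⟩
    refine ⟨x⁻¹, fun v => ?_⟩
    have h : a.val v * (a⁻¹).val v = 1 := congrFun (congrArg Subtype.val a.mul_inv) v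
    rw [hx v] at h
    rw [eq_inv_of_mul_eq_one_right h, Units.val_inv_eq_inv_val, map_inv₀,
      UniformSpace.Completion.coe_inv]

/-- The idele class group of the function field `K`. -/
def IdeleClassGroup : Type _ := (AdeleRing K)ˣ ⧸ principalIdeles K

noncomputable instance : CommGroup (IdeleClassGroup K) :=
  inferInstanceAs (CommGroup ((AdeleRing K)ˣ ⧸ principalIdeles K))

noncomputable instance : TopologicalSpace (IdeleClassGroup K) :=
  inferInstanceAs (TopologicalSpace ((AdeleRing K)ˣ ⧸ principalIdeles K))

instance : IsTopologicalGroup (IdeleClassGroup K) :=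
  inferInstanceAs (IsTopologicalGroup ((AdeleRing K)ˣ ⧸ principalIdeles K))

noncomputable instance : MeasurableSpace (IdeleClassGroup K) := borel _

instance : BorelSpace (IdeleClassGroup K) := ⟨rfl⟩

variable {K}

/-- The modulus `∏ |a_v|_v` of an idele. -/
noncomputable def ideleModulus (a : (AdeleRing K)ˣ) : ℝ := ∏ᶠ v : Place K, v.abv (a.val v)

/-- The modulus of an idele class, i.e. of any idele representing it (all representatives have the
same modulus, by the product formula). -/
noncomputable def classModulus (u : IdeleClassGroup K) : ℝ :=
  ideleModulus (Quotient.out (show (AdeleRing K)ˣ ⧸ principalIdeles K from u))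

/-- The normalization of the Haar measure `μ` on the idele class group of the function field `K`:
the classes of modulus one have total volume one. -/
def IsNormalized (μ : Measure (IdeleClassGroup K)) : Prop :=
  μ {u | classModulus u = 1} = 1

end GlobalFunctionField

namespace GlobalFunctionField

open Polynomial IsLocalRing

/-- `F` is a function field in one variable over `k`. -/
class IsFunctionField (k F : Type*) [Field k] [Field F] [Algebra k F] : Prop where
  essFiniteType : Algebra.EssFiniteType k F
  trdeg_eq_one : Algebra.trdeg k F = 1

section

variable {k F : Type*} [Field k] [Field F] [Algebra k F]

theorem aeval_mul_mem {x : F} {O : Submodule k F} (hxO : ∀ y ∈ O, x * y ∈ O) (p : k[X]) {y : F}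
    (hy : y ∈ O) : aeval x p * y ∈ O := by
  induction p using Polynomial.induction_on' with
  | add p q hp hq => rw [map_add, add_mul]; exact O.add_mem hp hq
  | monomial n a =>
    rw [aeval_monomial, mul_assoc, ← Algebra.smul_def]
    refine O.smul_mem _ ?_
    induction n with
    | zero => simpa
    | succ n ih => rw [pow_succ', mul_assoc]; exact hxO _ ih

open scoped IntermediateField IntermediateField.algebraAdjoinAdjoin in
/-- Generators over `k` modulo `x` are linearly independent over `k(x)`. -/
theorem linearIndependent_adjoin_of_map {x : F} (hx : Transcendental k x)
    {O : Submodule k F} (hxO : ∀ y ∈ O, x * y ∈ O) {V : Type*} [AddCommGroup V] [Module k V]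
    (π : O →ₗ[k] V) (hπ : ∀ y : O, π ⟨x * y, hxO y y.2⟩ = 0) {ι : Type*} (u : ι → O)
    (hu : LinearIndependent k fun i => π (u i)) :
    LinearIndependent k⟮x⟯ fun i => (u i : F) := by
  classical
  have hx0 : x ≠ 0 := fun h => hx (h ▸ isAlgebraic_zero)
  have hsplit : ∀ p : k[X], aeval x p = x * aeval x p.divX + algebraMap k F (p.coeff 0) := by
    intro p
    conv_lhs => rw [← X_mul_divX_add p]
    simp only [map_add, map_mul, aeval_X, aeval_C]
  have hπp : ∀ (p : k[X]) (y : O), π ⟨aeval x p * y, aeval_mul_mem hxO p y.2⟩ = p.coeff 0 • π y := by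
    intro p y
    have : (⟨aeval x p * y, aeval_mul_mem hxO p y.2⟩ : O) =
        ⟨x * (aeval x p.divX * y), hxO _ (aeval_mul_mem hxO _ y.2)⟩ + p.coeff 0 • y := by
      apply Subtype.ext
      simp only [Submodule.coe_add, Submodule.coe_smul]
      rw [hsplit p, Algebra.smul_def]
      ring
    rw [this, map_add, map_smul, hπ ⟨_, aeval_mul_mem hxO _ y.2⟩, zero_add]
  have key : ∀ (N : ℕ) (s : Finset ι) (p : ι → k[X]), (∀ i ∈ s, (p i).natDegree < N) →
      ∑ i ∈ s, aeval x (p i) * (u i : F) = 0 → ∀ i ∈ s, p i = 0 := by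
    intro N
    induction N with
    | zero => intro s p hp _ i hi; exact absurd (hp i hi) (by simp)
    | succ N ih =>
      intro s p hp h
      have hO : ∑ i ∈ s, (⟨aeval x (p i) * u i, aeval_mul_mem hxO _ (u i).2⟩ : O) = 0 := by
        apply Subtype.ext
        push_cast
        rw [← h]
      have h0 : ∀ i ∈ s, (p i).coeff 0 = 0 := by
        refine linearIndependent_iff'.1 hu s (fun i => (p i).coeff 0) ?_
        rw [← map_zero π, ← hO, map_sum]
        exact Finset.sum_congr rfl fun i _ => (hπp _ _).symm
      have h1 : ∀ i ∈ s, p i = X * (p i).divX := by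
        intro i hi
        conv_lhs => rw [← X_mul_divX_add (p i), h0 i hi]
        simp
      rcases Nat.eq_zero_or_pos N with rfl | hN
      · intro i hi
        have := hp i hi
        rw [eq_C_of_natDegree_le_zero (p := p i) (by omega), h0 i hi, map_zero]
      have h2 := ih s (fun i => (p i).divX)
        (fun i hi => by rw [natDegree_divX_eq_natDegree_tsub_one]; have := hp i hi; omega) (by
          have : x * ∑ i ∈ s, aeval x (p i).divX * (u i : F) = 0 := by
            rw [← h, Finset.mul_sum]
            refine Finset.sum_congr rfl fun i hi => ?_
            rw [hsplit (p i), h0 i hi]; simp [mul_assoc]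
          exact (mul_eq_zero.1 this).resolve_left hx0)
      intro i hi
      rw [h1 i hi, h2 i hi, mul_zero]
  rw [← LinearIndependent.iff_fractionRing (R := Algebra.adjoin k {x}) (K := k⟮x⟯)]
  rw [linearIndependent_iff']
  intro s g hg
  have hg' : ∀ i, ∃ p : k[X], aeval x p = (g i : F) := by
    intro i
    exact (Algebra.adjoin_singleton_eq_range_aeval k x).le (g i).2
  choose p hp using hg'
  intro i hi
  have := key (s.sup (fun i => (p i).natDegree) + 1) s p
    (fun i hi => Nat.lt_succ_of_le (Finset.le_sup (f := fun i => (p i).natDegree) hi)) (by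
      rw [← hg]
      refine Finset.sum_congr rfl fun i _ => ?_
      rw [hp, Algebra.smul_def]; rfl) i hi
  apply Subtype.ext
  rw [← hp i, this]; simp

open scoped IntermediateField IntermediateField.algebraAdjoinAdjoin in
theorem finiteDimensional_adjoin [h : IsFunctionField k F] {x : F} (hx : Transcendental k x) :
    FiniteDimensional k⟮x⟯ F := by
  have := h.essFiniteType
  have : Algebra.EssFiniteType k⟮x⟯ F := Algebra.EssFiniteType.of_comp k k⟮x⟯ F
  have hb : IsTranscendenceBasis k fun _ : Unit => x := by
    refine AlgebraicIndependent.isTranscendenceBasis_of_lift_trdeg_le_of_finite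
      (algebraicIndependent_unique_type_iff.2 hx) ?_
    rw [h.trdeg_eq_one]; simp
  have h1 := hb.isAlgebraic_field
  rw [Set.range_const] at h1
  exact Algebra.finite_of_essFiniteType_of_isAlgebraic

theorem finite_and_finrank_le_of_linearIndependent {V : Type*} [AddCommGroup V] [Module k V] (n : ℕ)
    (h : ∀ s : Finset V, LinearIndependent k (fun i : s => (i : V)) → s.card ≤ n) :
    Module.Finite k V ∧ Module.finrank k V ≤ n := by
  have hr : Module.rank k V ≤ n := rank_le h
  exact ⟨Module.rank_lt_aleph0_iff.1 (hr.trans_lt (Cardinal.natCast_lt_aleph0)),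
    Module.finrank_le_of_rank_le hr⟩

open scoped IntermediateField in
theorem finrank_le_of_surjective [IsFunctionField k F] {x : F} (hx : Transcendental k x)
    {O : Submodule k F} (hxO : ∀ y ∈ O, x * y ∈ O) {V : Type*} [AddCommGroup V] [Module k V]
    (π : O →ₗ[k] V) (hπ : ∀ y : O, π ⟨x * y, hxO y y.2⟩ = 0) (hs : Function.Surjective π) :
    Module.Finite k V ∧ Module.finrank k V ≤ Module.finrank k⟮x⟯ F := by
  have := finiteDimensional_adjoin hx
  refine finite_and_finrank_le_of_linearIndependent _ fun s hs' => ?_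
  have h := linearIndependent_adjoin_of_map hx hxO π hπ
    (fun i : s => Function.surjInv hs i) (by simpa only [Function.surjInv_eq hs] using hs')
  simpa using h.fintype_card_le_finrank

end

end GlobalFunctionField

namespace GlobalFunctionField

open Polynomial IsLocalRing WithZero

theorem _root_.ValuationSubring.mem_of_pow_eq_one {F : Type*} [Field F] (A : ValuationSubring F)
    {x : F} {n : ℕ} (hn : n ≠ 0) (h : x ^ n = 1) : x ∈ A := by
  rw [← A.valuation_le_one_iff]
  have : A.valuation x ^ n = 1 := by rw [← map_pow, h, map_one]
  exact (_root_.pow_le_one_iff hn).1 this.le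

theorem _root_.ValuationSubring.mem_of_isIntegral {F : Type*} [Field F] (A : ValuationSubring F)
    {x : F} (h : IsIntegral A x) : x ∈ A := by
  obtain ⟨y, rfl⟩ := IsIntegrallyClosed.isIntegral_iff.1 h
  exact y.2

namespace Place

section

variable {k F : Type*} [Field k] [Finite k] [Field F] [Algebra k F]

theorem algebraMap_mem (v : Place F) (c : k) : algebraMap k F c ∈ v.ring := by
  by_cases hc : c = 0
  · rw [hc, map_zero]; exact v.ring.zero_mem
  have := Fintype.ofFinite k
  have h2 := Fintype.one_lt_card (α := k)
  refine v.ring.mem_of_pow_eq_one (n := Fintype.card k - 1) (by omega) ?_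
  rw [← map_pow, FiniteField.pow_card_sub_one_eq_one c hc, map_one]

noncomputable instance (v : Place F) : Algebra k v.ring :=
  ((algebraMap k F).codRestrict v.ring.toSubring v.algebraMap_mem).toAlgebra

@[simp] theorem coe_algebraMap (v : Place F) (c : k) :
    ((algebraMap k v.ring c : v.ring) : F) = algebraMap k F c := rfl

instance (v : Place F) : IsScalarTower k v.ring F :=
  IsScalarTower.of_algebraMap_eq fun _ => rfl

theorem mem_of_isIntegral (v : Place F) {x : F} (h : IsIntegral k x) : x ∈ v.ring :=
  v.ring.mem_of_isIntegral h.tower_top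

theorem mem_of_isAlgebraic (v : Place F) {x : F} (h : IsAlgebraic k x) : x ∈ v.ring :=
  v.mem_of_isIntegral h.isIntegral

theorem transcendental_of_mem_nonunits (v : Place F) {x : F} (hx : x ≠ 0)
    (h : x ∈ v.ring.nonunits) : Transcendental k x := by
  intro ha
  rw [ValuationSubring.mem_nonunits_iff_or] at h
  exact (h.resolve_left hx) (v.mem_of_isAlgebraic ha.inv)

theorem finite_quotient [IsFunctionField k F] (v : Place F) {x : v.ring} (hx0 : x ≠ 0)
    (hx : x ∈ maximalIdeal v.ring) : Finite (v.ring ⧸ Ideal.span {x}) := by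
  have ht : Transcendental k (x : F) := v.transcendental_of_mem_nonunits
    (fun h => hx0 (Subtype.ext h)) (v.ring.coe_mem_nonunits_iff.2 hx)
  let O : Submodule k F := Subalgebra.toSubmodule (Algebra.ofId v.ring F |>.range.restrictScalars k)
  have hmem : ∀ y : O, (y : F) ∈ v.ring := by
    rintro ⟨y, z, rfl⟩
    exact z.2
  have hmem' : ∀ y ∈ v.ring, y ∈ O := fun y hy => ⟨⟨y, hy⟩, rfl⟩
  let π : O →ₗ[k] (v.ring ⧸ Ideal.span {x}) :=
    { toFun := fun y => Ideal.Quotient.mk _ (⟨y, hmem y⟩ : v.ring)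
      map_add' := fun y z => by rw [← map_add]; rfl
      map_smul' := fun c y => by
        have : (⟨(c • y : O), hmem _⟩ : v.ring) = c • (⟨y, hmem y⟩ : v.ring) :=
          Subtype.ext (by simp [Algebra.smul_def])
        rw [this]; rfl }
  have := (finrank_le_of_surjective (k := k) ht (O := O)
    (fun y hy => hmem' _ (v.ring.mul_mem _ _ x.2 (hmem ⟨y, hy⟩))) π
    (fun y => Ideal.Quotient.eq_zero_iff_mem.2 (Ideal.mem_span_singleton'.2
      ⟨⟨y, hmem y⟩, mul_comm _ _⟩))
    (fun z => by
      obtain ⟨y, rfl⟩ := Ideal.Quotient.mk_surjective z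
      exact ⟨⟨y, hmem' _ y.2⟩, rfl⟩)).1
  exact Module.finite_of_finite k

theorem exists_mem_maximalIdeal {F : Type*} [Field F] (v : Place F) :
    ∃ x : v.ring, x ≠ 0 ∧ x ∈ maximalIdeal v.ring := by
  by_contra! h
  refine v.ring_ne_top (top_unique fun x _ => ?_)
  rcases v.ring.mem_or_inv_mem x with hx | hx
  · exact hx
  · by_cases h0 : x = 0
    · rw [h0]; exact v.ring.zero_mem
    have hu : IsUnit (⟨x⁻¹, hx⟩ : v.ring) := by
      by_contra hu
      exact h _ (fun h' => h0 (by simpa using congrArg Subtype.val h')) ((mem_maximalIdeal _).2 hu)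
    obtain ⟨y, hy⟩ := hu.exists_right_inv
    have : x⁻¹ * (y : F) = 1 := congrArg Subtype.val hy
    rw [inv_mul_eq_one₀ h0] at this
    rw [this]; exact y.2

theorem isDiscreteValuationRing [IsFunctionField k F] (v : Place F) :
    IsDiscreteValuationRing v.ring := by
  have hN : IsNoetherianRing v.ring := by
    rw [isNoetherianRing_iff_ideal_fg]
    intro I
    by_cases hI : I = ⊥
    · rw [hI]; exact Submodule.fg_bot
    by_cases hI' : I = ⊤
    · rw [hI']; exact ⟨{1}, by simp⟩
    obtain ⟨x, hxI, hx0⟩ := Submodule.exists_mem_ne_zero_of_ne_bot hI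
    have := v.finite_quotient (k := k) hx0 (le_maximalIdeal hI' hxI)
    refine Submodule.fg_of_fg_map_of_fg_inf_ker (Submodule.mkQ (Ideal.span {x})) ?_ ?_
    · have : Finite (v.ring ⧸ (Ideal.span {x} : Ideal v.ring)) := this
      exact Submodule.fg_def.2 ⟨_, Set.toFinite _, Submodule.span_eq _⟩
    · rw [Submodule.ker_mkQ, inf_eq_right.2 ((Ideal.span_singleton_le_iff_mem _).2 hxI)]
      exact ⟨{x}, by simp⟩
  have : IsPrincipalIdealRing v.ring := inferInstance
  refine { not_a_field' := ?_ }
  obtain ⟨x, hx0, hx⟩ := v.exists_mem_maximalIdeal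
  exact fun h => hx0 (by simpa [h] using hx)

theorem finite_residueField [IsFunctionField k F] (v : Place F) :
    Finite (ResidueField v.ring) := by
  obtain ⟨x, hx0, hx⟩ := v.exists_mem_maximalIdeal
  have := v.finite_quotient (k := k) hx0 hx
  exact Finite.of_surjective _
    (Ideal.Quotient.factor_surjective ((Ideal.span_singleton_le_iff_mem (maximalIdeal v.ring)).2 hx))

end

end Place

/-- All places of `F` are discrete with finite residue field. -/
class HasDiscretePlaces (F : Type*) [Field F] : Prop where
  isDiscreteValuationRing (v : Place F) : IsDiscreteValuationRing v.ring
  finite_residueField (v : Place F) : Finite (ResidueField v.ring)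

attribute [instance] HasDiscretePlaces.isDiscreteValuationRing
  HasDiscretePlaces.finite_residueField

theorem IsFunctionField.hasDiscretePlaces (k F : Type*) [Field k] [Finite k] [Field F] [Algebra k F]
    [IsFunctionField k F] : HasDiscretePlaces F :=
  ⟨Place.isDiscreteValuationRing (k := k), Place.finite_residueField (k := k)⟩

namespace Place

section

variable {F : Type*} [Field F] [HasDiscretePlaces F]

/-- The normalized discrete valuation of a place. -/
noncomputable def val (v : Place F) : Valuation F ℤᵐ⁰ :=
  (IsDiscreteValuationRing.maximalIdeal v.ring).valuation F

/-- The order of `x` at a place. -/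
noncomputable def ord (v : Place F) (x : F) : ℤ := -log (v.val x)

theorem val_eq_exp (v : Place F) {x : F} (hx : x ≠ 0) : v.val x = exp (-v.ord x) := by
  rw [ord, neg_neg, exp_log ((Valuation.ne_zero_iff _).2 hx)]

theorem ord_mul (v : Place F) {x y : F} (hx : x ≠ 0) (hy : y ≠ 0) :
    v.ord (x * y) = v.ord x + v.ord y := by
  rw [ord, map_mul, log_mul ((Valuation.ne_zero_iff _).2 hx) ((Valuation.ne_zero_iff _).2 hy),
    ord, ord]
  ring

theorem ord_inv (v : Place F) (x : F) : v.ord x⁻¹ = - v.ord x := by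
  rw [ord, map_inv₀, log_inv, ord]

@[simp] theorem ord_one (v : Place F) : v.ord 1 = 0 := by simp [ord]

theorem ord_pow (v : Place F) (x : F) (n : ℕ) : v.ord (x ^ n) = n * v.ord x := by
  rw [ord, map_pow, log_pow, ord]; simp

theorem val_le_exp_iff (v : Place F) {x : F} (hx : x ≠ 0) (n : ℤ) :
    v.val x ≤ exp n ↔ -n ≤ v.ord x := by
  rw [v.val_eq_exp hx, exp_le_exp]; omega

theorem valuationSubring_val (v : Place F) : v.val.valuationSubring = v.ring := by
  refine (ValuationSubring.eq_of_le_of_ne_top (A := v.ring) (fun x hx => ?_) ?_).symm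
  · exact (IsDiscreteValuationRing.maximalIdeal v.ring).valuation_le_one (K := F) ⟨x, hx⟩
  · rw [ne_eq, Valuation.valuationSubring_eq_top_iff, not_not]
    exact inferInstanceAs
      (Valuation.IsNontrivial ((IsDiscreteValuationRing.maximalIdeal v.ring).valuation F))

theorem val_le_one_iff (v : Place F) {x : F} : v.val x ≤ 1 ↔ x ∈ v.ring := by
  rw [← Valuation.mem_valuationSubring_iff, valuationSubring_val]

theorem val_coe_lt_one_iff (v : Place F) (x : v.ring) :
    v.val x < 1 ↔ x ∈ maximalIdeal v.ring :=
  (IsDiscreteValuationRing.maximalIdeal v.ring).valuation_lt_one_iff_mem x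

theorem mem_nonunits_iff (v : Place F) {x : F} : x ∈ v.ring.nonunits ↔ v.val x < 1 := by
  constructor
  · intro h
    have := (v.val_coe_lt_one_iff ⟨x, v.ring.nonunits_le h⟩).2 (v.ring.coe_mem_nonunits_iff.1 h)
    exact this
  · intro h
    have := (v.val_coe_lt_one_iff ⟨x, v.val_le_one_iff.1 h.le⟩).1 h
    exact v.ring.coe_mem_nonunits_iff.2 this

theorem ord_nonneg_iff (v : Place F) {x : F} (hx : x ≠ 0) : 0 ≤ v.ord x ↔ x ∈ v.ring := by
  rw [← v.val_le_one_iff, ← exp_zero, v.val_le_exp_iff hx, neg_zero]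

theorem ord_pos_iff (v : Place F) {x : F} (hx : x ≠ 0) : 0 < v.ord x ↔ x ∈ v.ring.nonunits := by
  rw [v.mem_nonunits_iff, v.val_eq_exp hx, ← exp_zero, exp_lt_exp]; omega

theorem exists_ord_eq_one (v : Place F) : ∃ π : F, π ≠ 0 ∧ v.ord π = 1 := by
  obtain ⟨π, h⟩ := (IsDiscreteValuationRing.maximalIdeal v.ring).valuation_exists_uniformizer F
  refine ⟨π, fun h0 => ?_, ?_⟩
  · rw [h0, map_zero] at h; exact exp_ne_zero h.symm
  · rw [ord, val, h]; simp

theorem exists_ord_eq (v : Place F) (n : ℤ) : ∃ x : F, x ≠ 0 ∧ v.ord x = n := by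
  obtain ⟨π, h0, h⟩ := v.exists_ord_eq_one
  refine ⟨π ^ n, zpow_ne_zero _ h0, ?_⟩
  rw [ord, map_zpow₀, log_zpow, smul_eq_mul, ← mul_neg, ← ord, h, mul_one]

theorem ord_irreducible (v : Place F) {ϖ : v.ring} (h : Irreducible ϖ) : v.ord (ϖ : F) = 1 := by
  have h2 : v.val (ϖ : F) = exp (-1 : ℤ) :=
    ((IsDiscreteValuationRing.maximalIdeal v.ring).valuation_of_algebraMap (K := F) ϖ).trans
      ((IsDiscreteValuationRing.maximalIdeal v.ring).intValuation_singleton h.ne_zero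
        h.maximalIdeal_eq)
  rw [ord, h2]; simp

theorem ord_isUnit (v : Place F) {u : v.ring} (h : IsUnit u) : v.ord (u : F) = 0 := by
  have h1 : v.val (u : F) = 1 := by
    refine le_antisymm (v.val_le_one_iff.2 u.2) (not_lt.1 fun h' => ?_)
    exact (mem_maximalIdeal _).1 ((v.val_coe_lt_one_iff u).1 h') h
  rw [ord, h1]; simp

theorem card_quotient_span (v : Place F) {x : v.ring} (hx : x ≠ 0) :
    Nat.card (v.ring ⧸ Ideal.span {x}) = v.residueCard ^ (v.ord x).toNat := by
  obtain ⟨ϖ, hϖ⟩ := IsDiscreteValuationRing.exists_irreducible v.ring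
  obtain ⟨n, hn⟩ := IsDiscreteValuationRing.associated_pow_irreducible hx hϖ
  have hm := hϖ.maximalIdeal_eq
  have h1 : Ideal.span {x} = maximalIdeal v.ring ^ n := by
    rw [hm, Ideal.span_singleton_pow, Ideal.span_singleton_eq_span_singleton]; exact hn
  have hord : v.ord (x : F) = n := by
    obtain ⟨u, hu⟩ := hn
    have h2 : (x : F) * ((u : v.ring) : F) = (ϖ : F) ^ n := by
      rw [← SubmonoidClass.coe_pow, ← hu]; rfl
    have h3 := congrArg v.ord h2
    rw [v.ord_mul (by simpa using hx) (by simp), v.ord_isUnit u.isUnit, v.ord_pow,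
      v.ord_irreducible hϖ] at h3
    simpa using h3
  rw [hord, h1]
  have := cardQuot_pow_of_prime (P := maximalIdeal v.ring) (i := n)
    (IsDiscreteValuationRing.not_a_field _)
  rw [Submodule.cardQuot_apply, Submodule.cardQuot_apply] at this
  exact this

end

end Place

end GlobalFunctionField

namespace GlobalFunctionField

open Polynomial IsLocalRing WithZero

namespace Place

section

variable {F : Type*} [Field F] [HasDiscretePlaces F]

/-- A real absolute value attached to a place. -/
noncomputable def realAbv (v : Place F) : AbsoluteValue F ℝ :=
  (IsDiscreteValuationRing.maximalIdeal v.ring).adicAbv (b := 2) one_lt_two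

theorem realAbv_le_realAbv (v : Place F) (x y : F) :
    v.realAbv x ≤ v.realAbv y ↔ v.val x ≤ v.val y :=
  (WithZeroMulInt.toNNReal_strictMono (e := 2) one_lt_two).le_iff_le

theorem eq_of_isEquiv_realAbv {v w : Place F} (h : v.realAbv.IsEquiv w.realAbv) : v = w := by
  have : v.ring = w.ring := by
    apply ValuationSubring.ext
    intro x
    have := h x 1
    rwa [realAbv_le_realAbv, realAbv_le_realAbv, map_one, map_one, v.val_le_one_iff,
      w.val_le_one_iff] at this
  cases v; cases w; simpa using this

theorem isNontrivial_realAbv (v : Place F) : v.realAbv.IsNontrivial := by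
  obtain ⟨π, h0, h⟩ := v.exists_ord_eq_one
  refine ⟨π, h0, fun h1 => ?_⟩
  have h2 : v.realAbv 1 ≤ v.realAbv π := by rw [h1, map_one]
  rw [realAbv_le_realAbv, v.val_eq_exp h0, h, map_one, ← exp_zero, exp_le_exp] at h2
  omega

/-- Weak approximation at finitely many places. -/
theorem exists_val_sub_le (S : Finset (Place F)) (a : S → F) {y : F} (hy : y ≠ 0) :
    ∃ u : F, ∀ v : S, v.1.val (u - a v) ≤ v.1.val y := by
  have hd := AbsoluteValue.denseRange_algebraMap_pi (v := fun v : S => v.1.realAbv)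
    (fun v => v.1.isNontrivial_realAbv)
    (fun v w hvw h => hvw (Subtype.ext (eq_of_isEquiv_realAbv h)))
  set a' : (v : S) → WithAbs v.1.realAbv := fun v => WithAbs.toAbs _ (a v)
  have hopen : IsOpen {z : (v : S) → WithAbs v.1.realAbv | ∀ v, ‖z v - a' v‖ < v.1.realAbv y} := by
    simp only [Set.ofPred_forall]
    exact isOpen_iInter_of_finite fun v => isOpen_lt (by fun_prop) continuous_const
  obtain ⟨u, hu⟩ := hd.exists_mem_open hopen
    ⟨a', fun v => by simpa using v.1.realAbv.pos hy⟩
  refine ⟨u, fun v => ?_⟩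
  rw [← realAbv_le_realAbv]
  exact (hu v).le

end

variable (k : Type*) {F : Type*} [Field k] [Finite k] [Field F] [Algebra k F]

/-- The degree of a place over the finite field `k`. -/
noncomputable def degree (v : Place F) : ℕ := Module.finrank k (ResidueField v.ring)

variable [HasDiscretePlaces F]

instance (v : Place F) : Module.Finite k (ResidueField v.ring) := Module.Finite.of_finite

theorem residueCard_eq (v : Place F) : v.residueCard = Nat.card k ^ v.degree k :=
  Module.natCard_eq_pow_finrank

theorem degree_pos (v : Place F) : 0 < v.degree k := Module.finrank_pos

open scoped IntermediateField in
theorem sum_ord_mul_degree_le [IsFunctionField k F] {x : F} (hx : Transcendental k x)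
    (S : Finset (Place F)) (hS : ∀ v ∈ S, 0 < v.ord x) :
    ∑ v ∈ S, v.ord x * v.degree k ≤ Module.finrank k⟮x⟯ F := by
  classical
  have hx0 : x ≠ 0 := fun h => hx (h ▸ isAlgebraic_zero)
  have hxm : ∀ v : S, x ∈ v.1.ring := fun v => (v.1.ord_nonneg_iff hx0).1 (hS v v.2).le
  let O : Submodule k F :=
    { carrier := {f | ∀ v : S, f ∈ v.1.ring}
      add_mem' := fun ha hb v => v.1.ring.add_mem _ _ (ha v) (hb v)
      zero_mem' := fun v => v.1.ring.zero_mem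
      smul_mem' := fun c f hf v => by
        rw [Algebra.smul_def]; exact v.1.ring.mul_mem _ _ (v.1.algebraMap_mem c) (hf v) }
  let X : ∀ v : S, v.1.ring := fun v => ⟨x, hxm v⟩
  have hX0 : ∀ v : S, X v ≠ 0 := fun v h => hx0 (congrArg Subtype.val h)
  let π : O →ₗ[k] (∀ v : S, v.1.ring ⧸ Ideal.span {X v}) :=
    { toFun := fun y v => Ideal.Quotient.mk _ (⟨y, y.2 v⟩ : v.1.ring)
      map_add' := fun y z => by funext v; rw [Pi.add_apply, ← map_add]; rfl
      map_smul' := fun c y => by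
        funext v
        have : (⟨(c • y : O), (c • y).2 v⟩ : v.1.ring) = c • (⟨y, y.2 v⟩ : v.1.ring) :=
          Subtype.ext (by simp [Algebra.smul_def])
        rw [this]; rfl }
  obtain ⟨h1, h2⟩ := finrank_le_of_surjective (k := k) hx (O := O)
    (fun y hy v => v.1.ring.mul_mem _ _ (hxm v) (hy v)) π
    (fun y => funext fun v => Ideal.Quotient.eq_zero_iff_mem.2 (Ideal.mem_span_singleton'.2
      ⟨⟨y, y.2 v⟩, mul_comm _ _⟩))
    (fun z => by
      choose a ha using fun v : S => Ideal.Quotient.mk_surjective (z v)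
      obtain ⟨u, hu⟩ := exists_val_sub_le S (fun v => (a v : F)) hx0
      have hu' : ∀ v : S, (u - a v) / x ∈ v.1.ring := by
        intro v
        rw [← v.1.val_le_one_iff, map_div₀]
        exact div_le_one_of_le₀ (hu v) zero_le
      have hu'' : ∀ v : S, u - a v = (u - a v) / x * x := fun v => by
        rw [div_mul_cancel₀ _ hx0]
      refine ⟨⟨u, fun v => ?_⟩, ?_⟩
      · have := v.1.ring.add_mem _ _ (v.1.ring.mul_mem _ _ (hu' v) (hxm v)) (a v).2
        rwa [← hu'', sub_add_cancel] at this
      · funext v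
        rw [← ha v]
        refine Ideal.Quotient.eq.2 (Ideal.mem_span_singleton'.2 ⟨⟨_, hu' v⟩, ?_⟩)
        exact Subtype.ext (hu'' v).symm)
  have hcard := Module.natCard_eq_pow_finrank (K := k) (V := ∀ v : S, v.1.ring ⧸ Ideal.span {X v})
  rw [Nat.card_pi] at hcard
  have h3 : ∏ v : S, Nat.card (v.1.ring ⧸ Ideal.span {X v}) =
      Nat.card k ^ (∑ v : S, v.1.degree k * (v.1.ord x).toNat) := by
    rw [← Finset.prod_pow_eq_pow_sum]
    refine Finset.prod_congr rfl fun v _ => ?_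
    rw [v.1.card_quotient_span (hX0 v), v.1.residueCard_eq k, pow_mul]
  rw [h3] at hcard
  have hk : 1 < Nat.card k := Finite.one_lt_card
  have h4 := Nat.pow_right_injective hk hcard
  rw [← h4, Finset.sum_coe_sort S (fun v => v.degree k * (v.ord x).toNat)] at h2
  calc ∑ v ∈ S, v.ord x * v.degree k = ((∑ v ∈ S, v.degree k * (v.ord x).toNat : ℕ) : ℤ) := by
        push_cast
        refine Finset.sum_congr rfl fun v hv => ?_
        rw [Int.toNat_of_nonneg (hS v hv).le, mul_comm]
    _ ≤ _ := by exact_mod_cast h2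

theorem finite_setOf_ord_pos [IsFunctionField k F] {x : F} (hx : Transcendental k x) :
    {v : Place F | 0 < v.ord x}.Finite := by
  by_contra h
  obtain ⟨S, hS, hc⟩ := Set.Infinite.exists_subset_card_eq h
    (Module.finrank (IntermediateField.adjoin k {x}) F + 1)
  have h1 := sum_ord_mul_degree_le k hx S (fun v hv => hS hv)
  have h2 : ∑ v ∈ S, (1 : ℤ) ≤ ∑ v ∈ S, v.ord x * v.degree k := by
    refine Finset.sum_le_sum fun v hv => ?_
    have h3 : 0 < v.ord x := hS hv
    have h4 := v.degree_pos k
    have h5 : 0 < v.ord x * v.degree k := by positivity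
    omega
  simp [hc] at h2
  omega

end Place

end GlobalFunctionField

namespace GlobalFunctionField

open Polynomial IsLocalRing WithZero

theorem exists_place_mem_nonunits {k F : Type*} [Field k] [Field F] [Algebra k F] {x : F}
    (hx : Transcendental k x) : ∃ v : Place F, x ∈ v.ring.nonunits := by
  have hx0 : x ≠ 0 := fun h => hx (h ▸ isAlgebraic_zero)
  let A : Subring F := (Algebra.adjoin k {x}).toSubring
  let X' : A := ⟨x, Algebra.subset_adjoin rfl⟩
  have hI : Ideal.span {X'} ≠ ⊤ := by
    rw [ne_eq, Ideal.span_singleton_eq_top]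
    intro hu
    obtain ⟨⟨y, hy⟩, hxy⟩ := hu.exists_right_inv
    have hxy' : x * y = 1 := congrArg Subtype.val hxy
    obtain ⟨p, rfl⟩ := (Algebra.adjoin_singleton_eq_range_aeval k x).le hy
    refine hx ⟨X * p - 1, fun h => ?_, ?_⟩
    · have := congrArg (Polynomial.eval 0) h
      simp at this
    · simp only [map_sub, map_mul, aeval_X, map_one]
      exact sub_eq_zero.2 hxy'
  obtain ⟨B, -, hB⟩ := Ideal.image_subset_nonunits_valuationSubring _ hI
  have hxB : x ∈ B.nonunits := hB ⟨X', Ideal.mem_span_singleton_self _, rfl⟩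
  refine ⟨⟨B, fun h => ?_⟩, hxB⟩
  rw [ValuationSubring.mem_nonunits_iff_or] at hxB
  exact hxB.resolve_left hx0 (h ▸ ValuationSubring.mem_top _)

theorem exists_transcendental (k F : Type*) [Field k] [Field F] [Algebra k F]
    [h : IsFunctionField k F] : ∃ x : F, Transcendental k x := by
  have : Algebra.Transcendental k F := by
    rw [← trdeg_ne_zero_iff, h.trdeg_eq_one]; exact one_ne_zero
  exact this.transcendental

/-- The divisors of a function field. -/
abbrev Divisor (F : Type*) [Field F] : Type _ := Place F →₀ ℤ

section

variable (k : Type*) {F : Type*} [Field k] [Finite k] [Field F] [Algebra k F]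

theorem nonempty_place (k F : Type*) [Field k] [Field F] [Algebra k F] [IsFunctionField k F] : Nonempty (Place F) := by
  obtain ⟨x, hx⟩ := exists_transcendental k F
  exact ⟨(exists_place_mem_nonunits hx).choose⟩

/-- The degree of a divisor. -/
noncomputable def Divisor.deg : Divisor F →+ ℤ :=
  Finsupp.liftAddHom fun v => (AddMonoidHom.mulRight (v.degree k : ℤ))

theorem Divisor.deg_single (v : Place F) (n : ℤ) :
    Divisor.deg k (Finsupp.single v n) = n * v.degree k := by
  simp [Divisor.deg]

theorem Divisor.deg_eq_sum (D : Divisor F) {S : Finset (Place F)} (h : D.support ⊆ S) :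
    Divisor.deg k D = ∑ v ∈ S, D v * v.degree k := by
  rw [Divisor.deg, Finsupp.liftAddHom_apply, Finsupp.sum_of_support_subset _ h _ (by simp)]
  rfl

variable [HasDiscretePlaces F]

/-- The Riemann–Roch space `L(D)`. -/
def Divisor.space (D : Divisor F) : Submodule k F where
  carrier := {f | ∀ v, v.val f ≤ exp (D v)}
  add_mem' := fun {a b} ha hb v => (v.val.map_add a b).trans (max_le (ha v) (hb v))
  zero_mem' := fun v => by simp
  smul_mem' := fun c f hf v => by
    rw [Algebra.smul_def, map_mul]
    exact (mul_le_of_le_one_left' (v.val_le_one_iff.2 (v.algebraMap_mem c))).trans (hf v)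

variable {k}

theorem Divisor.mem_space {D : Divisor F} {f : F} :
    f ∈ D.space k ↔ ∀ v, v.val f ≤ exp (D v) := Iff.rfl

theorem Divisor.mem_space_iff {D : Divisor F} {f : F} (hf : f ≠ 0) :
    f ∈ D.space k ↔ ∀ v, 0 ≤ D v + v.ord f := by
  rw [Divisor.mem_space]
  refine forall_congr' fun v => ?_
  rw [v.val_le_exp_iff hf]
  omega

theorem Divisor.space_mono {D E : Divisor F} (h : D ≤ E) : D.space k ≤ E.space k :=
  fun _ hf v => (hf v).trans (exp_le_exp.2 (h v))

theorem Divisor.space_add_single (D : Divisor F) (v : Place F) [Module.Finite k (D.space k)] :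
    Module.Finite k ((D + Finsupp.single v 1).space k) ∧
    Module.finrank k ((D + Finsupp.single v 1).space k) ≤
      Module.finrank k (D.space k) + v.degree k := by
  classical
  set E := D + Finsupp.single v 1 with hE
  have hEv : E v = D v + 1 := by simp [hE]
  obtain ⟨t, ht0, ht⟩ := v.exists_ord_eq (E v)
  have hmem : ∀ f : E.space k, (f : F) * t ∈ v.ring := by
    intro f
    rw [← v.val_le_one_iff, map_mul, v.val_eq_exp ht0, ht]
    refine (mul_le_mul_left (f.2 v) _).trans ?_
    rw [← exp_add]; simp
  let π : E.space k →ₗ[k] ResidueField v.ring :=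
    { toFun := fun f => residue v.ring ⟨(f : F) * t, hmem f⟩
      map_add' := fun f g => by
        rw [← map_add]; congr 1; exact Subtype.ext (add_mul _ _ _)
      map_smul' := fun c f => by
        have : (⟨((c • f : E.space k) : F) * t, hmem _⟩ : v.ring) =
            c • (⟨(f : F) * t, hmem f⟩ : v.ring) :=
          Subtype.ext (by simp [Algebra.smul_def, mul_assoc])
        rw [this]; rfl }
  have hker : ∀ f ∈ LinearMap.ker π, (f : F) ∈ D.space k := by
    intro f hf w
    by_cases hw : w = v
    · subst hw
      have h1 : (⟨(f : F) * t, hmem f⟩ : w.ring) ∈ maximalIdeal w.ring :=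
        (residue_eq_zero_iff _).1 hf
      rw [← w.val_coe_lt_one_iff] at h1
      by_cases hf0 : (f : F) = 0
      · rw [hf0, map_zero]; exact zero_le
      rw [w.val_le_exp_iff hf0]
      change w.val ((f : F) * t) < 1 at h1
      rw [w.val_eq_exp (mul_ne_zero hf0 ht0), ← exp_zero, exp_lt_exp, w.ord_mul hf0 ht0, ht] at h1
      omega
    · have := f.2 w
      simpa [hE, Finsupp.single_apply, Ne.symm hw] using this
  let ι : LinearMap.ker π →ₗ[k] D.space k :=
    ((E.space k).subtype.comp (LinearMap.ker π).subtype).codRestrict (D.space k)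
      (fun f => hker f f.2)
  have hι : Function.Injective ι := by
    intro f g h
    exact Subtype.ext (Subtype.ext (congrArg (fun z : D.space k => (z : F)) h))
  have : Module.Finite k (LinearMap.ker π) := Module.Finite.of_injective ι hι
  have hfin : Module.Finite k (E.space k) := by
    have h1 : (LinearMap.ker π).FG := Module.Finite.iff_fg.1 this
    have : Module.Finite k (⊤ : Submodule k (E.space k)) := by
      refine Module.Finite.iff_fg.2 (Submodule.fg_of_fg_map_of_fg_inf_ker π ?_ ?_)
      · exact IsNoetherian.noetherian _
      · rwa [top_inf_eq]
    exact Module.Finite.of_surjective _ (Submodule.topEquiv (R := k) (M := E.space k)).surjective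
  refine ⟨hfin, ?_⟩
  rw [← LinearMap.finrank_range_add_finrank_ker π, add_comm]
  exact add_le_add (LinearMap.finrank_le_finrank_of_injective hι) (Submodule.finrank_le _)

theorem Divisor.space_add_of_nonneg (E : Place F →₀ ℕ) : ∀ (D : Divisor F) (_ : Module.Finite k (D.space k)),
    Module.Finite k ((D + E.mapRange Nat.cast Nat.cast_zero).space k) ∧
    (Module.finrank k ((D + E.mapRange Nat.cast Nat.cast_zero).space k) : ℤ) ≤
      Module.finrank k (D.space k) + Divisor.deg k (E.mapRange Nat.cast Nat.cast_zero) := by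
  induction E using Finsupp.induction_linear with
  | zero =>
    intro D hD
    rw [Finsupp.mapRange_zero, add_zero, map_zero, add_zero]
    exact ⟨hD, le_rfl⟩
  | add E E' h h' =>
    intro D hD
    have e : (E + E').mapRange (Nat.cast : ℕ → ℤ) Nat.cast_zero =
        E.mapRange Nat.cast Nat.cast_zero + E'.mapRange Nat.cast Nat.cast_zero :=
      Finsupp.mapRange_add Nat.cast_add _ _
    obtain ⟨h1, h2⟩ := h D hD
    obtain ⟨h3, h4⟩ := h' _ h1
    rw [e, ← add_assoc, map_add]
    exact ⟨h3, by linarith⟩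
  | single v n =>
    intro D hD
    rw [Finsupp.mapRange_single]
    induction n with
    | zero =>
      rw [Nat.cast_zero, Finsupp.single_zero, add_zero, map_zero, add_zero]
      exact ⟨hD, le_rfl⟩
    | succ n ih =>
      have e : Finsupp.single v ((n + 1 : ℕ) : ℤ) = Finsupp.single v (n : ℤ) + Finsupp.single v 1 := by
        rw [← Finsupp.single_add]; simp
      obtain ⟨h1, h2⟩ := ih
      obtain ⟨h3, h4⟩ := (D + Finsupp.single v (n : ℤ)).space_add_single (k := k) v
      rw [e, ← add_assoc, map_add]
      refine ⟨h3, ?_⟩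
      rw [Divisor.deg_single k v 1, one_mul]
      have : (Module.finrank k ((D + Finsupp.single v (n : ℤ) + Finsupp.single v 1).space k) : ℤ) ≤
        Module.finrank k ((D + Finsupp.single v (n : ℤ)).space k) + v.degree k := by exact_mod_cast h4
      linarith

theorem Divisor.space_of_le {D E : Divisor F} (h : D ≤ E) [hD : Module.Finite k (D.space k)] :
    Module.Finite k (E.space k) ∧
    (Module.finrank k (E.space k) : ℤ) - Divisor.deg k E ≤
      Module.finrank k (D.space k) - Divisor.deg k D := by
  have e : D + ((E - D).mapRange Int.toNat rfl).mapRange Nat.cast Nat.cast_zero = E := by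
    ext v
    have := h v
    simp only [Finsupp.add_apply, Finsupp.mapRange_apply, Finsupp.sub_apply]
    omega
  have := Divisor.space_add_of_nonneg ((E - D).mapRange Int.toNat rfl) D hD
  have e2 := congrArg (Divisor.deg k) e
  rw [map_add] at e2
  rw [e] at this
  exact ⟨this.1, by linarith [this.2]⟩

theorem space_neg_single_eq_bot (v : Place F) :
    Divisor.space k (Finsupp.single v (-1) : Divisor F) = ⊥ := by
  classical
  rw [eq_bot_iff]
  intro f hf
  by_contra hf0
  rw [Submodule.mem_bot] at hf0
  rw [Divisor.mem_space_iff hf0] at hf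
  have h1 : Transcendental k f := v.transcendental_of_mem_nonunits hf0
    ((v.ord_pos_iff hf0).1 (by have := hf v; simp at this; omega))
  have h2 : Transcendental k f⁻¹ := fun h => h1 (by simpa using h.inv)
  obtain ⟨w, hw⟩ := exists_place_mem_nonunits h2
  rw [← w.ord_pos_iff (inv_ne_zero hf0), w.ord_inv] at hw
  have := hf w
  rw [Finsupp.single_apply] at this
  split_ifs at this <;> omega

variable (k) in
theorem Divisor.finite_space [IsFunctionField k F] (D : Divisor F) :
    Module.Finite k (D.space k) := by
  classical
  obtain ⟨v⟩ := nonempty_place k F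
  have h0 : Module.Finite k (Divisor.space k (Finsupp.single v (-1) : Divisor F)) := by
    rw [space_neg_single_eq_bot]; infer_instance
  have h1 := (Divisor.space_of_le (k := k) (D := Finsupp.single v (-1))
    (E := Finsupp.single v (-1) ⊔ D) le_sup_left).1
  exact Module.Finite.of_injective (Submodule.inclusion (Divisor.space_mono
    (le_sup_right : D ≤ Finsupp.single v (-1) ⊔ D)))
    (Submodule.inclusion_injective _)

end

end GlobalFunctionField

namespace GlobalFunctionField

open Polynomial IsLocalRing WithZero

section

variable (k : Type*) {F : Type*} [Field k] [Finite k] [Field F] [Algebra k F]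
  [HasDiscretePlaces F] [IsFunctionField k F]

theorem Place.ord_eq_zero_of_isAlgebraic {k F : Type*} [Field k] [Finite k] [Field F] [Algebra k F]
    [HasDiscretePlaces F] {x : F} (hx : IsAlgebraic k x) (v : Place F) :
    v.ord x = 0 := by
  by_cases h0 : x = 0
  · simp [h0, ord]
  have h1 := (v.ord_nonneg_iff h0).2 (v.mem_of_isAlgebraic hx)
  have h2 := (v.ord_nonneg_iff (inv_ne_zero h0)).2 (v.mem_of_isAlgebraic hx.inv)
  rw [v.ord_inv] at h2
  omega

theorem finite_setOf_ord_ne_zero (k : Type*) {F : Type*} [Field k] [Finite k] [Field F] [Algebra k F]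
    [HasDiscretePlaces F] [IsFunctionField k F] (x : F) : {v : Place F | v.ord x ≠ 0}.Finite := by
  by_cases hx : Transcendental k x
  · have hx' : Transcendental k x⁻¹ := fun h => hx (by simpa using h.inv)
    refine ((Place.finite_setOf_ord_pos k hx).union (Place.finite_setOf_ord_pos k hx')).subset ?_
    intro v hv
    rcases lt_or_gt_of_ne hv with h | h
    · right; change 0 < v.ord x⁻¹; rw [v.ord_inv]; omega
    · left; exact h
  · have hx : IsAlgebraic k x := not_not.1 hx
    convert Set.finite_empty (α := Place F)
    exact Set.eq_empty_of_forall_notMem fun v hv => hv (Place.ord_eq_zero_of_isAlgebraic hx v)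

/-- The divisor of a function. -/
noncomputable def principalDivisor (x : F) : Divisor F :=
  Finsupp.ofSupportFinite (fun v => v.ord x) (finite_setOf_ord_ne_zero k x)

theorem principalDivisor_apply (x : F) (v : Place F) : principalDivisor k x v = v.ord x := rfl

theorem principalDivisor_mul {x y : F} (hx : x ≠ 0) (hy : y ≠ 0) : principalDivisor k (x * y) = principalDivisor k x + principalDivisor k y := by
  ext v
  simp [principalDivisor_apply, v.ord_mul hx hy]

theorem principalDivisor_inv (x : F) : principalDivisor k x⁻¹ = -principalDivisor k x := by
  ext v
  simp [principalDivisor_apply, v.ord_inv]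

variable {k}

open scoped IntermediateField in
theorem deg_sup_zero_le {x : F} (hx : Transcendental k x) :
    Divisor.deg k (principalDivisor k x ⊔ 0) ≤ Module.finrank k⟮x⟯ F := by
  classical
  have hfin := Place.finite_setOf_ord_pos k hx
  rw [Divisor.deg_eq_sum k _ (S := hfin.toFinset) (fun v hv => by
    simp only [Finsupp.mem_support_iff, Finsupp.sup_apply, principalDivisor_apply, Finsupp.zero_apply] at hv
    simp only [Set.Finite.mem_toFinset, Set.mem_ofPred_eq]
    by_contra h
    exact hv (max_eq_right (by omega)))]
  refine le_trans (le_of_eq (Finset.sum_congr rfl fun v hv => ?_))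
    (Place.sum_ord_mul_degree_le k hx hfin.toFinset (fun v hv => by simpa using hv))
  simp only [Set.Finite.mem_toFinset, Set.mem_ofPred_eq] at hv
  simp only [Finsupp.sup_apply, principalDivisor_apply, Finsupp.zero_apply]
  rw [max_eq_left hv.le]

open scoped IntermediateField in
/-- Functions with poles of bounded order at the poles of `x`. -/
theorem exists_le_finrank_space {x : F} (hx : Transcendental k x) :
    ∃ C : Divisor F, 0 ≤ C ∧ ∀ m : ℕ, Module.finrank k⟮x⟯ F * (m + 1) ≤
      Module.finrank k ((m • (principalDivisor k x⁻¹ ⊔ 0) + C).space k) := by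
  classical
  have := finiteDimensional_adjoin hx
  have hx0 : x ≠ 0 := fun h => hx (h ▸ isAlgebraic_zero)
  let b := Module.finBasis k⟮x⟯ F
  let C : Divisor F := Finset.univ.sup' (⟨⟨0, Module.finrank_pos⟩, Finset.mem_univ _⟩)
    (fun i => principalDivisor k (b i)⁻¹) ⊔ 0
  have hC : ∀ i, principalDivisor k (b i)⁻¹ ≤ C := fun i =>
    (Finset.le_sup' (fun i => principalDivisor k (b i)⁻¹) (Finset.mem_univ i)).trans le_sup_left
  refine ⟨C, le_sup_right, fun m => ?_⟩
  have := Divisor.finite_space k (m • (principalDivisor k x⁻¹ ⊔ 0) + C)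
  have hlin : LinearIndependent k (fun i : Fin (m + 1) =>
      (IntermediateField.AdjoinSimple.gen k x) ^ (i : ℕ)) := by
    have ht : Transcendental k (IntermediateField.AdjoinSimple.gen k x) := by
      intro h
      refine hx ?_
      have := h.algHom (k⟮x⟯.val)
      simpa using this
    have h1 := ((Polynomial.basisMonomials k).linearIndependent.map'
      (aeval (IntermediateField.AdjoinSimple.gen k x)).toLinearMap
      (LinearMap.ker_eq_bot.2 (transcendental_iff_injective.1 ht))).comp _
      (Fin.val_injective (n := m + 1))
    simpa [Function.comp_def] using h1
  have h := linearIndependent_smul hlin b.linearIndependent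
  have hmem : ∀ p : Fin (m + 1) × Fin (Module.finrank k⟮x⟯ F),
      IntermediateField.AdjoinSimple.gen k x ^ (p.1 : ℕ) • b p.2 ∈
        (m • (principalDivisor k x⁻¹ ⊔ 0) + C).space k := by
    rintro ⟨i, j⟩
    have e : IntermediateField.AdjoinSimple.gen k x ^ (i : ℕ) • b j = x ^ (i : ℕ) * b j := by
      rw [IntermediateField.smul_def]; simp
    rw [e, Divisor.mem_space_iff (mul_ne_zero (pow_ne_zero _ hx0) (b.ne_zero j))]
    intro v
    have h1 := hC j v
    rw [principalDivisor_apply, v.ord_inv] at h1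
    rw [v.ord_mul (pow_ne_zero _ hx0) (b.ne_zero j), v.ord_pow]
    simp only [Finsupp.add_apply, Finsupp.smul_apply, Finsupp.sup_apply, principalDivisor_apply,
      v.ord_inv, Finsupp.zero_apply, nsmul_eq_mul]
    have h2 : ((i : ℕ) : ℤ) ≤ m := by have := i.2; omega
    have h3 : -v.ord x ≤ max (-v.ord x) 0 := le_max_left _ _
    have h4 : 0 ≤ max (-v.ord x) 0 := le_max_right _ _
    nlinarith [mul_le_mul_of_nonneg_right h2 h4, Int.natCast_nonneg (i : ℕ)]
  have h5 : LinearIndependent k (fun p => (⟨_, hmem p⟩ :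
      (m • (principalDivisor k x⁻¹ ⊔ 0) + C).space k)) :=
    LinearIndependent.of_comp (Submodule.subtype _) h
  have h6 := h5.fintype_card_le_finrank
  simpa [mul_comm] using h6

theorem Divisor.deg_nonneg {D : Divisor F} (h : 0 ≤ D) : 0 ≤ Divisor.deg k D := by
  rw [Divisor.deg_eq_sum k D subset_rfl]
  exact Finset.sum_nonneg fun v _ => mul_nonneg (h v) (by positivity)

open scoped IntermediateField in
theorem exists_finrank_mul_le {x : F} (hx : Transcendental k x) :
    ∃ γ : ℤ, ∀ m : ℕ, (Module.finrank k⟮x⟯ F : ℤ) * m ≤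
      Module.finrank k ((m • (principalDivisor k x⁻¹ ⊔ 0)).space k) + γ := by
  obtain ⟨C, hC, h⟩ := exists_le_finrank_space hx
  refine ⟨Divisor.deg k C, fun m => ?_⟩
  have := Divisor.finite_space k (m • (principalDivisor k x⁻¹ ⊔ 0))
  have h1 := (Divisor.space_of_le (k := k) (D := m • (principalDivisor k x⁻¹ ⊔ 0))
    (E := m • (principalDivisor k x⁻¹ ⊔ 0) + C) (le_add_of_nonneg_right hC)).2
  rw [map_add] at h1
  have h2 : ((Module.finrank k⟮x⟯ F : ℕ) : ℤ) * (m + 1) ≤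
    Module.finrank k ((m • (principalDivisor k x⁻¹ ⊔ 0) + C).space k) := by exact_mod_cast h m
  have h3 : (0 : ℤ) ≤ Module.finrank k⟮x⟯ F := by positivity
  linarith

open scoped IntermediateField in
theorem finrank_le_deg_sup_zero {x : F} (hx : Transcendental k x) :
    (Module.finrank k⟮x⟯ F : ℤ) ≤ Divisor.deg k (principalDivisor k x⁻¹ ⊔ 0) := by
  obtain ⟨γ, h⟩ := exists_finrank_mul_le hx
  set B := principalDivisor k x⁻¹ ⊔ 0
  have hB : 0 ≤ B := le_sup_right
  have h0 := Divisor.finite_space k (0 : Divisor F)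
  by_contra! hlt
  set M : ℕ := (Module.finrank k ((0 : Divisor F).space k) + γ + 1).toNat
  have h1 := h M
  have h2 := (Divisor.space_of_le (k := k) (D := 0) (E := M • B) (nsmul_nonneg hB M)).2
  rw [map_nsmul, map_zero, nsmul_eq_mul] at h2
  have h3 : (Module.finrank k ((0 : Divisor F).space k) + γ + 1) ≤ (M : ℤ) := Int.self_le_toNat _
  nlinarith

open scoped IntermediateField in
theorem finrank_adjoin_inv (x : F) : Module.finrank k⟮x⁻¹⟯ F = Module.finrank k⟮x⟯ F := by
  have : k⟮x⁻¹⟯ = k⟮x⟯ := by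
    apply le_antisymm <;> rw [IntermediateField.adjoin_simple_le_iff]
    · exact inv_mem (IntermediateField.mem_adjoin_simple_self k x)
    · simpa using inv_mem (IntermediateField.mem_adjoin_simple_self k x⁻¹)
  rw [this]

open scoped IntermediateField in
theorem deg_sup_zero_eq {x : F} (hx : Transcendental k x) :
    Divisor.deg k (principalDivisor k x ⊔ 0) = Module.finrank k⟮x⟯ F := by
  refine le_antisymm (deg_sup_zero_le hx) ?_
  have := finrank_le_deg_sup_zero (k := k) (x := x⁻¹) (fun h => hx (by simpa using h.inv))
  rwa [finrank_adjoin_inv, inv_inv] at this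

/-- The product formula. -/
theorem deg_principalDivisor (x : F) : Divisor.deg k (principalDivisor k x) = 0 := by
  by_cases hx : Transcendental k x
  · have e : principalDivisor k x = (principalDivisor k x ⊔ 0) - (principalDivisor k x⁻¹ ⊔ 0) := by
      ext v
      simp only [Finsupp.sub_apply, Finsupp.sup_apply, principalDivisor_apply, v.ord_inv,
        Finsupp.zero_apply]
      omega
    rw [e, map_sub, deg_sup_zero_eq hx,
      deg_sup_zero_eq (fun h => hx (by simpa using h.inv)), finrank_adjoin_inv, sub_self]
  · have : principalDivisor k x = 0 := by
      ext v
      exact Place.ord_eq_zero_of_isAlgebraic (not_not.1 hx) v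
    rw [this, map_zero]

theorem finrank_space_le_add_principalDivisor (D : Divisor F) {z : F} (hz : z ≠ 0) :
    Module.finrank k (D.space k) ≤ Module.finrank k ((D + principalDivisor k z).space k) := by
  have := Divisor.finite_space k (D + principalDivisor k z)
  have hmem : ∀ f : D.space k, (f : F) * z⁻¹ ∈ (D + principalDivisor k z).space k := by
    intro f
    by_cases hf : (f : F) = 0
    · rw [hf, zero_mul]; exact Submodule.zero_mem _
    rw [Divisor.mem_space_iff (mul_ne_zero hf (inv_ne_zero hz))]
    intro v
    have := (Divisor.mem_space_iff hf).1 f.2 v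
    rw [v.ord_mul hf (inv_ne_zero hz), v.ord_inv, Finsupp.add_apply, principalDivisor_apply]
    omega
  let φ : D.space k →ₗ[k] (D + principalDivisor k z).space k :=
    { toFun := fun f => ⟨_, hmem f⟩
      map_add' := fun f g => Subtype.ext (add_mul _ _ _)
      map_smul' := fun c f => Subtype.ext (by simp) }
  refine LinearMap.finrank_le_finrank_of_injective (f := φ) fun f g h => Subtype.ext ?_
  have h' : (f : F) * z⁻¹ = g * z⁻¹ := congrArg Subtype.val h
  exact mul_right_cancel₀ (inv_ne_zero hz) h'

variable (k F) in
/-- Riemann's inequality. -/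
theorem exists_deg_le_finrank_space :
    ∃ γ : ℤ, ∀ D : Divisor F, Divisor.deg k D ≤ Module.finrank k (D.space k) + γ := by
  obtain ⟨x, hx⟩ := exists_transcendental k F
  obtain ⟨γ, h⟩ := exists_finrank_mul_le hx
  set B := principalDivisor k x⁻¹ ⊔ 0 with hBdef
  have hB : 0 ≤ B := le_sup_right
  have hdeg : Divisor.deg k B = Module.finrank (IntermediateField.adjoin k {x}) F := by
    rw [hBdef, deg_sup_zero_eq (fun h => hx (by simpa using h.inv)), finrank_adjoin_inv]
  have hn : 1 ≤ Divisor.deg k B := by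
    have := finiteDimensional_adjoin hx
    rw [hdeg]; exact_mod_cast Module.finrank_pos
  refine ⟨γ, fun A => ?_⟩
  set A₁ := A ⊔ 0
  have hA₁ : 0 ≤ A₁ := le_sup_right
  set l : ℕ := (Divisor.deg k A₁ + γ + 1).toNat
  have hl : Divisor.deg k A₁ + γ + 1 ≤ (l : ℤ) := Int.self_le_toNat _
  have h1 := Divisor.finite_space k (l • B - A₁)
  have h1' := Divisor.finite_space k (l • B)
  have h2 := (Divisor.space_of_le (k := k) (D := l • B - A₁) (E := l • B) (by
    simpa using hA₁)).2
  have h3 := h l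
  have h4 : 0 < Module.finrank k ((l • B - A₁).space k) := by
    rw [map_sub, map_nsmul, nsmul_eq_mul] at h2
    rw [← hdeg] at h3
    have : (0 : ℤ) < Module.finrank k ((l • B - A₁).space k) := by nlinarith
    exact_mod_cast this
  obtain ⟨⟨z, hz⟩, hz0⟩ := Module.finrank_pos_iff_exists_ne_zero.1 h4
  have hz0' : z ≠ 0 := fun h => hz0 (Subtype.ext h)
  have hle : A + principalDivisor k z⁻¹ ≤ l • B := by
    intro v
    have h5 := (Divisor.mem_space_iff hz0').1 hz v
    have h6 : A v ≤ A₁ v := (le_sup_left : A ≤ A ⊔ 0) v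
    rw [Finsupp.sub_apply] at h5
    rw [Finsupp.add_apply, principalDivisor_apply, v.ord_inv]
    omega
  have h7 := Divisor.finite_space k (A + principalDivisor k z⁻¹)
  have h8 := (Divisor.space_of_le (k := k) hle).2
  rw [map_add, deg_principalDivisor, add_zero, map_nsmul, nsmul_eq_mul] at h8
  have h9 := finrank_space_le_add_principalDivisor (k := k) (A + principalDivisor k z⁻¹) hz0'
  rw [add_assoc, principalDivisor_inv, neg_add_cancel, add_zero, ← principalDivisor_inv] at h9
  rw [← hdeg] at h3
  have h10 : (Module.finrank k ((A + principalDivisor k z⁻¹).space k) : ℤ) ≤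
    Module.finrank k (A.space k) := by exact_mod_cast h9
  linarith

end

end GlobalFunctionField

namespace GlobalFunctionField

open Polynomial IsLocalRing WithZero

section

variable (k F : Type*) [Field k] [Finite k] [Field F] [Algebra k F]
  [HasDiscretePlaces F] [IsFunctionField k F]

theorem finite_setOf_degree_eq (d : ℕ) : {v : Place F | v.degree k = d}.Finite := by
  obtain ⟨x, hx⟩ := exists_transcendental k F
  have hx0 : x ≠ 0 := fun h => hx (h ▸ isAlgebraic_zero)
  refine ((finite_setOf_ord_ne_zero k x).union
    (finite_setOf_ord_ne_zero k (x ^ (Nat.card k ^ d) - x))).subset fun v hv => ?_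
  by_cases hxv : x ∈ v.ring
  · right
    have hy0 : x ^ (Nat.card k ^ d) - x ≠ 0 := by
      intro h
      refine hx ⟨X ^ (Nat.card k ^ d) - X, fun h0 => ?_, by simpa using h⟩
      have hd : d ≠ 0 := by
        have := v.degree_pos k
        have hv' : v.degree k = d := hv
        omega
      have := FiniteField.X_pow_card_sub_X_natDegree_eq k
        (p := Nat.card k ^ d) (Nat.one_lt_pow hd Finite.one_lt_card)
      rw [h0] at this
      have h1 := Nat.one_lt_pow hd (Finite.one_lt_card (α := k))
      simp at this
      omega
    refine ne_of_gt ((v.ord_pos_iff hy0).2 ?_)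
    let x' : v.ring := ⟨x, hxv⟩
    have h1 : x' ^ (Nat.card k ^ d) - x' ∈ maximalIdeal v.ring := by
      rw [← residue_eq_zero_iff, map_sub, map_pow, sub_eq_zero]
      have hv' : v.degree k = d := hv
      rw [← hv', ← v.residueCard_eq k, Place.residueCard]
      have := Fintype.ofFinite (ResidueField v.ring)
      rw [Nat.card_eq_fintype_card, FiniteField.pow_card]
    exact v.ring.coe_mem_nonunits_iff.2 h1
  · left
    intro h
    exact hxv ((v.ord_nonneg_iff hx0).1 h.ge)

theorem finite_effective (c : ℤ) : {D : Divisor F | 0 ≤ D ∧ Divisor.deg k D = c}.Finite := by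
  classical
  have hfin : {v : Place F | v.degree k ≤ c.toNat}.Finite := by
    have : {v : Place F | v.degree k ≤ c.toNat} =
        ⋃ d ∈ Set.Iic c.toNat, {v : Place F | v.degree k = d} := by
      ext v; simp
    rw [this]
    exact (Set.finite_Iic _).biUnion fun d _ => finite_setOf_degree_eq k F d
  refine (Finset.finite_toSet (hfin.toFinset.finsupp fun _ => Finset.Icc 0 c)).subset ?_
  rintro D ⟨h0, hD⟩
  have hle : ∀ v, D v * v.degree k ≤ c := by
    intro v
    by_cases hv : v ∈ D.support
    · rw [← hD, Divisor.deg_eq_sum k D subset_rfl]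
      exact Finset.single_le_sum (f := fun v => D v * (v.degree k : ℤ))
        (fun w _ => mul_nonneg (h0 w) (by positivity)) hv
    · rw [Finsupp.notMem_support_iff.1 hv, zero_mul, ← hD]
      exact Divisor.deg_nonneg h0
  have hpos : ∀ v : Place F, (1 : ℤ) ≤ v.degree k := fun v => by exact_mod_cast v.degree_pos k
  rw [Finset.mem_coe, Finset.mem_finsupp_iff]
  refine ⟨fun v hv => ?_, fun v _ => ?_⟩
  · simp only [Set.Finite.mem_toFinset, Set.mem_ofPred_eq]
    have h1 : D v ≠ 0 := Finsupp.mem_support_iff.1 hv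
    have h2 : 0 ≤ D v := h0 v
    have h3 := hle v
    have h4 := hpos v
    have : (v.degree k : ℤ) ≤ c := by nlinarith [show 1 ≤ D v by omega]
    omega
  · rw [Finset.mem_Icc]
    refine ⟨h0 v, ?_⟩
    have h2 : 0 ≤ D v := h0 v
    nlinarith [hle v, hpos v]

/-- The group of principal divisors. -/
def principalDivisors : AddSubgroup (Divisor F) where
  carrier := {D | ∃ x : F, x ≠ 0 ∧ principalDivisor k x = D}
  add_mem' := by
    rintro _ _ ⟨x, hx, rfl⟩ ⟨y, hy, rfl⟩
    exact ⟨x * y, mul_ne_zero hx hy, principalDivisor_mul k hx hy⟩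
  zero_mem' := ⟨1, one_ne_zero, by ext v; simp [principalDivisor_apply]⟩
  neg_mem' := by
    rintro _ ⟨x, hx, rfl⟩
    exact ⟨x⁻¹, inv_ne_zero hx, principalDivisor_inv k x⟩

/-- The divisor class group. -/
abbrev Pic : Type _ := Divisor F ⧸ principalDivisors k F

/-- The degree of a divisor class. -/
noncomputable def Pic.deg : Pic k F →+ ℤ :=
  QuotientAddGroup.lift _ (Divisor.deg k) (by
    rintro _ ⟨x, _, rfl⟩
    exact deg_principalDivisor x)

@[simp] theorem Pic.deg_mk (D : Divisor F) :
    Pic.deg k F (QuotientAddGroup.mk D) = Divisor.deg k D := rfl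

theorem Pic.finite_ker_deg : Finite (Pic.deg k F).ker := by
  obtain ⟨γ, hγ⟩ := exists_deg_le_finrank_space k F
  obtain ⟨v⟩ := nonempty_place k F
  set D₀ : Divisor F := Finsupp.single v ((γ + 1).toNat : ℤ) with hD₀
  have hdeg : γ + 1 ≤ Divisor.deg k D₀ := by
    rw [hD₀, Divisor.deg_single]
    have h1 : (1 : ℤ) ≤ v.degree k := by exact_mod_cast v.degree_pos k
    have h2 : γ + 1 ≤ ((γ + 1).toNat : ℤ) := Int.self_le_toNat _
    nlinarith [Int.natCast_nonneg (γ + 1).toNat]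
  have hfin := (finite_effective k F (Divisor.deg k D₀)).image
    (fun D => (QuotientAddGroup.mk D : Pic k F) - QuotientAddGroup.mk D₀)
  refine (hfin.subset (t := ((Pic.deg k F).ker : Set (Pic k F))) ?_).to_subtype
  intro p hp
  induction p using QuotientAddGroup.induction_on with
  | H D =>
    have hD : Divisor.deg k D = 0 := hp
    have h1 := hγ (D + D₀)
    rw [map_add, hD, zero_add] at h1
    have := Divisor.finite_space k (D + D₀)
    have h2 : 0 < Module.finrank k ((D + D₀).space k) := by
      have : (0 : ℤ) < Module.finrank k ((D + D₀).space k) := by linarith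
      exact_mod_cast this
    obtain ⟨⟨z, hz⟩, hz0⟩ := Module.finrank_pos_iff_exists_ne_zero.1 h2
    have hz0' : z ≠ 0 := fun h => hz0 (Subtype.ext h)
    refine ⟨D + D₀ + principalDivisor k z, ⟨fun w => ?_, ?_⟩, ?_⟩
    · exact (Divisor.mem_space_iff hz0').1 hz w
    · rw [map_add, map_add, hD, deg_principalDivisor, zero_add, add_zero]
    · have : (QuotientAddGroup.mk (principalDivisor k z) : Pic k F) = 0 :=
        (QuotientAddGroup.eq_zero_iff _).2 ⟨z, hz0', rfl⟩
      simp only [QuotientAddGroup.mk_add, this]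
      abel

end

section Herbrand

/-- For two endomorphisms of a finite group whose composite is trivial, exactness on one side implies exactness on the
other. -/
@[to_additive]
theorem _root_.MonoidHom.range_eq_ker_of_finite {A : Type*} [CommGroup A] [Finite A] (S T : A →* A)
    (h : S.ker = T.range) (h' : S.range ≤ T.ker) : S.range = T.ker := by
  have h1 := S.ker.card_mul_index
  have h2 := T.ker.card_mul_index
  rw [Subgroup.index_ker] at h1 h2
  rw [h] at h1
  have hpos : 0 < Nat.card T.range := Nat.card_pos
  have h3 : Nat.card S.range = Nat.card T.ker := by
    refine Nat.eq_of_mul_eq_mul_left hpos ?_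
    rw [h1, ← h2, mul_comm]
  exact Subgroup.eq_of_le_of_card_ge h' h3.ge

theorem not_forall_fixed_eq_norm {P : Type*} [AddCommGroup P] (σ : P →+ P) {N : ℕ} (hN : 2 ≤ N)
    (hσ : ∀ p, σ^[N] p = p) (deg : P →+ ℤ) (hdeg : ∀ p, deg (σ p) = deg p)
    (hfin : Finite deg.ker) (hne : ∃ p, deg p ≠ 0)
    (H : ∀ p, σ p = p → ∃ y, p = ∑ i ∈ Finset.range N, σ^[i] y) : False := by
  have hdi : ∀ i p, deg (σ^[i] p) = deg p := by
    intro i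
    induction i with
    | zero => simp
    | succ i ih => intro p; rw [Function.iterate_succ_apply', hdeg, ih]
  have hiter : ∀ i p q, σ^[i] (p + q) = σ^[i] p + σ^[i] q := by
    intro i
    induction i with
    | zero => simp
    | succ i ih => intro p q; simp only [Function.iterate_succ_apply', ih, map_add]
  have hmin : ∃ y, deg y ≠ 0 ∧ ∀ p, deg y ∣ deg p := by
    obtain ⟨g, hg⟩ := Int.subgroup_cyclic deg.range
    rw [← AddSubgroup.zmultiples_eq_closure] at hg
    have hdvd : ∀ p, g ∣ deg p := fun p => Int.mem_zmultiples_iff.1 (hg ▸ ⟨p, rfl⟩)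
    obtain ⟨y, hy⟩ : g ∈ deg.range := hg ▸ AddSubgroup.mem_zmultiples g
    obtain ⟨p, hp⟩ := hne
    exact ⟨y, fun h => hp (zero_dvd_iff.1 (by rw [← h, hy]; exact hdvd p)), fun p => hy ▸ hdvd p⟩
  let Nm : P →+ P :=
    { toFun := fun y => ∑ i ∈ Finset.range N, σ^[i] y
      map_zero' := Finset.sum_eq_zero fun i _ => by
        simpa using hiter i 0 0
      map_add' := fun p q => by simp only [hiter, Finset.sum_add_distrib] }
  have hNm : ∀ y, Nm y = ∑ i ∈ Finset.range N, σ^[i] y := fun _ => rfl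
  have hdegNm : ∀ y, deg (Nm y) = N * deg y := by
    intro y
    rw [hNm, map_sum, Finset.sum_congr rfl (fun i _ => hdi i y)]
    simp
  have hσNm : ∀ y, σ (Nm y) = Nm y := by
    intro y
    rw [hNm, map_sum]
    have h1 := Finset.sum_range_succ (fun i => σ^[i] y) N
    have h2 := Finset.sum_range_succ' (fun i => σ^[i] y) N
    rw [h1, hσ] at h2
    simp only [Function.iterate_zero, id_eq, add_left_inj] at h2
    rw [h2]
    exact Finset.sum_congr rfl fun i _ => (Function.iterate_succ_apply' _ _ _).symm
  have hNmσ : ∀ y, Nm (σ y) = Nm y := by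
    intro y
    rw [← hσNm y, hNm, hNm, map_sum]
    exact Finset.sum_congr rfl fun i _ => by
      rw [← Function.iterate_succ_apply, Function.iterate_succ_apply']
  let S : deg.ker →+ deg.ker := ((σ - AddMonoidHom.id P).comp deg.ker.subtype).codRestrict _
    (fun a => by
      simp only [AddMonoidHom.mem_ker, AddMonoidHom.comp_apply, AddMonoidHom.sub_apply,
        AddMonoidHom.id_apply, map_sub, hdeg, sub_self])
  let T : deg.ker →+ deg.ker := (Nm.comp deg.ker.subtype).codRestrict _
    (fun a => by
      have := a.2
      rw [AddMonoidHom.mem_ker] at this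
      simp [AddMonoidHom.mem_ker, hdegNm, this])
  have hS : ∀ a : deg.ker, (S a : P) = σ a - a := fun a => rfl
  have hT : ∀ a : deg.ker, (T a : P) = Nm a := fun a => rfl
  have hker : S.ker = T.range := by
    ext a
    rw [AddMonoidHom.mem_ker, AddMonoidHom.mem_range]
    constructor
    · intro h
      have h1 : σ a = a := by
        have := congrArg Subtype.val h
        rw [hS] at this
        exact sub_eq_zero.1 this
      obtain ⟨y, hy⟩ := H a h1
      have hy0 : deg y = 0 := by
        have h2 := hdegNm y
        rw [hNm, ← hy] at h2
        have h3 : deg (a : P) = 0 := a.2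
        rw [h3] at h2
        have : (N : ℤ) ≠ 0 := by positivity
        exact (mul_eq_zero.1 h2.symm).resolve_left this
      exact ⟨⟨y, hy0⟩, Subtype.ext hy.symm⟩
    · rintro ⟨y, rfl⟩
      apply Subtype.ext
      rw [hS, hT, hσNm]
      simp
  have hle : S.range ≤ T.ker := by
    rintro _ ⟨a, rfl⟩
    rw [AddMonoidHom.mem_ker]
    apply Subtype.ext
    rw [hT, hS, map_sub, hNmσ]
    simp
  have hex := AddMonoidHom.range_eq_ker_of_finite S T hker hle
  obtain ⟨y, hy0, hy⟩ := hmin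
  have hz : deg (σ y - y) = 0 := by rw [map_sub, hdeg, sub_self]
  have hz' : (⟨σ y - y, hz⟩ : deg.ker) ∈ T.ker := by
    rw [AddMonoidHom.mem_ker]
    apply Subtype.ext
    rw [hT]
    simp only [map_sub, hNmσ, sub_self]
    rfl
  rw [← hex] at hz'
  obtain ⟨w, hw⟩ := hz'
  have hw' : σ w - w = σ y - y := congrArg Subtype.val hw
  obtain ⟨y', hy'⟩ := H (y - w) (by
    rw [map_sub]
    rw [sub_eq_sub_iff_sub_eq_sub, hw'])
  have h1 : deg y = N * deg y' := by
    rw [← hdegNm, hNm, ← hy', map_sub, (w.2 : deg w = 0), sub_zero]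
  obtain ⟨t, ht⟩ := hy y'
  rw [ht] at h1
  have h2 : (N : ℤ) * t = 1 := by
    have : deg y * ((N : ℤ) * t) = deg y * 1 := by rw [mul_one]; linarith
    exact mul_left_cancel₀ hy0 this
  have h3 := Int.isUnit_iff.1 (IsUnit.of_mul_eq_one _ h2)
  omega

end Herbrand

end GlobalFunctionField

namespace GlobalFunctionField

open Polynomial IsLocalRing WithZero

section Hilbert90

variable {F : Type*} [Field F] (σ : F →+* F) {N : ℕ}

theorem iterate_prod_eq (n : ℕ) (f : F) :
    f * σ (∏ j ∈ Finset.range n, σ^[j] f) = ∏ j ∈ Finset.range (n + 1), σ^[j] f := by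
  rw [Finset.prod_range_succ', map_prod, mul_comm]
  simp only [Function.iterate_succ_apply', Function.iterate_zero, id_eq]

/-- Hilbert's theorem 90 for a ring endomorphism of order `N`. -/
theorem exists_mul_map_eq_of_prod_eq_one (hN : 0 < N) (hσ : ∀ x, σ^[N] x = x)
    (hfree : ∀ i, 0 < i → i < N → ∃ x, σ^[i] x ≠ x) {f : F}
    (hf : ∏ i ∈ Finset.range N, σ^[i] f = 1) : ∃ g, g ≠ 0 ∧ f * σ g = g := by
  have hinj : Function.Injective (fun i : Fin N => ((σ ^ (i : ℕ) : F →+* F) : F →* F)) := by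
    have aux : ∀ i j : ℕ, i < j → j < N → (∀ x, σ^[i] x = σ^[j] x) → False := by
      intro i j hij hj h
      obtain ⟨x, hx⟩ := hfree (j - i) (by omega) (by omega)
      refine hx ((Function.Injective.iterate σ.injective i) ?_)
      rw [← Function.iterate_add_apply, h, show i + (j - i) = j by omega]
    intro i j hij
    have h : ∀ x, σ^[i] x = σ^[j] x := fun x => by
      have := DFunLike.congr_fun hij x
      simpa using this
    rcases lt_trichotomy (i : ℕ) j with hlt | heq | hlt
    · exact (aux i j hlt j.2 h).elim
    · exact Fin.ext heq
    · exact (aux j i hlt i.2 fun x => (h x).symm).elim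
  have hlin := (linearIndependent_monoidHom F F).comp _ hinj
  have hθ : ∃ θ, ∑ i ∈ Finset.range N, (∏ j ∈ Finset.range i, σ^[j] f) * σ^[i] θ ≠ 0 := by
    by_contra! h
    have h0 := Fintype.linearIndependent_iff.1 hlin
      (fun i => ∏ j ∈ Finset.range i, σ^[j] f) (by
        funext θ
        have hθ := h θ
        rw [← Fin.sum_univ_eq_sum_range (fun i => (∏ j ∈ Finset.range i, σ^[j] f) * σ^[i] θ)] at hθ
        simpa using hθ) ⟨0, hN⟩
    simp at h0
  obtain ⟨θ, hθ⟩ := hθ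
  refine ⟨_, hθ, ?_⟩
  rw [map_sum, Finset.mul_sum]
  have h1 : ∀ i, f * σ ((∏ j ∈ Finset.range i, σ^[j] f) * σ^[i] θ) =
      (∏ j ∈ Finset.range (i + 1), σ^[j] f) * σ^[i + 1] θ := by
    intro i
    rw [map_mul, ← mul_assoc, iterate_prod_eq, Function.iterate_succ_apply']
  rw [Finset.sum_congr rfl fun i _ => h1 i]
  have h2 := Finset.sum_range_succ (fun i => (∏ j ∈ Finset.range i, σ^[j] f) * σ^[i] θ) N
  have h3 := Finset.sum_range_succ' (fun i => (∏ j ∈ Finset.range i, σ^[j] f) * σ^[i] θ) N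
  rw [h2] at h3
  simp only [hf, hσ, Finset.range_zero, Finset.prod_empty, Function.iterate_zero, id_eq,
    add_left_inj] at h3
  exact h3.symm

theorem map_prod_iterate_eq (hσ : ∀ x, σ^[N] x = x) (f : F) :
    σ (∏ i ∈ Finset.range N, σ^[i] f) = ∏ i ∈ Finset.range N, σ^[i] f := by
  by_cases hf : f = 0
  · rcases Nat.eq_zero_or_pos N with rfl | hN
    · simp
    · rw [Finset.prod_eq_zero (Finset.mem_range.2 hN) (by simpa using hf), map_zero]
  · refine mul_left_cancel₀ hf ?_
    rw [iterate_prod_eq, Finset.prod_range_succ, hσ, mul_comm]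

/-- The norm of an extension of finite fields is surjective. -/
theorem exists_prod_iterate_eq [Finite F] (hN : 0 < N) (hσ : ∀ x, σ^[N] x = x)
    (hfree : ∀ i, 0 < i → i < N → ∃ x, σ^[i] x ≠ x) {c : F} (hc : c ≠ 0) (hσc : σ c = c) :
    ∃ e, e ≠ 0 ∧ ∏ i ∈ Finset.range N, σ^[i] e = c := by
  let S : Fˣ →* Fˣ :=
    { toFun := fun u => ∏ i ∈ Finset.range N, Units.map ((σ ^ i : F →+* F) : F →* F) u
      map_one' := by simp
      map_mul' := fun u v => by simp only [map_mul, Finset.prod_mul_distrib] }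
  let T : Fˣ →* Fˣ := Units.map (σ : F →* F) / MonoidHom.id Fˣ
  have hS : ∀ u : Fˣ, ((S u : Fˣ) : F) = ∏ i ∈ Finset.range N, σ^[i] u := by
    intro u
    simp [S, Units.coe_prod]
  have hT : ∀ u : Fˣ, ((T u : Fˣ) : F) = σ u / u := by
    intro u
    simp [T, Units.val_div_eq_div_val]
  have hST : ∀ u, S (T u) = 1 := by
    intro u
    have hne : ∏ i ∈ Finset.range N, σ^[i] (u : F) ≠ 0 := by rw [← hS]; exact (S u).ne_zero
    have h1 : S (Units.map (σ : F →* F) u) = S u := by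
      apply Units.ext
      rw [hS, hS, ← map_prod_iterate_eq σ hσ (u : F), map_prod]
      refine Finset.prod_congr rfl fun i _ => ?_
      rw [← Function.iterate_succ_apply' σ, Function.iterate_succ_apply]
      rfl
    change S (Units.map (σ : F →* F) u / u) = 1
    rw [_root_.map_div, h1, div_self']
  have hex := MonoidHom.range_eq_ker_of_finite S T (by
    ext u
    rw [MonoidHom.mem_ker, MonoidHom.mem_range]
    constructor
    · intro h
      obtain ⟨g, hg0, hg⟩ := exists_mul_map_eq_of_prod_eq_one σ hN hσ hfree (f := u) (by
        rw [← hS, h, Units.val_one])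
      refine ⟨(Units.mk0 g hg0)⁻¹, Units.ext ?_⟩
      rw [hT, Units.val_inv_eq_inv_val, Units.val_mk0, map_inv₀, inv_div_inv]
      rw [div_eq_iff (by simpa using hg0), hg]
    · rintro ⟨w, rfl⟩
      exact hST w) (by
    rintro _ ⟨u, rfl⟩
    rw [MonoidHom.mem_ker]
    apply Units.ext
    rw [hT, hS, map_prod_iterate_eq σ hσ, Units.val_one, div_self]
    rw [← hS]; exact (S u).ne_zero)
  have hmem : Units.mk0 c hc ∈ T.ker := by
    rw [MonoidHom.mem_ker]
    apply Units.ext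
    rw [hT, Units.val_mk0, hσc, div_self hc, Units.val_one]
  rw [← hex] at hmem
  obtain ⟨e, he⟩ := hmem
  exact ⟨e, e.ne_zero, by rw [← hS, he, Units.val_mk0]⟩

end Hilbert90

section Action

variable {k F : Type*} [Field k] [Field F] [Algebra k F]

open scoped Pointwise

theorem Place.ext {v w : Place F} (h : v.ring = w.ring) : v = w := by
  cases v; cases w; congr

noncomputable instance : MulAction (F ≃ₐ[k] F) (Place F) where
  smul g v := ⟨g • v.ring, fun h => v.ring_ne_top (by
    refine top_unique fun x _ => ?_
    rw [← ValuationSubring.smul_mem_pointwise_smul_iff (g := g), h]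
    exact ValuationSubring.mem_top _)⟩
  one_smul v := Place.ext (one_smul (F ≃ₐ[k] F) v.ring)
  mul_smul g h v := Place.ext (mul_smul g h v.ring)

theorem map_mem_smul_iff (g : F ≃ₐ[k] F) (v : Place F) (x : F) :
    g x ∈ (g • v).ring ↔ x ∈ v.ring :=
  ValuationSubring.smul_mem_pointwise_smul_iff

/-- The action of an automorphism on divisors. -/
noncomputable def divisorMap (g : F ≃ₐ[k] F) : Divisor F →+ Divisor F :=
  Finsupp.mapDomain.addMonoidHom (g • ·)

theorem divisorMap_apply (g : F ≃ₐ[k] F) (D : Divisor F) (v : Place F) :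
    divisorMap g D v = D (g⁻¹ • v) := by
  conv_lhs => rw [← smul_inv_smul g v]
  exact Finsupp.mapDomain_apply (MulAction.injective g) D _

variable [HasDiscretePlaces F]

theorem ord_smul (g : F ≃ₐ[k] F) (v : Place F) (x : F) : (g • v).ord (g x) = v.ord x := by
  have hunit : ∀ y : F, y ≠ 0 → v.ord y = 0 → (g • v).ord (g y) = 0 := by
    intro y hy0 hy
    have h0 : g y ≠ 0 := by simpa using hy0
    have h1 := ((g • v).ord_nonneg_iff h0).2
      ((map_mem_smul_iff g v y).2 ((v.ord_nonneg_iff hy0).1 hy.ge))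
    have h2 := ((g • v).ord_nonneg_iff (inv_ne_zero h0)).2 (by
      rw [← map_inv₀]
      exact (map_mem_smul_iff g v y⁻¹).2 ((v.ord_nonneg_iff (inv_ne_zero hy0)).1 (by
        rw [v.ord_inv, hy, neg_zero])))
    rw [Place.ord_inv] at h2
    omega
  obtain ⟨π, hπ0, hπ⟩ := v.exists_ord_eq_one
  have ord_zpow : ∀ (w : Place F) (y : F) (n : ℤ), w.ord (y ^ n) = n * w.ord y := by
    intro w y n
    rw [Place.ord, map_zpow₀, log_zpow, smul_eq_mul, ← mul_neg, ← Place.ord]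
  have hmul : ∀ y : F, y ≠ 0 → (g • v).ord (g y) = v.ord y * (g • v).ord (g π) := by
    intro y hy
    have hz : π ^ (v.ord y) ≠ 0 := zpow_ne_zero _ hπ0
    have h1 := hunit (y * (π ^ (v.ord y))⁻¹) (mul_ne_zero hy (inv_ne_zero hz)) (by
      rw [v.ord_mul hy (inv_ne_zero hz), v.ord_inv, ord_zpow, hπ]; ring)
    rw [map_mul, Place.ord_mul _ (by simpa using hy) ((_root_.map_ne_zero g).2 (inv_ne_zero hz)), map_inv₀, Place.ord_inv,
      map_zpow₀, ord_zpow] at h1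
    linarith
  have he : (g • v).ord (g π) = 1 := by
    obtain ⟨y, hy0, hy⟩ := (g • v).exists_ord_eq_one
    have hy' := hmul (g.symm y) (by simpa using hy0)
    rw [AlgEquiv.apply_symm_apply, hy] at hy'
    have hpos : 0 ≤ (g • v).ord (g π) := ((g • v).ord_nonneg_iff (by simpa using hπ0)).2
      ((map_mem_smul_iff g v π).2 ((v.ord_nonneg_iff hπ0).1 (by omega)))
    rcases Int.isUnit_iff.1 (IsUnit.of_mul_eq_one_right _ hy'.symm) with h | h <;> omega
  by_cases hx : x = 0
  · simp [hx, Place.ord]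
  · rw [hmul x hx, he, mul_one]

theorem degree_smul [Finite k] (g : F ≃ₐ[k] F) (v : Place F) : (g • v).degree k = v.degree k := by
  have e : v.ring ≃+* (g • v).ring :=
    { toFun := fun x => ⟨g x, (map_mem_smul_iff g v x).2 x.2⟩
      invFun := fun x => ⟨g.symm x, (map_mem_smul_iff g v _).1 (by simp)⟩
      left_inv := fun x => Subtype.ext (by simp)
      right_inv := fun x => Subtype.ext (by simp)
      map_mul' := fun x y => Subtype.ext (by simp)
      map_add' := fun x y => Subtype.ext (by simp) }
  have h := Nat.card_congr (ResidueField.mapEquiv e).toEquiv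
  have h1 := v.residueCard_eq k
  have h2 := (g • v).residueCard_eq k
  rw [Place.residueCard] at h1 h2
  rw [h1, h2] at h
  exact (Nat.pow_right_injective Finite.one_lt_card h).symm

theorem deg_divisorMap [Finite k] (g : F ≃ₐ[k] F) (D : Divisor F) :
    Divisor.deg k (divisorMap g D) = Divisor.deg k D := by
  have : (Divisor.deg k).comp (divisorMap g) = Divisor.deg k (F := F) := by
    ext v
    simp [divisorMap, Divisor.deg_single, degree_smul]
  exact DFunLike.congr_fun this D

theorem divisorMap_principalDivisor [Finite k] [IsFunctionField k F] (g : F ≃ₐ[k] F) (x : F) :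
    divisorMap g (principalDivisor k x) = principalDivisor k (g x) := by
  ext v
  rw [divisorMap_apply, principalDivisor_apply, principalDivisor_apply, ← ord_smul g, smul_inv_smul]

end Action

end GlobalFunctionField

namespace GlobalFunctionField

open Polynomial IsLocalRing WithZero

section

variable {k F : Type*} [Field k] [Field F] [Algebra k F]

theorem divisorMap_mul (g h : F ≃ₐ[k] F) (D : Divisor F) :
    divisorMap (g * h) D = divisorMap g (divisorMap h D) := by
  ext v
  rw [divisorMap_apply, divisorMap_apply, divisorMap_apply, mul_inv_rev, mul_smul]

theorem divisorMap_one (D : Divisor F) : divisorMap (1 : F ≃ₐ[k] F) D = D := by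
  ext v
  rw [divisorMap_apply, inv_one, one_smul]

/-- If a finite cyclic group acts freely on the places, the invariant divisors are norms. -/
theorem exists_eq_sum_divisorMap (σ : F ≃ₐ[k] F)
    (hfree : ∀ i, 0 < i → i < orderOf σ → ∀ v : Place F, σ ^ i • v ≠ v)
    (hpos : 0 < orderOf σ) {D : Divisor F} (hD : divisorMap σ D = D) :
    ∃ D' : Divisor F, D = ∑ i ∈ Finset.range (orderOf σ), divisorMap (σ ^ i) D' := by
  classical
  have hinv : ∀ i : ℕ, divisorMap (σ ^ i) D = D := by
    intro i
    induction i with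
    | zero => rw [pow_zero, divisorMap_one]
    | succ i ih => rw [pow_succ, divisorMap_mul, hD, ih]
  let rep : Place F → Place F := fun v =>
    (Quotient.out (Quotient.mk (MulAction.orbitRel (Subgroup.zpowers σ) (Place F)) v))
  have hrep : ∀ v, ∃ i < orderOf σ, (σ ^ i)⁻¹ • v = rep v := by
    intro v
    have h1 : MulAction.orbitRel (Subgroup.zpowers σ) (Place F) v (rep v) :=
      (MulAction.orbitRel (Subgroup.zpowers σ) (Place F)).symm
        (Quotient.mk_out (s := MulAction.orbitRel (Subgroup.zpowers σ) (Place F)) v)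
    rw [MulAction.orbitRel_apply] at h1
    obtain ⟨⟨g, hg⟩, hgv⟩ := h1
    obtain ⟨i, hi, rfl⟩ := (isOfFinOrder_iff_pow_eq_one.2
      ⟨_, hpos, pow_orderOf_eq_one σ⟩).mem_zpowers_iff_mem_range_orderOf.1 hg |> Finset.mem_image.1
    refine ⟨i, Finset.mem_range.1 hi, ?_⟩
    rw [inv_smul_eq_iff]
    exact hgv.symm
  have hrep_smul : ∀ (i : ℕ) v, rep ((σ ^ i)⁻¹ • v) = rep v := by
    intro i v
    have : Quotient.mk (MulAction.orbitRel (Subgroup.zpowers σ) (Place F)) ((σ ^ i)⁻¹ • v) =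
        Quotient.mk _ v := by
      apply Quotient.sound
      change MulAction.orbitRel (Subgroup.zpowers σ) (Place F) _ _
      rw [MulAction.orbitRel_apply]
      exact ⟨⟨(σ ^ i)⁻¹, inv_mem (pow_mem (Subgroup.mem_zpowers σ) i)⟩, rfl⟩
    simp only [rep, this]
  refine ⟨D.filter (fun v => rep v = v), ?_⟩
  ext v
  rw [Finsupp.finsetSum_apply]
  obtain ⟨i, hi, hiv⟩ := hrep v
  rw [Finset.sum_eq_single i]
  · rw [divisorMap_apply, hiv, Finsupp.filter_apply_pos _ _ (by
        rw [← hiv, hrep_smul, hiv]), ← hiv,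
      ← divisorMap_apply, hinv]
  · intro j hj hji
    rw [divisorMap_apply, Finsupp.filter_apply_neg]
    rw [hrep_smul, ← hiv]
    have aux : ∀ a b : ℕ, a < b → b < orderOf σ → (σ ^ a)⁻¹ • v ≠ (σ ^ b)⁻¹ • v := by
      intro a b hab hb h
      refine hfree (b - a) (by omega) (by omega) v ?_
      rw [pow_sub _ hab.le, mul_smul, h, smul_inv_smul]
    rcases lt_or_gt_of_ne hji with h | h
    · exact (aux j i h hi).symm
    · exact aux i j h (Finset.mem_range.1 hj)
  · intro h
    exact (h (Finset.mem_range.2 hi)).elim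

variable [Finite k] [HasDiscretePlaces F] [IsFunctionField k F]

theorem isAlgebraic_of_principalDivisor_eq_zero {x : F} (h : principalDivisor k x = 0) :
    IsAlgebraic k x := by
  by_contra hx
  obtain ⟨v, hv⟩ := exists_place_mem_nonunits hx
  have hx0 : x ≠ 0 := fun h => hx (h ▸ isAlgebraic_zero)
  rw [← v.ord_pos_iff hx0, ← principalDivisor_apply k, h] at hv
  exact lt_irrefl _ hv

variable (k F) in
theorem finite_algebraicClosure : Finite (algebraicClosure k F) := by
  have := Divisor.finite_space k (0 : Divisor F)
  have : Finite ((0 : Divisor F).space k) := Module.finite_of_finite k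
  refine Finite.of_injective (fun x : algebraicClosure k F => (⟨x, fun v => ?_⟩ :
    (0 : Divisor F).space k)) fun x y h => Subtype.ext
    (congrArg (fun z : (0 : Divisor F).space k => (z : F)) h)
  rw [Finsupp.zero_apply, exp_zero, v.val_le_one_iff]
  exact v.mem_of_isAlgebraic ((mem_algebraicClosure_iff).1 x.2)

/-- The action of an automorphism on divisor classes. -/
noncomputable def picMap (σ : F ≃ₐ[k] F) : Pic k F →+ Pic k F :=
  QuotientAddGroup.map _ _ (divisorMap σ) (by
    rintro _ ⟨x, hx, rfl⟩
    exact ⟨σ x, by simpa using hx, (divisorMap_principalDivisor σ x).symm⟩)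

theorem picMap_mk (σ : F ≃ₐ[k] F) (D : Divisor F) :
    picMap σ (QuotientAddGroup.mk D) = QuotientAddGroup.mk (divisorMap σ D) := rfl

theorem picMap_iterate_mk (σ : F ≃ₐ[k] F) (i : ℕ) (D : Divisor F) :
    (picMap σ)^[i] (QuotientAddGroup.mk D) = QuotientAddGroup.mk (divisorMap (σ ^ i) D) := by
  induction i with
  | zero => simp [divisorMap_one]
  | succ i ih => rw [Function.iterate_succ_apply', ih, picMap_mk, pow_succ', divisorMap_mul]

theorem picMap_fixed_eq_norm (σ : F ≃ₐ[k] F) (hpos : 0 < orderOf σ)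
    (hfree : ∀ i, 0 < i → i < orderOf σ → ∀ v : Place F, σ ^ i • v ≠ v)
    (hconst : ∀ i, 0 < i → i < orderOf σ → ∃ x : F, IsAlgebraic k x ∧ (σ ^ i) x ≠ x)
    (p : Pic k F) (hp : picMap σ p = p) :
    ∃ y, p = ∑ i ∈ Finset.range (orderOf σ), (picMap σ)^[i] y := by
  have hiter : ∀ (i : ℕ) (x : F), (σ : F →+* F)^[i] x = (σ ^ i) x := by
    intro i
    induction i with
    | zero => simp
    | succ i ih => intro x; rw [Function.iterate_succ_apply', ih, pow_succ']; rfl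
  have hord : ∀ x, (σ : F →+* F)^[orderOf σ] x = x := fun x => by
    rw [hiter, pow_orderOf_eq_one]; rfl
  induction p using QuotientAddGroup.induction_on with
  | H D =>
    rw [picMap_mk, QuotientAddGroup.eq_iff_sub_mem] at hp
    obtain ⟨f, hf0, hf⟩ := hp
    have hne : ∀ i, (σ : F →+* F)^[i] f ≠ 0 := fun i => by
      rw [hiter]; exact (_root_.map_ne_zero _).2 hf0
    set c := ∏ i ∈ Finset.range (orderOf σ), (σ : F →+* F)^[i] f with hc
    have hc0 : c ≠ 0 := Finset.prod_ne_zero_iff.2 fun i _ => hne i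
    have hcσ : (σ : F →+* F) c = c := map_prod_iterate_eq _ hord f
    have hprod : ∀ (s : Finset ℕ), principalDivisor k (∏ i ∈ s, (σ : F →+* F)^[i] f) =
        ∑ i ∈ s, divisorMap (σ ^ i) (principalDivisor k f) := by
      classical
      intro s
      induction s using Finset.induction_on with
      | empty => ext v; simp [principalDivisor_apply]
      | insert a s ha ih =>
        rw [Finset.prod_insert ha, Finset.sum_insert ha, principalDivisor_mul, ih, hiter,
          divisorMap_principalDivisor]
        · exact hne a
        · exact Finset.prod_ne_zero_iff.2 fun i _ => hne i
    have hcdiv : principalDivisor k c = 0 := by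
      rw [hc, hprod, hf]
      have : ∀ i, divisorMap (σ ^ i) (divisorMap σ D - D) =
          divisorMap (σ ^ (i + 1)) D - divisorMap (σ ^ i) D := by
        intro i; rw [map_sub, pow_succ, divisorMap_mul]
      rw [Finset.sum_congr rfl fun i _ => this i,
        Finset.sum_range_sub (fun i => divisorMap (σ ^ i) D), pow_orderOf_eq_one, pow_zero, sub_self]
    have hcalg := isAlgebraic_of_principalDivisor_eq_zero hcdiv
    have := finite_algebraicClosure k F
    let C := algebraicClosure k F
    have hC : ∀ x : C, σ x ∈ C := fun x =>
      mem_algebraicClosure_iff.2 ((mem_algebraicClosure_iff.1 x.2).algHom (σ : F →ₐ[k] F))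
    let τ : C →+* C := ((σ : F →+* F).comp (algebraMap C F)).codRestrict C (fun x => hC x)
    have hτ : ∀ (i : ℕ) (x : C), ((τ^[i] x : C) : F) = (σ : F →+* F)^[i] x := by
      intro i
      induction i with
      | zero => simp
      | succ i ih =>
        intro x; rw [Function.iterate_succ_apply', Function.iterate_succ_apply', ← ih]; rfl
    obtain ⟨e, he0, he⟩ := exists_prod_iterate_eq τ hpos
      (fun x => Subtype.ext (by rw [hτ, hord]))
      (fun i hi hiN => by
        obtain ⟨x, hx, hne⟩ := hconst i hi hiN
        refine ⟨⟨x, mem_algebraicClosure_iff.2 hx⟩, fun h => hne ?_⟩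
        have := congrArg Subtype.val h
        rwa [hτ, hiter] at this)
      (c := ⟨c, mem_algebraicClosure_iff.2 hcalg⟩)
      (fun h => hc0 (congrArg Subtype.val h)) (Subtype.ext hcσ)
    have he' : ∏ i ∈ Finset.range (orderOf σ), (σ : F →+* F)^[i] (e : F) = c := by
      have := congrArg (algebraMap C F) he
      rw [map_prod] at this
      refine (Finset.prod_congr rfl fun i _ => ?_).trans this
      exact (hτ i e).symm
    have he0' : (e : F) ≠ 0 := fun h => he0 (Subtype.ext h)
    obtain ⟨g, hg0, hg⟩ := exists_mul_map_eq_of_prod_eq_one (σ : F →+* F) hpos hord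
      (fun i hi hiN => by
        obtain ⟨x, -, hx⟩ := hconst i hi hiN
        exact ⟨x, by rwa [hiter]⟩) (f := f * (e : F)⁻¹) (by
      have : ∀ i, (σ : F →+* F)^[i] (f * (e : F)⁻¹) =
          (σ : F →+* F)^[i] f * ((σ : F →+* F)^[i] (e : F))⁻¹ := fun i => by
        rw [hiter, hiter, hiter, map_mul, map_inv₀]
      rw [Finset.prod_congr rfl fun i _ => this i, Finset.prod_mul_distrib, Finset.prod_inv_distrib,
        he', ← hc, mul_inv_cancel₀ hc0])
    have hdg : principalDivisor k f + divisorMap σ (principalDivisor k g) = principalDivisor k g := by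
      have hde : principalDivisor k (e : F)⁻¹ = 0 := by
        ext v
        exact v.ord_eq_zero_of_isAlgebraic (mem_algebraicClosure_iff.1 e.2).inv
      have := congrArg (principalDivisor k) hg
      rw [principalDivisor_mul k (mul_ne_zero hf0 (inv_ne_zero he0')) (by simpa using hg0),
        principalDivisor_mul k hf0 (inv_ne_zero he0'), hde, add_zero] at this
      rw [divisorMap_principalDivisor]
      exact this
    obtain ⟨D', hD'⟩ := exists_eq_sum_divisorMap σ hfree hpos (D := D + principalDivisor k g) (by
      have h2 : divisorMap σ (principalDivisor k g) =
          principalDivisor k g - (divisorMap σ D - D) := by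
        rw [← hf, eq_sub_iff_add_eq, add_comm]; exact hdg
      rw [map_add, h2]
      abel)
    refine ⟨QuotientAddGroup.mk D', ?_⟩
    have h1 : (QuotientAddGroup.mk (D + principalDivisor k g) : Pic k F) = QuotientAddGroup.mk D := by
      have h2 : (QuotientAddGroup.mk (principalDivisor k g) : Pic k F) = 0 :=
        (QuotientAddGroup.eq_zero_iff _).2 ⟨g, hg0, rfl⟩
      rw [QuotientAddGroup.mk_add, h2, add_zero]
    rw [← h1, hD', Finset.sum_congr rfl fun i _ => picMap_iterate_mk σ i D']
    exact map_sum (QuotientAddGroup.mk' (principalDivisors k F)) _ _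

/-- No automorphism of a function field acts freely on places and faithfully on constants. -/
theorem orderOf_lt_two_of_free (σ : F ≃ₐ[k] F) (hpos : 0 < orderOf σ)
    (hfree : ∀ i, 0 < i → i < orderOf σ → ∀ v : Place F, σ ^ i • v ≠ v)
    (hconst : ∀ i, 0 < i → i < orderOf σ → ∃ x : F, IsAlgebraic k x ∧ (σ ^ i) x ≠ x) :
    orderOf σ < 2 := by
  by_contra! h
  refine not_forall_fixed_eq_norm (picMap σ) h (fun p => ?_) (Pic.deg k F) (fun p => ?_)
    (Pic.finite_ker_deg k F) ?_ (picMap_fixed_eq_norm σ hpos hfree hconst)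
  · induction p using QuotientAddGroup.induction_on with
    | H D => rw [picMap_iterate_mk, pow_orderOf_eq_one, divisorMap_one]
  · induction p using QuotientAddGroup.induction_on with
    | H D => rw [picMap_mk, Pic.deg_mk, Pic.deg_mk, deg_divisorMap]
  · obtain ⟨v⟩ := nonempty_place k F
    refine ⟨QuotientAddGroup.mk (Finsupp.single v 1), ?_⟩
    rw [Pic.deg_mk, Divisor.deg_single, one_mul]
    exact_mod_cast (v.degree_pos k).ne'

end

end GlobalFunctionField

namespace GlobalFunctionField

open Polynomial IsLocalRing WithZero

theorem IsFunctionField.of_finite (k K L : Type*) [Field k] [Field K] [Field L] [Algebra k K]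
    [Algebra K L] [Algebra k L] [IsScalarTower k K L] [Module.Finite K L] [h : IsFunctionField k K] :
    IsFunctionField k L := by
  have := h.essFiniteType
  refine ⟨Algebra.EssFiniteType.comp k K L, ?_⟩
  have h1 := lift_trdeg_add_eq k K L
  rw [h.trdeg_eq_one, trdeg_eq_zero] at h1
  simpa using h1.symm

/-- The restriction of a place to a subfield over which the field is algebraic. -/
def Place.comap {K L : Type*} [Field K] [Field L] [Algebra K L] [Algebra.IsAlgebraic K L]
    (P : Place L) : Place K where
  ring := P.ring.comap (algebraMap K L)
  ring_ne_top h := P.ring_ne_top (top_unique fun x _ => by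
    have h1 : ∀ a : K, algebraMap K L a ∈ P.ring := fun a =>
      (h ▸ ValuationSubring.mem_top a : a ∈ P.ring.comap (algebraMap K L))
    let _ : Algebra K P.ring := ((algebraMap K L).codRestrict P.ring.toSubring h1).toAlgebra
    have : IsScalarTower K P.ring L := IsScalarTower.of_algebraMap_eq fun _ => rfl
    exact P.ring.mem_of_isIntegral ((Algebra.IsAlgebraic.isAlgebraic (R := K) x).isIntegral.tower_top))

theorem Place.mem_comap {K L : Type*} [Field K] [Field L] [Algebra K L] [Algebra.IsAlgebraic K L]
    {P : Place L} {a : K} : a ∈ (P.comap (K := K)).ring ↔ algebraMap K L a ∈ P.ring := Iff.rfl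

/-- Elements of a place fixed by a power of Frobenius of the restriction are congruent to
elements of the subfield. -/
theorem Place.exists_sub_mem_nonunits {K L : Type*} [Field K] [Field L] [Algebra K L]
    [Algebra.IsAlgebraic K L] [HasDiscretePlaces K] (P : Place L) {e : L} (he : e ∈ P.ring)
    (h : e ^ (P.comap (K := K)).residueCard = e) :
    ∃ a : K, algebraMap K L a ∈ P.ring ∧ algebraMap K L a - e ∈ P.ring.nonunits := by
  classical
  set v := P.comap (K := K)
  let ι : v.ring →+* P.ring := ((algebraMap K L).comp v.ring.subtype).codRestrict P.ring.toSubring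
    (fun x => x.2)
  have hι : ∀ x : v.ring, (ι x : L) = algebraMap K L x := fun _ => rfl
  have hloc : IsLocalHom ι := by
    refine ⟨fun x hx => ?_⟩
    obtain ⟨y, hy⟩ := hx.exists_right_inv
    have hx0 : (x : K) ≠ 0 := by
      intro h0
      have : x = 0 := Subtype.ext h0
      rw [this, map_zero, zero_mul] at hy
      exact zero_ne_one hy
    have hy' : algebraMap K L x * (y : L) = 1 := congrArg Subtype.val hy
    have hinv : (x : K)⁻¹ ∈ v.ring := by
      rw [Place.mem_comap, map_inv₀, ← eq_inv_of_mul_eq_one_right hy']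
      exact y.2
    exact IsUnit.of_mul_eq_one (⟨_, hinv⟩ : v.ring) (Subtype.ext (mul_inv_cancel₀ hx0))
  let φ : ResidueField v.ring →+* ResidueField P.ring := ResidueField.map ι
  have := Fintype.ofFinite (ResidueField v.ring)
  have hcard : v.residueCard = Fintype.card (ResidueField v.ring) := Nat.card_eq_fintype_card
  set n := v.residueCard
  have hn : 1 < n := by rw [hcard]; exact Fintype.one_lt_card
  have hpoly : (X ^ n - X : (ResidueField P.ring)[X]) ≠ 0 :=
    FiniteField.X_pow_card_sub_X_ne_zero _ hn
  have hsub : Finset.univ.image φ ⊆ (X ^ n - X : (ResidueField P.ring)[X]).roots.toFinset := by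
    intro z hz
    obtain ⟨w, -, rfl⟩ := Finset.mem_image.1 hz
    rw [Multiset.mem_toFinset, mem_roots hpoly, IsRoot.def, eval_sub, eval_pow, eval_X, ← map_pow,
      hcard, FiniteField.pow_card, sub_self]
  have heq : Finset.univ.image φ = (X ^ n - X : (ResidueField P.ring)[X]).roots.toFinset := by
    refine Finset.eq_of_subset_of_card_le hsub ?_
    rw [Finset.card_image_of_injective _ φ.injective, Finset.card_univ, ← hcard]
    refine (Multiset.toFinset_card_le _).trans ((card_roots' _).trans ?_)
    rw [FiniteField.X_pow_card_sub_X_natDegree_eq _ hn]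
  have hmem : residue P.ring ⟨e, he⟩ ∈ Finset.univ.image φ := by
    rw [heq, Multiset.mem_toFinset, mem_roots hpoly, IsRoot.def, eval_sub, eval_pow, eval_X,
      ← map_pow, sub_eq_zero]
    congr 1
    exact Subtype.ext h
  obtain ⟨w, -, hw⟩ := Finset.mem_image.1 hmem
  obtain ⟨a, rfl⟩ := residue_surjective w
  refine ⟨a, a.2, ?_⟩
  have h1 : ι a - ⟨e, he⟩ ∈ maximalIdeal P.ring := by
    rw [← residue_eq_zero_iff, map_sub, sub_eq_zero, ← hw]; rfl
  exact P.ring.coe_mem_nonunits_iff.2 h1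

/-- F. K. Schmidt's theorem: no prime number divides the degrees of all places. -/
theorem exists_not_dvd_degree (k K : Type*) [Field k] [Finite k] [Field K] [Algebra k K]
    [HasDiscretePlaces K] [IsFunctionField k K]
    (hk : ∀ x : K, IsAlgebraic k x → x ∈ (algebraMap k K).range) {l : ℕ} (hl : l.Prime) :
    ∃ v : Place K, ¬ l ∣ v.degree k := by
  by_contra! hdvd
  set Q := Nat.card k ^ l with hQ
  have hk1 : 1 < Nat.card k := Finite.one_lt_card
  have hQ1 : 1 < Q := Nat.one_lt_pow hl.ne_zero hk1
  set f : K[X] := X ^ Q - X with hf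
  obtain ⟨p, hp⟩ := CharP.exists k
  have hsep : f.Separable := by
    have hpK : CharP K p := charP_of_injective_algebraMap (algebraMap k K).injective p
    refine galois_poly_separable p Q ((CharP.cast_eq_zero_iff k p Q).1 ?_)
    have := Fintype.ofFinite k
    rw [hQ, Nat.cast_pow, Nat.card_eq_fintype_card, FiniteField.cast_card_eq_zero,
      zero_pow hl.ne_zero]
  let L := f.SplittingField
  have hGal : IsGalois K L := IsGalois.of_separable_splitting_field hsep
  have : IsFunctionField k L := IsFunctionField.of_finite k K L
  have : HasDiscretePlaces L := IsFunctionField.hasDiscretePlaces k L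
  have hfL : ∀ e : L, e ∈ f.rootSet L ↔ e ^ Q = e := by
    intro e
    have h1 : aeval e f = e ^ Q - e := by simp [hf]
    rw [mem_rootSet, h1, sub_eq_zero]
    exact and_iff_right (FiniteField.X_pow_card_sub_X_ne_zero K hQ1)
  have halg : ∀ e : L, e ^ Q = e → IsAlgebraic k e := fun e he =>
    ⟨X ^ Q - X, FiniteField.X_pow_card_sub_X_ne_zero k hQ1, by simp [he]⟩
  -- a nontrivial automorphism
  obtain ⟨σ, hσ⟩ : ∃ σ : L ≃ₐ[K] L, σ ≠ 1 := by
    by_contra! h1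
    have hbot : ∀ e : L, e ∈ (⊥ : IntermediateField K L) := fun e =>
      (IsGalois.mem_bot_iff_fixed e).2 fun σ => by rw [h1 σ]; rfl
    have hcardroots : Nat.card (f.rootSet L) = Q := by
      rw [Nat.card_eq_fintype_card, card_rootSet_eq_natDegree hsep (SplittingField.splits f), hf,
        FiniteField.X_pow_card_sub_X_natDegree_eq K hQ1]
    have hinj : ∀ e : f.rootSet L, ∃ c : k, algebraMap k L c = e := by
      rintro ⟨e, he⟩
      obtain ⟨a, rfl⟩ := IntermediateField.mem_bot.1 (hbot e)
      have h2 := halg _ ((hfL _).1 he)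
      obtain ⟨c, hc⟩ := hk a ((isAlgebraic_algebraMap_iff (algebraMap K L).injective).1 h2)
      exact ⟨c, by rw [IsScalarTower.algebraMap_apply k K L, hc]⟩
    choose g hg using hinj
    have hle := Nat.card_le_card_of_injective g fun a b hab => Subtype.ext (by rw [← hg, ← hg, hab])
    rw [hcardroots, hQ] at hle
    have := Nat.pow_lt_pow_right hk1 hl.one_lt
    rw [pow_one] at this
    omega
  let τ : L ≃ₐ[k] L := σ.restrictScalars k
  have hτσ : ∀ (i : ℕ) (x : L), (τ ^ i) x = (σ ^ i) x := fun i => by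
    induction i with
    | zero => exact fun _ => rfl
    | succ i ih => intro x; rw [pow_succ, pow_succ, AlgEquiv.mul_apply, AlgEquiv.mul_apply, ih]; rfl
  have hfix : ∀ i : ℕ, (∀ e : L, e ^ Q = e → (τ ^ i) e = e) → τ ^ i = 1 := by
    intro i h
    have h1 : ((σ ^ i : L ≃ₐ[K] L) : L →ₐ[K] L) = AlgHom.id K L :=
      AlgHom.ext_of_adjoin_eq_top (SplittingField.adjoin_rootSet f) fun e he => by
        have := h e ((hfL e).1 he)
        rwa [hτσ] at this
    ext x
    rw [hτσ]
    exact DFunLike.congr_fun h1 x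
  have hpos : 0 < orderOf τ := by
    refine orderOf_pos_iff.2 (isOfFinOrder_iff_pow_eq_one.2 ⟨orderOf σ, orderOf_pos σ, ?_⟩)
    ext x
    rw [hτσ, pow_orderOf_eq_one]
    rfl
  have hlt := orderOf_lt_two_of_free τ hpos (fun i hi hiN P hP => ?_) (fun i hi hiN => ?_)
  · have : orderOf τ = 1 := by omega
    rw [orderOf_eq_one_iff] at this
    exact hσ (AlgEquiv.ext fun x => DFunLike.congr_fun this x)
  · have hne : τ ^ i ≠ 1 := pow_ne_one_of_lt_orderOf hi.ne' hiN
    refine hne (hfix i fun e he => ?_)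
    have heP : e ∈ P.ring := P.mem_of_isAlgebraic (halg e he)
    obtain ⟨a, haP, ha⟩ := P.exists_sub_mem_nonunits (K := K) heP (by
      obtain ⟨m, hm⟩ := hdvd (P.comap (K := K))
      rw [Place.residueCard_eq k, hm, pow_mul, ← hQ]
      clear hm
      induction m with
      | zero => simp
      | succ m ih => rw [pow_succ, pow_mul, ih, he])
    have hτa : (τ ^ i) (algebraMap K L a) = algebraMap K L a := by
      rw [hτσ, AlgEquiv.commutes]
    by_contra hne'
    set d := (τ ^ i) e - e with hd
    have hd0 : d ≠ 0 := sub_ne_zero.2 hne'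
    have h1 : d ∈ P.ring.nonunits := by
      have h2 : (τ ^ i) (algebraMap K L a - e) ∈ P.ring.nonunits := by
        rw [ValuationSubring.mem_nonunits_iff_or] at ha ⊢
        have h3 := map_mem_smul_iff (τ ^ i) P (algebraMap K L a - e)⁻¹
        rw [hP] at h3
        rw [← map_inv₀, h3]
        exact ha.imp (fun h => by rw [h, map_zero]) id
      have : d = (algebraMap K L a - e) - (τ ^ i) (algebraMap K L a - e) := by
        rw [map_sub, hτa, hd]; ring
      rw [this]
      exact sub_mem ha h2
    refine P.transcendental_of_mem_nonunits (k := k) hd0 h1 ?_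
    exact ((halg e he).algHom (τ ^ i : L ≃ₐ[k] L).toAlgHom).sub (halg e he)
  · by_contra! h
    exact pow_ne_one_of_lt_orderOf hi.ne' hiN (hfix i fun e he => h e (halg e he))

end GlobalFunctionField

section Modulus

set_option linter.unusedSectionVars false

open Filter
open scoped InnerProductSpace ComplexConjugate

variable {G : Type*} [CommGroup G] [TopologicalSpace G] [IsTopologicalGroup G]
  [MeasurableSpace G] [BorelSpace G]

/-- `N` is a positive multiplicative function on the group `G`, along which the pushforward of the
measure `μ` is invariant under inversion. -/
structure IsModulus (μ : Measure G) (N : G → ℝ) : Prop where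
  map_mul : ∀ x y, N (x * y) = N x * N y
  pos : ∀ x, 0 < N x
  aemeasurable : AEMeasurable N μ
  map_inv : (μ.map N).map Inv.inv = μ.map N

/-- The convolution `x ↦ ∫ κ(N x / N y) f(y) dμ(y)`. -/
noncomputable def modulusConv (μ : Measure G) (N : G → ℝ) (κ : ℝ → ℝ) (f : G → ℂ) (x : G) : ℂ :=
  ∫ y, (κ (N x / N y) : ℂ) * f y ∂μ

namespace IsModulus

variable {μ : Measure G} {N : G → ℝ}

theorem map_one (h : IsModulus μ N) : N 1 = 1 := by
  have := h.map_mul 1 1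
  rw [mul_one] at this
  exact (mul_eq_left₀ (h.pos 1).ne').1 this.symm

theorem map_inv' (h : IsModulus μ N) (x : G) : N x⁻¹ = (N x)⁻¹ := by
  refine eq_inv_of_mul_eq_one_left ?_
  rw [← h.map_mul, inv_mul_cancel, h.map_one]

theorem map_div (h : IsModulus μ N) (x y : G) : N (x / y) = N x / N y := by
  rw [div_eq_mul_inv, h.map_mul, h.map_inv', div_eq_mul_inv]

section

variable [μ.IsMulLeftInvariant]

theorem map_div_const (h : IsModulus μ N) (y : G) : μ.map (fun x => N x / N y) = μ.map N := by
  have h1 := (measurePreserving_mul_left μ y⁻¹).map_eq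
  have h2 : (fun x => N x / N y) = N ∘ (fun x => y⁻¹ * x) := by
    ext x
    simp only [Function.comp]
    rw [h.map_mul, h.map_inv', mul_comm, div_eq_mul_inv]
  rw [h2, ← AEMeasurable.map_map_of_aemeasurable (by rw [h1]; exact h.aemeasurable)
    (measurable_const_mul _).aemeasurable, h1]

theorem map_const_div (h : IsModulus μ N) (x : G) : μ.map (fun y => N x / N y) = μ.map N := by
  have h2 : (fun y => N x / N y) = Inv.inv ∘ (fun y => N y / N x) := by
    ext y
    simp
  rw [h2, ← AEMeasurable.map_map_of_aemeasurable measurable_inv.aemeasurable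
    (h.aemeasurable.div_const _), h.map_div_const, h.map_inv]

theorem lintegral_const_div (h : IsModulus μ N) {g : ℝ → ENNReal} (hg : Measurable g) (x : G) :
    ∫⁻ y, g (N x / N y) ∂μ = ∫⁻ t, g t ∂(μ.map N) := by
  rw [← h.map_const_div x, lintegral_map' hg.aemeasurable (h.aemeasurable.const_div _)]

theorem lintegral_div_const (h : IsModulus μ N) {g : ℝ → ENNReal} (hg : Measurable g) (y : G) :
    ∫⁻ x, g (N x / N y) ∂μ = ∫⁻ t, g t ∂(μ.map N) := by
  rw [← h.map_div_const y, lintegral_map' hg.aemeasurable (h.aemeasurable.div_const _)]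

theorem ae_const_div (h : IsModulus μ N) {p : ℝ → Prop} (hp : ∀ᵐ t ∂(μ.map N), p t) (x : G) :
    ∀ᵐ y ∂μ, p (N x / N y) := by
  rw [← h.map_const_div x] at hp
  exact ae_of_ae_map (h.aemeasurable.const_div _) hp

end

theorem integrable_inv (h : IsModulus μ N) {κ : ℝ → ℝ} (hκi : Integrable κ (μ.map N)) :
    Integrable (fun t => κ t⁻¹) (μ.map N) := by
  rw [← h.map_inv] at hκi
  exact hκi.comp_measurable measurable_inv

variable [SigmaFinite μ] {κ : ℝ → ℝ} {f : G → ℂ}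

theorem aemeasurable_kernel (h : IsModulus μ N) {X : Type*} [MeasurableSpace X] {g : ℝ → X}
    (hg : Measurable g) :
    AEMeasurable (fun p : G × G => g (N p.1 / N p.2)) (μ.prod μ) :=
  hg.comp_aemeasurable (h.aemeasurable.comp_fst.div h.aemeasurable.comp_snd)

theorem aemeasurable_kernel_mul (h : IsModulus μ N) (hκ : Measurable κ) {φ : G → ENNReal}
    (hφ : AEMeasurable φ μ) :
    AEMeasurable (fun p : G × G => ‖κ (N p.1 / N p.2)‖ₑ * φ p.2) (μ.prod μ) :=
  (h.aemeasurable_kernel hκ.enorm).mul hφ.comp_snd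

theorem aestronglyMeasurable_kernel_mul (h : IsModulus μ N) (hκ : Measurable κ)
    (hf : AEStronglyMeasurable f μ) :
    AEStronglyMeasurable (fun p : G × G => (κ (N p.1 / N p.2) : ℂ) * f p.2) (μ.prod μ) :=
  (h.aemeasurable_kernel (Complex.measurable_ofReal.comp hκ)).aestronglyMeasurable.mul
    hf.comp_snd

variable [μ.IsMulLeftInvariant]

/-- Cauchy–Schwarz for a convolution operator. -/
theorem lintegral_kernel_mul_rpow_le (h : IsModulus μ N) (hκ : Measurable κ) {φ : G → ENNReal}
    (hφ : AEMeasurable φ μ) (x : G) :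
    (∫⁻ y, ‖κ (N x / N y)‖ₑ * φ y ∂μ) ^ (2 : ℝ) ≤
      (∫⁻ t, ‖κ t‖ₑ ∂(μ.map N)) * ∫⁻ y, ‖κ (N x / N y)‖ₑ * φ y ^ (2 : ℝ) ∂μ := by
  have hm : AEMeasurable (fun y => ‖κ (N x / N y)‖ₑ) μ :=
    hκ.enorm.comp_aemeasurable (h.aemeasurable.const_div _)
  have h1 := ENNReal.lintegral_mul_le_Lp_mul_Lq μ Real.HolderConjugate.two_two
    (hm.pow_const (1 / 2 : ℝ)) ((hm.pow_const (1 / 2 : ℝ)).mul hφ)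
  have h2 : ∀ z : ENNReal, (z ^ (1 / 2 : ℝ)) ^ (2 : ℝ) = z := fun z => by
    rw [← ENNReal.rpow_mul]; norm_num
  have h3 : ∀ z w : ENNReal, z ^ (1 / 2 : ℝ) * (z ^ (1 / 2 : ℝ) * w) = z * w := fun z w => by
    rw [← mul_assoc, ← ENNReal.rpow_add_of_nonneg _ _ (by norm_num) (by norm_num)]; norm_num
  simp only [Pi.mul_apply, h3, h2, ENNReal.mul_rpow_of_nonneg _ _ (zero_le_two (α := ℝ))] at h1
  have h4 := ENNReal.rpow_le_rpow h1 (zero_le_two (α := ℝ))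
  rwa [ENNReal.mul_rpow_of_nonneg _ _ (zero_le_two (α := ℝ)), h2, h2,
    h.lintegral_const_div hκ.enorm] at h4

theorem lintegral_lintegral_kernel_mul (h : IsModulus μ N) (hκ : Measurable κ) {φ : G → ENNReal}
    (hφ : AEMeasurable φ μ) :
    ∫⁻ x, ∫⁻ y, ‖κ (N x / N y)‖ₑ * φ y ∂μ ∂μ = (∫⁻ t, ‖κ t‖ₑ ∂(μ.map N)) * ∫⁻ y, φ y ∂μ := by
  rw [lintegral_lintegral_swap (h.aemeasurable_kernel_mul hκ hφ),
    ← lintegral_const_mul'' _ hφ]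
  refine lintegral_congr fun y => ?_
  have hm : AEMeasurable (fun x => ‖κ (N x / N y)‖ₑ) μ :=
    hκ.enorm.comp_aemeasurable (h.aemeasurable.div_const _)
  rw [lintegral_mul_const'' _ hm, h.lintegral_div_const hκ.enorm]

/-- Schur's test for a convolution operator. -/
theorem lintegral_rpow_le (h : IsModulus μ N) (hκ : Measurable κ) {φ : G → ENNReal}
    (hφ : AEMeasurable φ μ) :
    ∫⁻ x, (∫⁻ y, ‖κ (N x / N y)‖ₑ * φ y ∂μ) ^ (2 : ℝ) ∂μ ≤
      (∫⁻ t, ‖κ t‖ₑ ∂(μ.map N)) ^ (2 : ℝ) * ∫⁻ y, φ y ^ (2 : ℝ) ∂μ := by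
  refine (lintegral_mono fun x => h.lintegral_kernel_mul_rpow_le hκ hφ x).trans ?_
  rw [lintegral_const_mul'' _ (h.aemeasurable_kernel_mul hκ
      (hφ.pow_const (2 : ℝ))).lintegral_prod_right',
    h.lintegral_lintegral_kernel_mul hκ (hφ.pow_const _), ← mul_assoc, ENNReal.rpow_two, sq]

theorem lintegral_enorm_rpow_lt_top (hf : MemLp f 2 μ) : ∫⁻ y, ‖f y‖ₑ ^ (2 : ℝ) ∂μ < ⊤ := by
  have := eLpNorm_nnreal_pow_eq_lintegral (f := f) (μ := μ) (two_ne_zero (α := NNReal))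
  simp only [NNReal.coe_ofNat, ENNReal.coe_ofNat] at this
  rw [← this]
  exact ENNReal.rpow_lt_top_of_nonneg zero_le_two hf.2.ne

theorem ae_lintegral_lt_top (h : IsModulus μ N) (hκ : Measurable κ) (hκi : Integrable κ (μ.map N))
    {φ : G → ENNReal} (hφ : AEMeasurable φ μ) (hφ2 : ∫⁻ y, φ y ^ (2 : ℝ) ∂μ < ⊤) :
    ∀ᵐ x ∂μ, ∫⁻ y, ‖κ (N x / N y)‖ₑ * φ y ∂μ < ⊤ := by
  filter_upwards [ae_lt_top' ((h.aemeasurable_kernel_mul hκ hφ).lintegral_prod_right'.pow_const _)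
    ((h.lintegral_rpow_le hκ hφ).trans_lt (ENNReal.mul_lt_top
      (ENNReal.rpow_lt_top_of_nonneg zero_le_two hκi.2.ne) hφ2)).ne] with x hx
  by_contra! htop
  rw [top_le_iff] at htop
  rw [htop] at hx
  simp at hx

theorem aestronglyMeasurable_section (h : IsModulus μ N) (hκ : Measurable κ)
    (hf : AEStronglyMeasurable f μ) (x : G) :
    AEStronglyMeasurable (fun y => (κ (N x / N y) : ℂ) * f y) μ :=
  ((Complex.measurable_ofReal.comp hκ).comp_aemeasurable
    (h.aemeasurable.const_div (N x))).aestronglyMeasurable.mul hf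

theorem enorm_kernel_mul (t : ℝ) (z : ℂ) : ‖(κ t : ℂ) * z‖ₑ = ‖κ t‖ₑ * ‖z‖ₑ := by
  rw [enorm_mul, ← ofReal_norm, ← ofReal_norm (κ t), Complex.norm_real]

theorem ae_integrable (h : IsModulus μ N) (hκ : Measurable κ) (hκi : Integrable κ (μ.map N))
    (hf : MemLp f 2 μ) :
    ∀ᵐ x ∂μ, Integrable (fun y => (κ (N x / N y) : ℂ) * f y) μ := by
  filter_upwards [h.ae_lintegral_lt_top hκ hκi hf.1.enorm (lintegral_enorm_rpow_lt_top hf)] with x hx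
  refine ⟨h.aestronglyMeasurable_section hκ hf.1 x, ?_⟩
  rw [HasFiniteIntegral]
  simpa only [enorm_kernel_mul] using hx

theorem integrable_of_sq (h : IsModulus μ N) (hκi : MemLp κ 2 (μ.map N)) (hf : MemLp f 2 μ) (x : G) :
    Integrable (fun y => (κ (N x / N y) : ℂ) * f y) μ := by
  refine MemLp.integrable_mul (p := 2) (q := 2) (f := fun y => (κ (N x / N y) : ℂ)) ?_ hf
  rw [← h.map_const_div x] at hκi
  exact (hκi.comp_of_map (h.aemeasurable.const_div _)).ofReal

theorem enorm_modulusConv_le (x : G) :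
    ‖modulusConv μ N κ f x‖ₑ ≤ ∫⁻ y, ‖κ (N x / N y)‖ₑ * ‖f y‖ₑ ∂μ := by
  refine (enorm_integral_le_lintegral_enorm _).trans_eq ?_
  simp only [enorm_kernel_mul]

theorem aestronglyMeasurable_modulusConv (h : IsModulus μ N) (hκ : Measurable κ)
    (hf : AEStronglyMeasurable f μ) : AEStronglyMeasurable (modulusConv μ N κ f) μ :=
  (h.aestronglyMeasurable_kernel_mul hκ hf).integral_prod_right'

theorem eLpNorm_modulusConv_le (h : IsModulus μ N) (hκ : Measurable κ)
    (hf : AEStronglyMeasurable f μ) :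
    eLpNorm (modulusConv μ N κ f) 2 μ ≤ (∫⁻ t, ‖κ t‖ₑ ∂(μ.map N)) * eLpNorm f 2 μ := by
  have h1 : ∀ g : G → ℂ, eLpNorm g 2 μ ^ (2 : ℝ) = ∫⁻ y, ‖g y‖ₑ ^ (2 : ℝ) ∂μ := fun g => by
    have := eLpNorm_nnreal_pow_eq_lintegral (f := g) (μ := μ) (two_ne_zero (α := NNReal))
    simpa only [NNReal.coe_ofNat, ENNReal.coe_ofNat] using this
  rw [← ENNReal.rpow_le_rpow_iff (zero_lt_two (α := ℝ)), ENNReal.mul_rpow_of_nonneg _ _ (zero_le_two (α := ℝ)),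
    h1, h1]
  exact (lintegral_mono fun x => ENNReal.rpow_le_rpow (enorm_modulusConv_le x) zero_le_two).trans
    (h.lintegral_rpow_le hκ hf.enorm)

theorem memLp_modulusConv (h : IsModulus μ N) (hκ : Measurable κ) (hκi : Integrable κ (μ.map N))
    (hf : MemLp f 2 μ) : MemLp (modulusConv μ N κ f) 2 μ :=
  ⟨h.aestronglyMeasurable_modulusConv hκ hf.1, (h.eLpNorm_modulusConv_le hκ hf.1).trans_lt
    (ENNReal.mul_lt_top hκi.2 hf.2)⟩

theorem modulusConv_congr {f g : G → ℂ} (hfg : f =ᵐ[μ] g) (x : G) :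
    modulusConv μ N κ f x = modulusConv μ N κ g x :=
  integral_congr_ae (hfg.mono fun y hy => by simp only [hy])

/-- Convolution as a bounded operator on `L²`. -/
noncomputable def convOperator (h : IsModulus μ N) (hκ : Measurable κ)
    (hκi : Integrable κ (μ.map N)) : Lp ℂ 2 μ →L[ℂ] Lp ℂ 2 μ :=
  LinearMap.mkContinuous
    { toFun := fun f => (h.memLp_modulusConv hκ hκi (Lp.memLp f)).toLp
      map_add' := fun f g => by
        ext1
        filter_upwards [MemLp.coeFn_toLp (h.memLp_modulusConv hκ hκi (Lp.memLp (f + g))),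
          MemLp.coeFn_toLp (h.memLp_modulusConv hκ hκi (Lp.memLp f)),
          MemLp.coeFn_toLp (h.memLp_modulusConv hκ hκi (Lp.memLp g)),
          Lp.coeFn_add ((h.memLp_modulusConv hκ hκi (Lp.memLp f)).toLp)
            ((h.memLp_modulusConv hκ hκi (Lp.memLp g)).toLp),
          h.ae_integrable hκ hκi (Lp.memLp f), h.ae_integrable hκ hκi (Lp.memLp g)]
          with x h1 h2 h3 h4 h5 h6
        rw [h1, h4, Pi.add_apply, h2, h3, modulusConv_congr (Lp.coeFn_add f g), modulusConv,
          modulusConv, modulusConv, ← integral_add h5 h6]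
        simp only [Pi.add_apply, mul_add]
      map_smul' := fun c f => by
        ext1
        filter_upwards [MemLp.coeFn_toLp (h.memLp_modulusConv hκ hκi (Lp.memLp (c • f))),
          MemLp.coeFn_toLp (h.memLp_modulusConv hκ hκi (Lp.memLp f)),
          Lp.coeFn_smul c ((h.memLp_modulusConv hκ hκi (Lp.memLp f)).toLp)] with x h1 h2 h3
        rw [h1, RingHom.id_apply, h3, Pi.smul_apply, h2, modulusConv_congr (Lp.coeFn_smul c f),
          modulusConv, modulusConv, smul_eq_mul, ← integral_const_mul]
        simp only [Pi.smul_apply, smul_eq_mul, mul_left_comm] }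
    (∫⁻ t, ‖κ t‖ₑ ∂(μ.map N)).toReal fun f => by
      simp only [LinearMap.coe_mk, AddHom.coe_mk]
      rw [Lp.norm_toLp, Lp.norm_def, ← ENNReal.toReal_mul]
      exact ENNReal.toReal_mono (ENNReal.mul_ne_top hκi.2.ne (Lp.memLp f).2.ne)
        (h.eLpNorm_modulusConv_le hκ (Lp.memLp f).1)

theorem convOperator_ae_eq (h : IsModulus μ N) (hκ : Measurable κ) (hκi : Integrable κ (μ.map N))
    (f : Lp ℂ 2 μ) : h.convOperator hκ hκi f =ᵐ[μ] modulusConv μ N κ f :=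
  MemLp.coeFn_toLp (h.memLp_modulusConv hκ hκi (Lp.memLp f))

end IsModulus

end Modulus

section Modulus

set_option linter.unusedSectionVars false

open Filter
open scoped InnerProductSpace ComplexConjugate

variable {G : Type*} [CommGroup G] [TopologicalSpace G] [IsTopologicalGroup G]
  [MeasurableSpace G] [BorelSpace G]

namespace IsModulus

variable {μ : Measure G} {N : G → ℝ} [SigmaFinite μ] {κ κ₁ κ₂ κ₃ : ℝ → ℝ} {f : G → ℂ}
  [μ.IsMulLeftInvariant]

theorem convOperator_add (h : IsModulus μ N) (hκ₁ : Measurable κ₁) (hκ₂ : Measurable κ₂)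
    (hi₁ : Integrable κ₁ (μ.map N)) (hi₂ : Integrable κ₂ (μ.map N)) :
    h.convOperator (hκ₁.add hκ₂) (hi₁.add hi₂) =
      h.convOperator hκ₁ hi₁ + h.convOperator hκ₂ hi₂ := by
  ext1 f
  rw [add_apply]
  ext1
  filter_upwards [h.convOperator_ae_eq (hκ₁.add hκ₂) (hi₁.add hi₂) f,
    h.convOperator_ae_eq hκ₁ hi₁ f, h.convOperator_ae_eq hκ₂ hi₂ f,
    Lp.coeFn_add (h.convOperator hκ₁ hi₁ f) (h.convOperator hκ₂ hi₂ f),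
    h.ae_integrable hκ₁ hi₁ (Lp.memLp f), h.ae_integrable hκ₂ hi₂ (Lp.memLp f)]
    with x h1 h2 h3 h4 h5 h6
  rw [h1, h4, Pi.add_apply, h2, h3, modulusConv, modulusConv, modulusConv, ← integral_add h5 h6]
  simp only [Pi.add_apply, Complex.ofReal_add, add_mul]

theorem convOperator_comp (h : IsModulus μ N) (hκ₁ : Measurable κ₁) (hκ₂ : Measurable κ₂)
    (hκ₃ : Measurable κ₃) (hi₁ : Integrable κ₁ (μ.map N)) (hi₂ : Integrable κ₂ (μ.map N))
    (hi₃ : Integrable κ₃ (μ.map N))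
    (hconv : ∀ᵐ t ∂(μ.map N), ∫ s, κ₁ (t / s) * κ₂ s ∂(μ.map N) = κ₃ t) :
    h.convOperator hκ₁ hi₁ * h.convOperator hκ₂ hi₂ = h.convOperator hκ₃ hi₃ := by
  ext1 f
  rw [mul_apply_eq_comp]
  ext1
  have hf := Lp.memLp f
  have hm := h.aemeasurable_kernel_mul hκ₂ hf.1.enorm
  have hlt := h.ae_lintegral_lt_top hκ₁ hi₁ hm.lintegral_prod_right'
    ((h.lintegral_rpow_le hκ₂ hf.1.enorm).trans_lt (ENNReal.mul_lt_top
      (ENNReal.rpow_lt_top_of_nonneg zero_le_two hi₂.2.ne) (lintegral_enorm_rpow_lt_top hf)))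
  filter_upwards [h.convOperator_ae_eq hκ₁ hi₁ (h.convOperator hκ₂ hi₂ f),
    h.convOperator_ae_eq hκ₃ hi₃ f, hlt] with x h1 h2 hx
  rw [h1, h2, modulusConv_congr (h.convOperator_ae_eq hκ₂ hi₂ f)]
  simp only [modulusConv, ← integral_const_mul]
  rw [integral_integral_swap]
  · refine integral_congr_ae ?_
    filter_upwards [h.ae_const_div hconv x] with z hz
    simp only [← mul_assoc]
    rw [integral_mul_const]
    congr 1
    rw [← hz, ← h.map_div_const z, integral_map (h.aemeasurable.div_const _)]
    · rw [← integral_complex_ofReal]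
      refine integral_congr_ae (Eventually.of_forall fun y => ?_)
      simp only [div_div_div_cancel_right₀ (h.pos z).ne', Complex.ofReal_mul]
    · exact ((hκ₁.comp (measurable_const.div measurable_id)).mul hκ₂).aestronglyMeasurable
  · have hmeas : AEStronglyMeasurable (fun p : G × G =>
        (κ₁ (N x / N p.1) : ℂ) * ((κ₂ (N p.1 / N p.2) : ℂ) * f p.2)) (μ.prod μ) :=
      ((Complex.measurable_ofReal.comp hκ₁).comp_aemeasurable
        (h.aemeasurable.const_div (N x))).aestronglyMeasurable.comp_fst.mul
        (h.aestronglyMeasurable_kernel_mul hκ₂ hf.1)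
    refine ⟨hmeas, (lintegral_prod _ hmeas.enorm).trans_lt ?_⟩
    simp only [enorm_kernel_mul]
    refine lt_of_eq_of_lt (lintegral_congr fun y => ?_) hx
    exact lintegral_const_mul' _ _ enorm_ne_top

/-- The adjoint of a convolution operator is the convolution with the inverted kernel. -/
theorem adjoint_convOperator (h : IsModulus μ N) (hκ : Measurable κ)
    (hi : Integrable κ (μ.map N)) :
    ContinuousLinearMap.adjoint (h.convOperator hκ hi) =
      h.convOperator (hκ.comp measurable_inv) (h.integrable_inv hi) := by
  symm
  rw [ContinuousLinearMap.eq_adjoint_iff]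
  intro f g
  have hf := Lp.memLp f
  have hg := Lp.memLp g
  have hmeas : AEStronglyMeasurable (fun p : G × G =>
      (κ (N p.1 / N p.2) : ℂ) * g p.2 * conj (f p.1)) (μ.prod μ) :=
    (h.aestronglyMeasurable_kernel_mul hκ hg.1).mul
      (Complex.continuous_conj.comp_aestronglyMeasurable hf.1.comp_fst)
  have hint : Integrable (Function.uncurry fun x y : G =>
      (κ (N x / N y) : ℂ) * g y * conj (f x)) (μ.prod μ) := by
    refine ⟨hmeas, (lintegral_prod _ hmeas.enorm).trans_lt ?_⟩
    simp only [enorm_mul, RCLike.enorm_conj]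
    have h2 : ∀ x, ∫⁻ y, ‖(κ (N x / N y) : ℂ)‖ₑ * ‖g y‖ₑ * ‖f x‖ₑ ∂μ =
        (∫⁻ y, ‖κ (N x / N y)‖ₑ * ‖g y‖ₑ ∂μ) * ‖f x‖ₑ := fun x => by
      rw [lintegral_mul_const' _ _ enorm_ne_top]
      simp only [← enorm_mul, enorm_kernel_mul]
    simp only [h2]
    have h3 := ENNReal.lintegral_mul_le_Lp_mul_Lq μ Real.HolderConjugate.two_two
      (h.aemeasurable_kernel_mul hκ hg.1.enorm).lintegral_prod_right' hf.1.enorm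
    refine h3.trans_lt (ENNReal.mul_lt_top (ENNReal.rpow_lt_top_of_nonneg (by norm_num) ?_)
      (ENNReal.rpow_lt_top_of_nonneg (by norm_num) (lintegral_enorm_rpow_lt_top hf).ne))
    exact ((h.lintegral_rpow_le hκ hg.1.enorm).trans_lt (ENNReal.mul_lt_top
      (ENNReal.rpow_lt_top_of_nonneg zero_le_two hi.2.ne) (lintegral_enorm_rpow_lt_top hg))).ne
  have h1 := integral_integral_swap hint
  rw [L2.inner_def, L2.inner_def]
  have hl : ∫ a, ⟪h.convOperator (hκ.comp measurable_inv) (h.integrable_inv hi) f a, g a⟫_ℂ ∂μ =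
      ∫ y, ∫ x, (κ (N x / N y) : ℂ) * g y * conj (f x) ∂μ ∂μ := by
    refine integral_congr_ae ?_
    filter_upwards [h.convOperator_ae_eq (hκ.comp measurable_inv) (h.integrable_inv hi) f]
      with y hy
    rw [hy, RCLike.inner_apply, modulusConv, ← integral_conj, ← integral_const_mul]
    refine integral_congr_ae (Eventually.of_forall fun x => ?_)
    simp only [Function.comp, _root_.map_mul, Complex.conj_ofReal, inv_div]
    ring
  have hr : ∫ a, ⟪f a, h.convOperator hκ hi g a⟫_ℂ ∂μ =
      ∫ x, ∫ y, (κ (N x / N y) : ℂ) * g y * conj (f x) ∂μ ∂μ := by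
    refine integral_congr_ae ?_
    filter_upwards [h.convOperator_ae_eq hκ hi g] with x hx
    rw [hx, RCLike.inner_apply, modulusConv, ← integral_mul_const]
  rw [hl, hr, h1]

theorem convOperator_regularAction (h : IsModulus μ N) (hκ : Measurable κ)
    (hi : Integrable κ (μ.map N)) (g : G) (f : Lp ℂ 2 μ) :
    h.convOperator hκ hi (regularAction μ g f) = regularAction μ g (h.convOperator hκ hi f) := by
  ext1
  have h3 := (measurePreserving_div_right μ g).quasiMeasurePreserving.ae
    (h.convOperator_ae_eq hκ hi f)
  have h4 : ∀ f : Lp ℂ 2 μ, regularAction μ g f =ᵐ[μ] f ∘ fun u => u / g := fun f =>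
    Lp.coeFn_compMeasurePreserving f (measurePreserving_div_right μ g)
  filter_upwards [h.convOperator_ae_eq hκ hi (regularAction μ g f), h4 (h.convOperator hκ hi f), h3]
    with x h1 h2 h3
  rw [h1, h2, Function.comp, h3, modulusConv_congr (h4 f), modulusConv, modulusConv,
    ← integral_div_right_eq_self (fun y => (κ (N (x / g) / N y) : ℂ) * f y) g]
  simp only [Function.comp, h.map_div, div_div_div_cancel_right₀ (h.pos g).ne']

theorem convOperator_mem_hardySpace (h : IsModulus μ N) (hκ : Measurable κ)
    (hi : Integrable κ (μ.map N)) (hκ1 : ∀ t, 1 < t → κ t = 0) {f : Lp ℂ 2 μ}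
    (hf : f ∈ hardySpace μ N) : h.convOperator hκ hi f ∈ hardySpace μ N := by
  have hf' : ∀ᵐ u ∂μ, 1 < N u → f u = 0 := hf
  change ∀ᵐ u ∂μ, 1 < N u → _ = _
  filter_upwards [h.convOperator_ae_eq hκ hi f] with x hx hx1
  rw [hx, modulusConv]
  refine (integral_congr_ae ?_).trans (integral_zero G ℂ)
  filter_upwards [hf'] with y hy
  rcases lt_or_ge 1 (N x / N y) with h1 | h1
  · rw [hκ1 _ h1, Complex.ofReal_zero, zero_mul]
  · rw [hy (hx1.trans_le ((div_le_one (h.pos y)).1 h1)), mul_zero]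

theorem integrable_modulusConv_uncurry (h : IsModulus μ N) (hκ : Measurable κ)
    (hi : Integrable κ (μ.map N)) (hf : Integrable f μ) :
    Integrable (fun p : G × G => (κ (N p.1 / N p.2) : ℂ) * f p.2) (μ.prod μ) := by
  have hmeas := h.aestronglyMeasurable_kernel_mul hκ hf.1
  refine ⟨hmeas, ?_⟩
  rw [HasFiniteIntegral, lintegral_prod _ hmeas.enorm]
  simp only [enorm_kernel_mul]
  rw [h.lintegral_lintegral_kernel_mul hκ hf.1.enorm]
  exact ENNReal.mul_lt_top hi.2 hf.2

theorem integrable_modulusConv (h : IsModulus μ N) (hκ : Measurable κ)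
    (hi : Integrable κ (μ.map N)) (hf : Integrable f μ) : Integrable (modulusConv μ N κ f) μ :=
  (h.integrable_modulusConv_uncurry hκ hi hf).integral_prod_left

theorem continuous_character (ψ : PontryaginDual G) : Continuous fun u => (ψ u : ℂ) :=
  continuous_subtype_val.comp (map_continuous ψ)

theorem character_mul (ψ : PontryaginDual G) (u v : G) : (ψ (u * v) : ℂ) = ψ u * ψ v := by
  rw [_root_.map_mul, Circle.coe_mul]

theorem fourierMellin_modulusConv (h : IsModulus μ N) (hκ : Measurable κ)
    (hi : Integrable κ (μ.map N)) (hf : Integrable f μ) (ψ : PontryaginDual G) :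
    fourierMellin μ (modulusConv μ N κ f) ψ =
      (∫ u, (κ (N u) : ℂ) * ψ u ∂μ) * fourierMellin μ f ψ := by
  have hψ := continuous_character ψ
  have hint : Integrable (Function.uncurry fun x y : G =>
      (κ (N x / N y) : ℂ) * f y * ψ x) (μ.prod μ) :=
    (h.integrable_modulusConv_uncurry hκ hi hf).mul_bdd (c := 1)
      (hψ.measurable.comp measurable_fst).aestronglyMeasurable
      (Eventually.of_forall fun p => (Circle.norm_coe _).le)
  rw [fourierMellin, fourierMellin, ← integral_const_mul]
  simp only [modulusConv, ← integral_mul_const]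
  rw [integral_integral_swap hint]
  refine integral_congr_ae (Eventually.of_forall fun y => ?_)
  have h1 := integral_div_right_eq_self (μ := μ) (fun x => (κ (N x) : ℂ) * ψ (x * y)) y
  simp only [div_mul_cancel, h.map_div, character_mul, ← mul_assoc] at h1
  rw [integral_mul_const] at h1
  simp only
  rw [integral_mul_const, mul_left_comm, ← h1, ← integral_const_mul]
  refine integral_congr_ae (Eventually.of_forall fun x => ?_)
  simp only
  ring

theorem integral_mul_character_eq_zero (h : IsModulus μ N) {u : G} (hu : N u = 1)
    {ψ : PontryaginDual G} (hψ : ψ u ≠ 1) : ∫ x, (κ (N x) : ℂ) * ψ x ∂μ = 0 := by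
  have h1 := integral_mul_left_eq_self (μ := μ) (fun x => (κ (N x) : ℂ) * ψ x) u
  simp only [h.map_mul, hu, one_mul, character_mul, mul_left_comm _ (ψ u : ℂ)] at h1
  rw [integral_const_mul] at h1
  by_contra h0
  exact hψ (Circle.ext ((mul_eq_right₀ h0).1 h1))

end IsModulus

theorem dense_integrable {X : Type*} [MeasurableSpace X] (μ : Measure X) :
    Dense {f : Lp ℂ 2 μ | Integrable f μ} := by
  refine (Lp.simpleFunc.dense (E := ℂ) (μ := μ) ENNReal.ofNat_ne_top (p := 2)).mono ?_
  intro f hf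
  have h1 := Lp.simpleFunc.toSimpleFunc_eq_toFun (⟨f, hf⟩ : Lp.simpleFunc ℂ 2 μ)
  have h2 : MemLp (Lp.simpleFunc.toSimpleFunc (⟨f, hf⟩ : Lp.simpleFunc ℂ 2 μ)) 2 μ :=
    Lp.simpleFunc.memLp _
  exact ((SimpleFunc.memLp_iff_integrable two_ne_zero ENNReal.ofNat_ne_top).1 h2).congr h1

/-- A multiplier of the Fourier transform on `L¹ ∩ L²` is a spectral multiplier. -/
theorem hasSpectralMultiplier_of_integrable {μ : Measure G} {T : Lp ℂ 2 μ →L[ℂ] Lp ℂ 2 μ}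
    {m : PontryaginDual G → ℂ}
    (hT : ∀ f : Lp ℂ 2 μ, Integrable f μ →
      Integrable (T f) μ ∧ ∀ ψ, fourierMellin μ (T f) ψ = m ψ * fourierMellin μ f ψ) :
    HasSpectralMultiplier μ T m := by
  refine ⟨hT, fun _ _ ν F hF f => ?_⟩
  obtain ⟨g, hg, hgf⟩ := mem_closure_iff_seq_limit.1 (dense_integrable μ f)
  have h1 : Tendsto (fun n => F (g n)) atTop (nhds (F f)) := (F.continuous.tendsto _).comp hgf
  have h2 : Tendsto (fun n => F (T (g n))) atTop (nhds (F (T f))) :=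
    ((F.continuous.comp T.continuous).tendsto _).comp hgf
  obtain ⟨ns, hns, h3⟩ := (tendstoInMeasure_of_tendsto_Lp h1).exists_seq_tendsto_ae
  obtain ⟨ms, hms, h4⟩ :=
    (tendstoInMeasure_of_tendsto_Lp (h2.comp hns.tendsto_atTop)).exists_seq_tendsto_ae
  have h5 : ∀ᵐ ψ ∂ν, ∀ n, F (T (g n)) ψ = m ψ * F (g n) ψ := ae_all_iff.2 fun n => by
    filter_upwards [hF _ (hg n), hF _ (hT _ (hg n)).1] with ψ ha hb
    rw [ha, hb, (hT _ (hg n)).2]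
  filter_upwards [h3, h4, h5] with ψ h3 h4 h5
  refine tendsto_nhds_unique h4 ?_
  simp only [Function.comp, h5]
  exact (h3.comp hms.tendsto_atTop).const_mul _

namespace IsModulus

variable {μ : Measure G} {N : G → ℝ} [SigmaFinite μ] {κ : ℝ → ℝ} [μ.IsMulLeftInvariant]

/-- If the autocorrelation of the kernel `κ` is `κ(t) + κ(1/t)`, then `1 - A` is unitary for the
operator `A` of convolution with `κ`. -/
theorem one_sub_convOperator_mem_unitary (h : IsModulus μ N) (hκ : Measurable κ)
    (hi : Integrable κ (μ.map N))
    (hauto : ∀ᵐ t ∂(μ.map N), ∫ s, κ (t * s) * κ s ∂(μ.map N) = κ t + κ t⁻¹) :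
    1 - h.convOperator hκ hi ∈ unitary (Lp ℂ 2 μ →L[ℂ] Lp ℂ 2 μ) := by
  have hκ' := hκ.comp measurable_inv
  have hi' := h.integrable_inv hi
  have hadd := h.convOperator_add hκ hκ' hi hi'
  have hsub : ∀ g : ℝ → ℝ, Measurable g → ∫ s, g s⁻¹ ∂(μ.map N) = ∫ s, g s ∂(μ.map N) :=
    fun g hg => by
      conv_rhs => rw [← h.map_inv]
      rw [integral_map measurable_inv.aemeasurable hg.aestronglyMeasurable]
  have h1 := h.convOperator_comp hκ hκ' (hκ.add hκ') hi hi' (hi.add hi') (by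
    filter_upwards [hauto] with t ht
    rw [Pi.add_apply, Function.comp, ← ht]
    refine Eq.trans ?_ (hsub (fun s => κ (t * s) * κ s)
      ((hκ.comp (measurable_const.mul measurable_id)).mul hκ))
    simp only [div_eq_mul_inv, Function.comp])
  have hauto' : ∀ᵐ t ∂(μ.map N), ∫ s, κ (t⁻¹ * s) * κ s ∂(μ.map N) = κ t⁻¹ + κ t⁻¹⁻¹ := by
    rw [← h.map_inv] at hauto
    have := ae_of_ae_map measurable_inv.aemeasurable hauto
    rwa [h.map_inv] at this
  have h2 := h.convOperator_comp hκ' hκ (hκ.add hκ') hi' hi (hi.add hi') (by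
    filter_upwards [hauto'] with t ht
    rw [inv_inv, add_comm] at ht
    rw [Pi.add_apply, Function.comp, ← ht]
    simp only [Function.comp, inv_div]
    simp only [div_eq_inv_mul])
  rw [Unitary.mem_iff, star_sub, star_one, ContinuousLinearMap.star_eq_adjoint,
    h.adjoint_convOperator]
  rw [hadd] at h1 h2
  constructor
  · rw [sub_mul, one_mul, mul_sub, mul_one, h2]
    abel
  · rw [sub_mul, one_mul, mul_sub, mul_one, h1]
    abel

theorem exists_convolutionOperator (h : IsModulus μ N) (hκ : Measurable κ)
    (hi : Integrable κ (μ.map N)) (hi2 : MemLp κ 2 (μ.map N)) (hκ1 : ∀ t, 1 < t → κ t = 0)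
    (hauto : ∀ᵐ t ∂(μ.map N), ∫ s, κ (t * s) * κ s ∂(μ.map N) = κ t + κ t⁻¹)
    {a : G → ℝ} (ha : ∀ w, a w = κ (N w)) :
    ∃ A V : Lp ℂ 2 μ →L[ℂ] Lp ℂ 2 μ,
      IsConvolutionOperator μ a A ∧
      V = 1 - A ∧
      V ∈ unitary (Lp ℂ 2 μ →L[ℂ] Lp ℂ 2 μ) ∧
      (∀ (g : G) (f : Lp ℂ 2 μ), V (regularAction μ g f) = regularAction μ g (V f)) ∧
      (∀ f ∈ hardySpace μ N, V f ∈ hardySpace μ N) ∧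
      ∃ m : PontryaginDual G → ℂ,
        HasSpectralMultiplier μ V m ∧
        (∀ ψ, (∃ u, N u = 1 ∧ ψ u ≠ 1) → m ψ = 1) ∧
        (∀ (ψ : PontryaginDual G) (w : ℂ), (∀ u, (ψ u : ℂ) = (N u : ℂ) ^ w) →
          m ψ = 1 - ∫ t, (κ t : ℂ) * (t : ℂ) ^ w ∂(μ.map N)) := by
  refine ⟨h.convOperator hκ hi, 1 - h.convOperator hκ hi, fun f => ⟨fun u₀ => ?_, ?_⟩, rfl,
    h.one_sub_convOperator_mem_unitary hκ hi hauto, fun g f => ?_, fun f hf => ?_,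
    fun ψ => 1 - ∫ u, (κ (N u) : ℂ) * ψ u ∂μ, hasSpectralMultiplier_of_integrable fun f hf => ?_,
    fun ψ ⟨u, hu, hψ⟩ => ?_, fun ψ w hψ => ?_⟩
  · simp only [ha, h.map_div]
    exact h.integrable_of_sq hi2 (Lp.memLp f) u₀
  · simp only [ha, h.map_div]
    exact h.convOperator_ae_eq hκ hi f
  · rw [sub_apply, sub_apply, map_sub,
      h.convOperator_regularAction, one_apply_eq_self, one_apply_eq_self]
  · have h1 : ∀ᵐ u ∂μ, 1 < N u → h.convOperator hκ hi f u = 0 :=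
      h.convOperator_mem_hardySpace hκ hi hκ1 hf
    have h2 : ∀ᵐ u ∂μ, 1 < N u → f u = 0 := hf
    change ∀ᵐ u ∂μ, 1 < N u → _ = _
    rw [sub_apply, one_apply_eq_self]
    filter_upwards [h1, h2, Lp.coeFn_sub f (h.convOperator hκ hi f)] with x hx1 hx2 hx3 hx
    rw [hx3, Pi.sub_apply, hx1 hx, hx2 hx, sub_zero]
  · have h1 := h.integrable_modulusConv hκ hi hf
    have h2 : ((1 - h.convOperator hκ hi) f : Lp ℂ 2 μ) =ᵐ[μ] fun x => f x - modulusConv μ N κ f x := by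
      rw [sub_apply, one_apply_eq_self]
      filter_upwards [Lp.coeFn_sub f (h.convOperator hκ hi f), h.convOperator_ae_eq hκ hi f]
        with x hx1 hx2
      rw [hx1, Pi.sub_apply, hx2]
    refine ⟨(hf.sub h1).congr h2.symm, fun ψ => ?_⟩
    have hb : ∀ {g : G → ℂ}, Integrable g μ → Integrable (fun u => g u * ψ u) μ := fun hg =>
      hg.mul_bdd (c := 1) (continuous_character ψ).measurable.aestronglyMeasurable
        (Eventually.of_forall fun p => (Circle.norm_coe _).le)
    have h3 : fourierMellin μ ((1 - h.convOperator hκ hi) f : Lp ℂ 2 μ) ψ =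
        fourierMellin μ f ψ - fourierMellin μ (modulusConv μ N κ f) ψ := by
      rw [fourierMellin, fourierMellin, fourierMellin, ← integral_sub (hb hf) (hb h1)]
      refine integral_congr_ae (h2.mono fun x hx => ?_)
      simp only [hx, sub_mul]
    rw [h3, h.fourierMellin_modulusConv hκ hi hf]
    ring
  · simp only [h.integral_mul_character_eq_zero hu hψ, sub_zero]
  · have hm : Measurable fun t : ℝ => (κ t : ℂ) * (t : ℂ) ^ w :=
      (Complex.measurable_ofReal.comp hκ).mul (Complex.measurable_ofReal.pow_const w)
    rw [integral_map h.aemeasurable hm.aestronglyMeasurable]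
    simp only [hψ]

end IsModulus

end Modulus

section MultiplicativeHaar

open Filter Set

theorem map_exp_volume :
    (volume : Measure ℝ).map Real.exp =
      (volume.restrict (Ioi (0 : ℝ))).withDensity fun t => ENNReal.ofReal t⁻¹ := by
  ext s hs
  rw [Measure.map_apply Real.measurable_exp hs, withDensity_apply _ hs, ← lintegral_indicator hs,
    ← Real.range_exp, ← image_univ, lintegral_image_eq_lintegral_abs_deriv_mul MeasurableSet.univ
      (fun x _ => (Real.hasDerivAt_exp x).hasDerivWithinAt) Real.exp_injective.injOn,
    ← lintegral_indicator_one (Real.measurable_exp hs), Measure.restrict_univ]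
  refine lintegral_congr fun x => ?_
  by_cases hx : Real.exp x ∈ s
  · rw [indicator_of_mem hx, indicator_of_mem (show x ∈ Real.exp ⁻¹' s from hx),
      abs_of_pos (Real.exp_pos x), ← ENNReal.ofReal_mul (Real.exp_pos x).le,
      mul_inv_cancel₀ (Real.exp_pos x).ne', ENNReal.ofReal_one, Pi.one_apply]
  · rw [indicator_of_notMem hx, indicator_of_notMem (show x ∉ Real.exp ⁻¹' s from hx), mul_zero]

theorem map_inv_map_exp :
    ((volume : Measure ℝ).map Real.exp).map Inv.inv = (volume : Measure ℝ).map Real.exp := by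
  rw [Measure.map_map measurable_inv Real.measurable_exp]
  have : Inv.inv ∘ Real.exp = Real.exp ∘ Neg.neg := by
    ext x
    exact (Real.exp_neg x).symm
  rw [this, ← Measure.map_map Real.measurable_exp measurable_neg, Measure.map_neg_eq_self]

/-- The function `√t` on `t ≤ 1`, and `0` on `t > 1`. -/
noncomputable def sqrtKernel : ℝ → ℝ := indicator (Iic 1) Real.sqrt

theorem measurable_sqrtKernel : Measurable sqrtKernel :=
  Real.continuous_sqrt.measurable.indicator measurableSet_Iic

theorem sqrtKernel_of_one_lt {t : ℝ} (ht : 1 < t) : sqrtKernel t = 0 :=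
  indicator_of_notMem (show t ∉ Iic 1 from ht.not_ge) _

theorem sqrtKernel_exp (x : ℝ) :
    sqrtKernel (Real.exp x) = indicator (Iic 0) (fun x => Real.exp (1 / 2 * x)) x := by
  by_cases hx : x ≤ 0
  · rw [sqrtKernel, indicator_of_mem (show x ∈ Iic 0 from hx),
      indicator_of_mem (show _ ∈ Iic (1 : ℝ) from Real.exp_le_one_iff.2 hx), Real.sqrt_eq_rpow,
      ← Real.exp_mul, mul_comm]
  · rw [sqrtKernel, indicator_of_notMem (show x ∉ Iic 0 from hx),
      indicator_of_notMem (show _ ∉ Iic (1 : ℝ) from fun h => hx (Real.exp_le_one_iff.1 h))]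

theorem integrable_sqrtKernel : Integrable sqrtKernel ((volume : Measure ℝ).map Real.exp) := by
  rw [integrable_map_measure measurable_sqrtKernel.aestronglyMeasurable
    Real.measurable_exp.aemeasurable]
  have : sqrtKernel ∘ Real.exp = indicator (Iic 0) (fun x => Real.exp (1 / 2 * x)) :=
    funext sqrtKernel_exp
  rw [this, integrable_indicator_iff measurableSet_Iic]
  exact integrableOn_exp_mul_Iic (by norm_num) 0

theorem memLp_sqrtKernel : MemLp sqrtKernel 2 ((volume : Measure ℝ).map Real.exp) := by
  rw [memLp_two_iff_integrable_sq measurable_sqrtKernel.aestronglyMeasurable,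
    integrable_map_measure (measurable_sqrtKernel.pow_const 2).aestronglyMeasurable
    Real.measurable_exp.aemeasurable]
  have : (fun x => sqrtKernel x ^ 2) ∘ Real.exp =
      indicator (Iic 0) (fun x => Real.exp (1 * x)) := by
    ext x
    simp only [Function.comp, sqrtKernel_exp]
    by_cases hx : x ∈ Iic (0 : ℝ)
    · rw [indicator_of_mem hx, indicator_of_mem hx, ← Real.exp_nat_mul]
      congr 1
      push_cast
      ring
    · rw [indicator_of_notMem hx, indicator_of_notMem hx, sq, mul_zero]
  rw [this, integrable_indicator_iff measurableSet_Iic]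
  exact integrableOn_exp_mul_Iic one_pos 0

theorem integral_sqrtKernel_mul_sqrtKernel (y : ℝ) :
    ∫ s, sqrtKernel (Real.exp y * s) * sqrtKernel s ∂((volume : Measure ℝ).map Real.exp) =
      Real.exp (y / 2 + min 0 (-y)) := by
  have hm : Measurable fun s => sqrtKernel (Real.exp y * s) * sqrtKernel s :=
    (measurable_sqrtKernel.comp (measurable_const.mul measurable_id)).mul measurable_sqrtKernel
  rw [integral_map Real.measurable_exp.aemeasurable hm.aestronglyMeasurable]
  have : ∀ x, sqrtKernel (Real.exp y * Real.exp x) * sqrtKernel (Real.exp x) =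
      indicator (Iic (min 0 (-y))) (fun x => Real.exp (y / 2) * Real.exp x) x := fun x => by
    rw [← Real.exp_add, sqrtKernel_exp, sqrtKernel_exp]
    by_cases h1 : x ≤ 0
    · by_cases h2 : y + x ≤ 0
      · rw [indicator_of_mem (show _ ∈ Iic (0 : ℝ) from h2),
          indicator_of_mem (show _ ∈ Iic (0 : ℝ) from h1),
          indicator_of_mem (show x ∈ Iic (min 0 (-y)) from le_min h1 (by linarith)),
          ← Real.exp_add, ← Real.exp_add]
        congr 1
        ring
      · rw [indicator_of_notMem (show _ ∉ Iic (0 : ℝ) from h2), zero_mul,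
          indicator_of_notMem (show x ∉ Iic (min 0 (-y)) from
            fun h => h2 (by linarith [(le_min_iff.1 (mem_Iic.1 h)).2]))]
    · rw [indicator_of_notMem (show x ∉ Iic (0 : ℝ) from h1), mul_zero,
          indicator_of_notMem (show x ∉ Iic (min 0 (-y)) from fun h => h1 (le_min_iff.1 (mem_Iic.1 h)).1)]
  simp only [this]
  rw [integral_indicator measurableSet_Iic, integral_const_mul, integral_exp_Iic, Real.exp_add]

theorem ae_integral_sqrtKernel_mul_sqrtKernel :
    ∀ᵐ t ∂((volume : Measure ℝ).map Real.exp),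
      ∫ s, sqrtKernel (t * s) * sqrtKernel s ∂((volume : Measure ℝ).map Real.exp) =
        sqrtKernel t + sqrtKernel t⁻¹ := by
  have h1 : ∀ᵐ t ∂((volume : Measure ℝ).map Real.exp), 0 < t ∧ t ≠ 1 := by
    have hm : MeasurableSet {t : ℝ | 0 < t ∧ t ≠ 1} :=
      measurableSet_Ioi.inter (measurableSet_singleton 1).compl
    rw [ae_map_iff Real.measurable_exp.aemeasurable hm]
    filter_upwards [Measure.ae_ne volume (0 : ℝ)] with x hx
    exact ⟨Real.exp_pos x, fun h => hx (Real.exp_eq_one_iff x |>.1 h)⟩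
  filter_upwards [h1] with t ht
  obtain ⟨y, rfl⟩ : ∃ y, Real.exp y = t := ⟨_, Real.exp_log ht.1⟩
  have hy : y ≠ 0 := fun h => ht.2 (by rw [h, Real.exp_zero])
  rw [integral_sqrtKernel_mul_sqrtKernel, ← Real.exp_neg, sqrtKernel_exp, sqrtKernel_exp]
  rcases lt_or_gt_of_ne hy with h | h
  · rw [indicator_of_mem (show y ∈ Iic (0 : ℝ) from h.le),
      indicator_of_notMem (show -y ∉ Iic (0 : ℝ) from fun h' => by
        rw [mem_Iic] at h'; linarith), min_eq_left (by linarith), add_zero, add_zero]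
    congr 1
    ring
  · rw [indicator_of_mem (show -y ∈ Iic (0 : ℝ) from by rw [mem_Iic]; linarith),
      indicator_of_notMem (show y ∉ Iic (0 : ℝ) from fun h' => by
        rw [mem_Iic] at h'; linarith), min_eq_right (by linarith), zero_add]
    congr 1
    ring

theorem integral_sqrtKernel_mul_cpow {s : ℂ} (hs : s.re = 1 / 2) :
    ∫ t, (sqrtKernel t : ℂ) * (t : ℂ) ^ (s - 1 / 2) ∂((volume : Measure ℝ).map Real.exp) = 1 / s := by
  have hm : Measurable fun t : ℝ => (sqrtKernel t : ℂ) * (t : ℂ) ^ (s - 1 / 2) :=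
    (Complex.measurable_ofReal.comp measurable_sqrtKernel).mul
      (Complex.measurable_ofReal.pow_const _)
  rw [integral_map Real.measurable_exp.aemeasurable hm.aestronglyMeasurable]
  have : ∀ x : ℝ, (sqrtKernel (Real.exp x) : ℂ) * (Real.exp x : ℂ) ^ (s - 1 / 2) =
      indicator (Iic 0) (fun x : ℝ => Complex.exp (s * x)) x := fun x => by
    rw [sqrtKernel_exp]
    by_cases hx : x ∈ Iic (0 : ℝ)
    · rw [indicator_of_mem hx, indicator_of_mem hx, Complex.cpow_def_of_ne_zero
        (Complex.ofReal_ne_zero.2 (Real.exp_pos x).ne'), ← Complex.ofReal_log (Real.exp_pos x).le,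
        Real.log_exp, Complex.ofReal_exp, ← Complex.exp_add]
      congr 1
      push_cast
      ring
    · rw [indicator_of_notMem hx, indicator_of_notMem hx, Complex.ofReal_zero, zero_mul]
  simp only [this]
  rw [integral_indicator measurableSet_Iic, integral_exp_mul_complex_Iic (by rw [hs]; norm_num),
    Complex.ofReal_zero, mul_zero, Complex.exp_zero]

end MultiplicativeHaar

theorem QuotientGroup.map_out_eq {A M : Type*} [CommGroup A] [Monoid M] {H : Subgroup A}
    {f : A →* M} (hf : ∀ a ∈ H, f a = 1) (a : A) : f (Quotient.out (a : A ⧸ H)) = f a := by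
  obtain ⟨h, hh⟩ := QuotientGroup.mk_out_eq_mul H a
  rw [hh, map_mul, hf _ h.2, mul_one]

namespace NumberField

open IsDedekindDomain

variable {K : Type*} [Field K] [NumberField K]

theorem isUnit_snd (v : (AdeleRing (𝓞 K) K)ˣ) : IsUnit v.val.2 :=
  IsUnit.of_mul_eq_one v⁻¹.val.2 (congrArg Prod.snd v.val_inv)

theorem finite_mulSupport_norm (v : (AdeleRing (𝓞 K) K)ˣ) :
    (Function.mulSupport fun p : HeightOneSpectrum (𝓞 K) => ‖v.val.2 p‖).Finite := by
  refine ((FiniteAdeleRing.isUnit_iff.1 (isUnit_snd v)).2.mono fun p hp => ?_ :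
    ∀ᶠ p in Filter.cofinite, ‖v.val.2 p‖ = 1)
  rw [FinitePlace.norm_def, hp, map_one, NNReal.coe_one]

theorem ideleModulus_mul (v w : (AdeleRing (𝓞 K) K)ˣ) :
    ideleModulus (v * w) = ideleModulus v * ideleModulus w := by
  have h1 : ∀ p : HeightOneSpectrum (𝓞 K), ‖(v * w).val.2 p‖ = ‖v.val.2 p‖ * ‖w.val.2 p‖ :=
    fun p => norm_mul _ _
  have h2 : ∀ p : InfinitePlace K, ‖(v * w).val.1 p‖ = ‖v.val.1 p‖ * ‖w.val.1 p‖ :=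
    fun p => norm_mul _ _
  rw [ideleModulus, ideleModulus, ideleModulus]
  simp only [h1, h2, mul_pow, Finset.prod_mul_distrib]
  rw [finprod_mul_distrib (finite_mulSupport_norm v) (finite_mulSupport_norm w)]
  ring

theorem ideleModulus_pos (v : (AdeleRing (𝓞 K) K)ˣ) : 0 < ideleModulus v := by
  refine mul_pos (Finset.prod_pos fun w _ => pow_pos (norm_pos_iff.2 ?_) _)
    (finprod_induction (0 < ·) one_pos (fun _ _ => mul_pos) fun p => norm_pos_iff.2 ((FiniteAdeleRing.isUnit_iff.1 (isUnit_snd v)).1 p))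
  have h : v.val.1 w * v⁻¹.val.1 w = 1 := congrFun (congrArg Prod.fst v.val_inv) w
  exact left_ne_zero_of_mul_eq_one h

/-- The modulus as a homomorphism. -/
noncomputable def ideleModulusHom : (AdeleRing (𝓞 K) K)ˣ →* ℝ where
  toFun := ideleModulus
  map_one' := (mul_eq_left₀ (ideleModulus_pos 1).ne').1 (by rw [← ideleModulus_mul, one_mul])
  map_mul' := ideleModulus_mul

theorem ideleModulus_eq_one {v : (AdeleRing (𝓞 K) K)ˣ} (hv : v ∈ principalIdeles K) :
    ideleModulus v = 1 := by
  obtain ⟨x, rfl⟩ := hv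
  rw [ideleModulus, ← prod_abs_eq_one x.ne_zero,
    ← finprod_comp_equiv FinitePlace.equivHeightOneSpectrum.symm]
  congr 1
  exact Finset.prod_congr rfl fun w _ => congrArg (· ^ w.mult)
    (InfinitePlace.Completion.norm_coe w ((WithAbs.equiv w.1).symm x))

theorem classModulus_mk (v : (AdeleRing (𝓞 K) K)ˣ) :
    classModulus (QuotientGroup.mk v : (AdeleRing (𝓞 K) K)ˣ ⧸ principalIdeles K) =
      ideleModulus v :=
  QuotientGroup.map_out_eq (f := ideleModulusHom) (fun _ => ideleModulus_eq_one) v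

theorem IsNormalized.isModulus {μ : Measure (IdeleClassGroup K)} (h : IsNormalized μ) :
    IsModulus μ classModulus where
  map_mul u w := by
    obtain ⟨u, rfl⟩ := QuotientGroup.mk_surjective u
    obtain ⟨w, rfl⟩ := QuotientGroup.mk_surjective w
    exact (classModulus_mk (u * w)).trans
      ((ideleModulus_mul u w).trans (by rw [← classModulus_mk, ← classModulus_mk]))
  pos u := ideleModulus_pos _
  aemeasurable := by
    by_contra hm
    rw [IsNormalized, Measure.map_of_not_aemeasurable hm, ← map_exp_volume] at h
    have := congrArg (fun ν => ν Set.univ) h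
    simp [Measure.map_apply Real.measurable_exp] at this
  map_inv := by
    rw [IsNormalized] at h
    rw [h, ← map_exp_volume, map_inv_map_exp]

theorem numberFieldKernel_eq {G : Type*} (N : G → ℝ) (w : G) :
    numberFieldKernel N w = sqrtKernel (N w) := rfl

theorem exists_convolutionOperator (μ : Measure (IdeleClassGroup K)) [μ.IsHaarMeasure]
    (hμ : IsNormalized μ) :
    ∃ A V : Lp ℂ 2 μ →L[ℂ] Lp ℂ 2 μ,
      IsConvolutionOperator μ (numberFieldKernel NumberField.classModulus) A ∧
      V = 1 - A ∧
      V ∈ unitary (Lp ℂ 2 μ →L[ℂ] Lp ℂ 2 μ) ∧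
      (∀ (g : NumberField.IdeleClassGroup K) (f : Lp ℂ 2 μ),
        V (regularAction μ g f) = regularAction μ g (V f)) ∧
      (∀ f ∈ hardySpace μ NumberField.classModulus,
        V f ∈ hardySpace μ NumberField.classModulus) ∧
      ∃ m : PontryaginDual (NumberField.IdeleClassGroup K) → ℂ,
        HasSpectralMultiplier μ V m ∧
        (∀ ψ, (∃ u, NumberField.classModulus u = 1 ∧ ψ u ≠ 1) → m ψ = 1) ∧
        (∀ ψ (s : ℂ), s.re = 1 / 2 →
          (∀ u, (ψ u : ℂ) = (NumberField.classModulus u : ℂ) ^ (s - 1 / 2)) →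
          m ψ = (s - 1) / s) := by
  have h := hμ.isModulus
  rw [IsNormalized, ← map_exp_volume] at hμ
  have : SigmaFinite (μ.map classModulus) := by
    rw [hμ, map_exp_volume]
    infer_instance
  have : SigmaFinite μ := SigmaFinite.of_map μ h.aemeasurable this
  obtain ⟨A, V, hA, hV, hu, hc, hh, m, hm, hm1, hm2⟩ :=
    h.exists_convolutionOperator measurable_sqrtKernel (hμ ▸ integrable_sqrtKernel)
    (hμ ▸ memLp_sqrtKernel) (fun t ht => sqrtKernel_of_one_lt ht)
    (hμ ▸ ae_integral_sqrtKernel_mul_sqrtKernel) (numberFieldKernel_eq classModulus)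
  refine ⟨A, V, hA, hV, hu, hc, hh, m, hm, hm1, fun ψ s hs hψ => ?_⟩
  have hs0 : s ≠ 0 := fun h0 => by rw [h0] at hs; norm_num at hs
  rw [hm2 ψ _ hψ, hμ, integral_sqrtKernel_mul_cpow hs]
  field_simp

end NumberField

section GeometricHaar

open Filter Set

/-- The counting measure on the powers of `q`. -/
noncomputable def zpowMeasure (q : ℝ) : Measure ℝ := (Measure.count : Measure ℤ).map (q ^ ·)

theorem integrable_zpowMeasure {E : Type*} [NormedAddCommGroup E] [MeasurableSpace E]
    [BorelSpace E] [SecondCountableTopology E] {q : ℝ} {f : ℝ → E} (hf : Measurable f) :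
    Integrable f (zpowMeasure q) ↔ Summable fun n : ℤ => ‖f (q ^ n)‖ := by
  rw [zpowMeasure, integrable_map_measure hf.aestronglyMeasurable
    (Measurable.of_discrete (f := fun n : ℤ => q ^ n)).aemeasurable, ← integrable_norm_iff
    (hf.comp Measurable.of_discrete).aestronglyMeasurable, integrable_count_iff]
  simp only [norm_norm, Function.comp]

theorem integral_zpowMeasure {E : Type*} [NormedAddCommGroup E] [NormedSpace ℝ E]
    [MeasurableSpace E] [BorelSpace E] [SecondCountableTopology E] [CompleteSpace E]
    {q : ℝ} {f : ℝ → E} (hf : Measurable f)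
    (hs : Summable fun n : ℤ => ‖f (q ^ n)‖) {a : E} (ha : HasSum (fun n : ℤ => f (q ^ n)) a) :
    ∫ t, f t ∂(zpowMeasure q) = a := by
  have hi := (integrable_zpowMeasure hf).2 hs
  rw [zpowMeasure] at hi ⊢
  rw [integral_map (Measurable.of_discrete (f := fun n : ℤ => q ^ n)).aemeasurable
    hf.aestronglyMeasurable, integral_countable]
  · simp only [count_real_singleton, one_smul, ha.tsum_eq]
  · exact hi.comp_measurable Measurable.of_discrete

theorem map_inv_zpowMeasure (q : ℝ) : (zpowMeasure q).map Inv.inv = zpowMeasure q := by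
  have h1 : Measurable fun n : ℤ => q ^ n := Measurable.of_discrete
  have h2 : (Measure.count : Measure ℤ).map Neg.neg = Measure.count := by
    ext s hs
    rw [Measure.map_apply Measurable.of_discrete hs, Set.neg_preimage, ← Set.image_neg_eq_neg,
      Measure.count_injective_image neg_injective]
  have h3 : Inv.inv ∘ (fun n : ℤ => q ^ n) = (fun n : ℤ => q ^ n) ∘ Neg.neg := by
    ext n
    simp [zpow_neg]
  rw [zpowMeasure, Measure.map_map measurable_inv h1, h3,
    ← Measure.map_map h1 Measurable.of_discrete, h2]

theorem ae_zpowMeasure {q : ℝ} {p : ℝ → Prop} (h : ∀ n : ℤ, p (q ^ n)) :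
    ∀ᵐ t ∂(zpowMeasure q), p t := by
  filter_upwards [ae_map_mem_range (fun n : ℤ => q ^ n) (countable_range _).measurableSet
    Measure.count] with t ht
  obtain ⟨n, rfl⟩ := ht
  exact h n

theorem sigmaFinite_zpowMeasure {q : ℝ} (hq : 1 < q) : SigmaFinite (zpowMeasure q) := by
  have hm : Measurable fun n : ℤ => q ^ n := Measurable.of_discrete
  refine Measure.sigmaFinite_of_countable
    (S := insert (range fun n : ℤ => q ^ n)ᶜ (range fun n : ℤ => {q ^ n}))
    ((countable_range _).insert _) ?_ ?_
  · rintro s (rfl | ⟨n, rfl⟩)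
    · rw [zpowMeasure, Measure.map_apply hm (countable_range _).measurableSet.compl,
        preimage_compl, preimage_range, compl_univ, measure_empty]
      exact ENNReal.zero_lt_top
    · have h1 : (fun n : ℤ => q ^ n) ⁻¹' {q ^ n} = {n} := by
        ext m
        exact (zpow_right_injective₀ (by positivity) hq.ne').eq_iff
      rw [zpowMeasure, Measure.map_apply hm (measurableSet_singleton _), h1, Measure.count_singleton]
      exact ENNReal.one_lt_top
  · rw [sUnion_insert, sUnion_range, iUnion_singleton_eq_range, compl_union_self]

/-- The function `√t (√q - 1/√q)` on `t < 1`, with value `1 - 1/√q` at `1`, and `0` on `t > 1`. -/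
noncomputable def stepKernel (q t : ℝ) : ℝ :=
  indicator (Iio 1) (fun t => √t * (√q - 1 / √q)) t + indicator {1} (fun _ => 1 - 1 / √q) t

variable {q : ℝ}

theorem measurable_stepKernel (q : ℝ) : Measurable (stepKernel q) :=
  ((Real.continuous_sqrt.measurable.mul_const _).indicator measurableSet_Iio).add
    (measurable_const.indicator (measurableSet_singleton 1))

theorem stepKernel_of_one_lt {t : ℝ} (ht : 1 < t) : stepKernel q t = 0 := by
  rw [stepKernel, indicator_of_notMem (show t ∉ Iio 1 from ht.not_gt),
    indicator_of_notMem (show t ∉ {1} from ht.ne'), add_zero]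

theorem stepKernel_one : stepKernel q 1 = 1 - 1 / √q := by
  rw [stepKernel, indicator_of_notMem (show (1 : ℝ) ∉ Iio 1 from lt_irrefl (1 : ℝ)),
    indicator_of_mem (mem_singleton _), zero_add]

theorem stepKernel_zpow_neg (hq : 1 < q) (k : ℕ) :
    stepKernel q (q ^ (-((k + 1 : ℕ) : ℤ))) = (√q)⁻¹ ^ (k + 1) * (√q - 1 / √q) := by
  have h1 : q ^ (-((k + 1 : ℕ) : ℤ)) < 1 := by
    rw [zpow_neg, zpow_natCast]
    exact inv_lt_one_of_one_lt₀ (one_lt_pow₀ hq k.succ_ne_zero)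
  rw [stepKernel, indicator_of_mem (show _ ∈ Iio (1 : ℝ) from h1),
    indicator_of_notMem (show _ ∉ {(1 : ℝ)} from h1.ne), add_zero]
  congr 1
  rw [zpow_neg, zpow_natCast, ← inv_pow, Real.sqrt_eq_iff_mul_self_eq (by positivity) (by positivity),
    ← mul_pow, ← mul_inv, Real.mul_self_sqrt (by linarith)]

theorem one_lt_sqrt (hq : 1 < q) : 1 < √q := Real.lt_sqrt_of_sq_lt (by simpa using hq)

theorem stepKernel_mul_stepKernel_of_pos (hq : 1 < q) {m n : ℤ} (hn : 0 < n) :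
    stepKernel q (q ^ m) * stepKernel q (q ^ n) = 0 := by
  rw [stepKernel_of_one_lt (one_lt_zpow₀ hq hn), mul_zero]

/-- A series over `ℤ` supported on `n ≤ 0`, with the term at `0` split off. -/
theorem hasSum_int_of_nonpos {E : Type*} [NormedAddCommGroup E] {f : ℤ → E} {a : E}
    (hf : ∀ n, 0 < n → f n = 0) (ha : HasSum (fun k : ℕ => f (-((k + 1 : ℕ) : ℤ))) a) :
    HasSum f (f 0 + a) := by
  have h1 : HasSum (fun k : ℕ => f (-(k : ℤ))) (f 0 + a) := by
    have := (hasSum_nat_add_iff (f := fun k : ℕ => f (-(k : ℤ))) 1).1 ha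
    rwa [Finset.sum_range_one, Nat.cast_zero, neg_zero, add_comm] at this
  have hinj : Function.Injective fun k : ℕ => -(k : ℤ) := fun a b h => by simpa using h
  refine (hinj.hasSum_iff fun n hn => hf n ?_).1 h1
  by_contra! h
  exact hn ⟨n.natAbs, by simp only; omega⟩

theorem hasSum_stepKernel_mul (hq : 1 < q) (j : ℕ) :
    HasSum (fun n : ℤ => stepKernel q (q ^ (-(j : ℤ)) * q ^ n) * stepKernel q (q ^ n))
      (stepKernel q (q ^ (-(j : ℤ))) + stepKernel q (q ^ (-(j : ℤ)))⁻¹) := by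
  have hr := one_lt_sqrt hq
  have hr0 : √q ≠ 0 := by positivity
  have hq0 : q ≠ 0 := by positivity
  have hr2 : √q ^ 2 = q := Real.sq_sqrt (by positivity)
  simp only [← zpow_add₀ hq0]
  have hgeo : HasSum (fun k : ℕ => (√q)⁻¹ ^ (j + 2) * (√q - 1 / √q) ^ 2 * ((√q)⁻¹ ^ 2) ^ k)
      ((√q)⁻¹ ^ (j + 2) * (√q - 1 / √q) ^ 2 * (1 - (√q)⁻¹ ^ 2)⁻¹) :=
    (hasSum_geometric_of_lt_one (by positivity)
      (pow_lt_one₀ (by positivity) (inv_lt_one_of_one_lt₀ hr) two_ne_zero)).mul_left _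
  have h1 := hasSum_int_of_nonpos (f := fun n : ℤ => stepKernel q (q ^ (-(j : ℤ) + n)) *
    stepKernel q (q ^ n)) (fun n hn => stepKernel_mul_stepKernel_of_pos hq hn)
    (hgeo.congr_fun fun k => by
      have : (-(j : ℤ) + -((k + 1 : ℕ) : ℤ)) = -((j + k + 1 : ℕ) : ℤ) := by push_cast; ring
      rw [this, stepKernel_zpow_neg hq, stepKernel_zpow_neg hq, ← pow_mul]
      ring)
  have hne : √q ^ 2 - 1 ≠ 0 := by nlinarith
  have hinv : (1 - (√q)⁻¹ ^ 2)⁻¹ = √q ^ 2 / (√q ^ 2 - 1) := by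
    rw [inv_pow]
    field_simp
  have heq : stepKernel q (q ^ (-(j : ℤ))) + stepKernel q (q ^ (-(j : ℤ)))⁻¹ =
      stepKernel q (q ^ (-(j : ℤ) + 0)) * stepKernel q (q ^ (0 : ℤ)) +
        (√q)⁻¹ ^ (j + 2) * (√q - 1 / √q) ^ 2 * (1 - (√q)⁻¹ ^ 2)⁻¹ := by
    rw [add_zero, zpow_zero, stepKernel_one, ← zpow_neg, neg_neg, hinv]
    rcases j with _ | j
    · simp only [Nat.cast_zero, neg_zero, zpow_zero, stepKernel_one, inv_pow, zero_add]
      field_simp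
      ring
    · have hj : (0 : ℤ) < ((j + 1 : ℕ) : ℤ) := by exact_mod_cast j.succ_pos
      rw [stepKernel_of_one_lt (one_lt_zpow₀ hq hj), stepKernel_zpow_neg hq]
      simp only [inv_pow, pow_add, pow_one]
      field_simp
      ring
  rw [heq]
  exact h1

theorem stepKernel_nonneg (hq : 1 < q) (t : ℝ) : 0 ≤ stepKernel q t := by
  have hr := one_lt_sqrt hq
  have h1 : 1 / √q ≤ 1 := by rw [one_div]; exact inv_le_one_of_one_le₀ hr.le
  exact add_nonneg (indicator_nonneg (fun t _ => mul_nonneg (Real.sqrt_nonneg t) (by linarith)) _)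
    (indicator_nonneg (fun t _ => by linarith) _)

theorem hasSum_stepKernel_mul_int (hq : 1 < q) (m : ℤ) :
    HasSum (fun n : ℤ => stepKernel q (q ^ m * q ^ n) * stepKernel q (q ^ n))
      (stepKernel q (q ^ m) + stepKernel q (q ^ m)⁻¹) := by
  rcases le_total m 0 with hm | hm
  · obtain ⟨j, rfl⟩ : ∃ j : ℕ, m = -j := ⟨m.natAbs, by omega⟩
    exact hasSum_stepKernel_mul hq j
  · obtain ⟨j, rfl⟩ : ∃ j : ℕ, m = j := ⟨m.natAbs, by omega⟩
    have h1 := hasSum_stepKernel_mul hq j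
    rw [← (Equiv.addRight (j : ℤ)).hasSum_iff, ← zpow_neg, neg_neg, add_comm] at h1
    rw [← zpow_neg]
    refine h1.congr_fun fun n => ?_
    have hq0 : q ≠ 0 := by positivity
    simp only [Function.comp, Equiv.coe_addRight, ← zpow_add₀ hq0, neg_add_cancel_comm_assoc]
    rw [mul_comm, add_comm n]

theorem integral_stepKernel_mul_stepKernel (hq : 1 < q) (m : ℤ) :
    ∫ s, stepKernel q (q ^ m * s) * stepKernel q s ∂(zpowMeasure q) =
      stepKernel q (q ^ m) + stepKernel q (q ^ m)⁻¹ := by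
  have hm := measurable_stepKernel q
  have hm' : Measurable fun s => stepKernel q (q ^ m * s) * stepKernel q s :=
    (hm.comp (measurable_const.mul measurable_id)).mul hm
  refine integral_zpowMeasure hm' ?_ (hasSum_stepKernel_mul_int hq m)
  exact (hasSum_stepKernel_mul_int hq m).summable.congr fun n =>
    (Real.norm_of_nonneg (mul_nonneg (stepKernel_nonneg hq _) (stepKernel_nonneg hq _))).symm

theorem hasSum_stepKernel_cpow (hq : 1 < q) {w : ℂ} (hw : w.re = 0) :
    HasSum (fun n : ℤ => (stepKernel q (q ^ n) : ℂ) * ((q ^ n : ℝ) : ℂ) ^ w)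
      (1 - (1 - (√q : ℂ) * (q : ℂ) ^ (-w)) / ((√q : ℂ) - (q : ℂ) ^ (-w))) := by
  have hr := one_lt_sqrt hq
  have hr0 : (√q : ℂ) ≠ 0 := Complex.ofReal_ne_zero.2 (by positivity)
  have hq0 : (0 : ℝ) < q := by positivity
  set z := (q : ℂ) ^ (-w)
  have hz : ‖z‖ = 1 := by
    rw [Complex.norm_cpow_eq_rpow_re_of_pos hq0, Complex.neg_re, hw, neg_zero, Real.rpow_zero]
  have hpow : ∀ k : ℕ, ((q ^ (-(k : ℤ)) : ℝ) : ℂ) ^ w = z ^ k := fun k => by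
    rw [Complex.ofReal_zpow, zpow_neg, zpow_natCast, ← Complex.cpow_nat_mul, ← inv_pow,
      ← Complex.ofReal_inv, ← Complex.ofReal_pow]
    rw [Complex.cpow_def_of_ne_zero (Complex.ofReal_ne_zero.2 (by positivity)),
      Complex.cpow_def_of_ne_zero (Complex.ofReal_ne_zero.2 hq0.ne'),
      ← Complex.ofReal_log (by positivity), ← Complex.ofReal_log hq0.le, Real.log_pow, Real.log_inv]
    congr 1
    push_cast
    ring
  have hgeo := (hasSum_geometric_of_norm_lt_one (ξ := (√q : ℂ)⁻¹ * z) (by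
    rw [norm_mul, hz, mul_one, norm_inv, Complex.norm_real, Real.norm_of_nonneg (by positivity)]
    exact inv_lt_one_of_one_lt₀ hr)).mul_left ((√q : ℂ)⁻¹ * z * (√q - 1 / √q))
  have h1 := hasSum_int_of_nonpos
    (f := fun n : ℤ => (stepKernel q (q ^ n) : ℂ) * ((q ^ n : ℝ) : ℂ) ^ w)
    (fun n hn => by
      simp only [stepKernel_of_one_lt (one_lt_zpow₀ hq hn), Complex.ofReal_zero, zero_mul])
    (hgeo.congr_fun fun k => by
      rw [hpow, stepKernel_zpow_neg hq]
      push_cast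
      ring)
  have hrz : (√q : ℂ) - z ≠ 0 := by
    intro h
    have := congrArg norm (sub_eq_zero.1 h)
    rw [hz, Complex.norm_real, Real.norm_of_nonneg (by positivity)] at this
    linarith
  have h0 : (1 : ℂ) - (√q : ℂ)⁻¹ * z ≠ 0 := by
    have : (1 : ℂ) - (√q : ℂ)⁻¹ * z = (√q : ℂ)⁻¹ * (√q - z) := by
      rw [mul_sub, inv_mul_cancel₀ hr0]
    rw [this]
    exact mul_ne_zero (inv_ne_zero hr0) hrz
  have heq : 1 - (1 - (√q : ℂ) * z) / ((√q : ℂ) - z) =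
      (stepKernel q (q ^ (0 : ℤ)) : ℂ) * ((q ^ (0 : ℤ) : ℝ) : ℂ) ^ w +
        (√q : ℂ)⁻¹ * z * (√q - 1 / √q) * (1 - (√q : ℂ)⁻¹ * z)⁻¹ := by
    rw [zpow_zero, stepKernel_one, Complex.ofReal_one, Complex.one_cpow]
    push_cast
    field_simp
    ring
  rw [heq]
  exact h1

theorem integrable_stepKernel (hq : 1 < q) : Integrable (stepKernel q) (zpowMeasure q) := by
  rw [integrable_zpowMeasure (measurable_stepKernel q)]
  have := (hasSum_stepKernel_cpow hq (w := 0) rfl).summable.norm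
  simpa using this

theorem memLp_stepKernel (hq : 1 < q) : MemLp (stepKernel q) 2 (zpowMeasure q) := by
  rw [memLp_two_iff_integrable_sq (measurable_stepKernel q).aestronglyMeasurable,
    integrable_zpowMeasure ((measurable_stepKernel q).pow_const 2)]
  have := (hasSum_stepKernel_mul_int hq 0).summable
  refine this.congr fun n => ?_
  rw [Real.norm_of_nonneg (sq_nonneg _), zpow_zero, one_mul, sq]

theorem integral_stepKernel_cpow (hq : 1 < q) {w : ℂ} (hw : w.re = 0) :
    ∫ t, (stepKernel q t : ℂ) * (t : ℂ) ^ w ∂(zpowMeasure q) =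
      1 - (1 - (√q : ℂ) * (q : ℂ) ^ (-w)) / ((√q : ℂ) - (q : ℂ) ^ (-w)) :=
  integral_zpowMeasure ((Complex.measurable_ofReal.comp (measurable_stepKernel q)).mul
    (Complex.measurable_ofReal.pow_const w)) (hasSum_stepKernel_cpow hq hw).summable.norm
    (hasSum_stepKernel_cpow hq hw)

end GeometricHaar

section Degree

variable {G : Type*} [CommGroup G] [TopologicalSpace G] [IsTopologicalGroup G]
  [MeasurableSpace G] [BorelSpace G]

/-- A homomorphism onto the powers of `q` whose kernel is open, of measure one, pushes an
invariant measure forward to the counting measure on the powers of `q`. -/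
theorem map_eq_zpowMeasure {μ : Measure G} [μ.IsMulLeftInvariant] {N : G → ℝ} {q : ℝ} (hq : 1 < q)
    (hmul : ∀ x y, N (x * y) = N x * N y) (hN : ∀ x, ∃ n : ℤ, N x = q ^ n) {u : G} (hu : N u = q)
    (hopen : IsOpen {x | N x = 1}) (hμ : μ {x | N x = 1} = 1) :
    Measurable N ∧ μ.map N = zpowMeasure q := by
  have hq0 : q ≠ 0 := by positivity
  have h1 : N 1 = 1 := by
    obtain ⟨n, hn⟩ := hN 1
    have := hmul 1 1
    rw [mul_one] at this
    exact (mul_eq_left₀ (by rw [hn]; exact zpow_ne_zero _ hq0)).1 this.symm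
  have hinv : ∀ x, N x⁻¹ = (N x)⁻¹ := fun x =>
    eq_inv_of_mul_eq_one_left (by rw [← hmul, inv_mul_cancel, h1])
  have hpow : ∀ n : ℕ, N (u ^ n) = q ^ n := fun n => by
    induction n with
    | zero => rw [pow_zero, pow_zero, h1]
    | succ n ih => rw [pow_succ, hmul, ih, hu, pow_succ]
  have hzpow : ∀ n : ℤ, N (u ^ n) = q ^ n := fun n => by
    rcases n with n | n
    · simpa using hpow n
    · rw [zpow_negSucc, zpow_negSucc, hinv, hpow]
  have hfib : ∀ n : ℤ, {x | N x = q ^ n} = (fun x => u ^ (-n) * x) ⁻¹' {x | N x = 1} := fun n => by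
    ext x
    simp only [Set.mem_ofPred_eq, Set.mem_preimage, hmul, hzpow]
    rw [zpow_neg, inv_mul_eq_one₀ (zpow_ne_zero _ hq0), eq_comm]
  have hfibm : ∀ n : ℤ, MeasurableSet {x | N x = q ^ n} := fun n => by
    rw [hfib]
    exact measurable_const_mul _ hopen.measurableSet
  have hfibμ : ∀ n : ℤ, μ {x | N x = q ^ n} = 1 := fun n => by
    rw [hfib, measure_preimage_mul, hμ]
  have hpre : ∀ s : Set ℝ, N ⁻¹' s = ⋃ n : ℤ, {x | N x = q ^ n ∧ q ^ n ∈ s} := fun s => by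
    ext x
    simp only [Set.mem_preimage, Set.mem_iUnion, Set.mem_ofPred_eq]
    obtain ⟨n, hn⟩ := hN x
    refine ⟨fun h => ⟨n, hn, hn ▸ h⟩, fun ⟨m, hm, hms⟩ => hm ▸ hms⟩
  have hpm : ∀ (s : Set ℝ) (n : ℤ), MeasurableSet {x | N x = q ^ n ∧ q ^ n ∈ s} := fun s n => by
    by_cases h : q ^ n ∈ s
    · simpa only [h, and_true] using hfibm n
    · simp [h]
  have hNm : Measurable N := fun s _ => by
    rw [hpre]
    exact MeasurableSet.iUnion (hpm s)
  refine ⟨hNm, ?_⟩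
  ext s hs
  have hzm : Measurable fun n : ℤ => q ^ n := Measurable.of_discrete
  rw [zpowMeasure, Measure.map_apply hNm hs, Measure.map_apply hzm hs, hpre, measure_iUnion _ (hpm s),
    ← lintegral_indicator_one (hzm hs), lintegral_count]
  · refine tsum_congr fun n => ?_
    by_cases h : q ^ n ∈ s
    · rw [Set.indicator_of_mem (show n ∈ (fun n : ℤ => q ^ n) ⁻¹' s from h), Pi.one_apply]
      simpa only [h, and_true] using hfibμ n
    · rw [Set.indicator_of_notMem (show n ∉ (fun n : ℤ => q ^ n) ⁻¹' s from h)]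
      simp [h]
  · intro m n hmn
    refine Set.disjoint_left.2 fun x hx hx' => hmn ?_
    exact zpow_right_injective₀ (by positivity) hq.ne' (hx.1.symm.trans hx'.1)

end Degree

namespace GlobalFunctionField

open Polynomial IsLocalRing WithZero

section

variable {K : Type*} [Field K]

theorem Place.valued_coe (v : Place K) (y : K) :
    Valued.v (y : v.Completion) = v.ring.valuation y :=
  Valued.valuedCompletion_apply _

theorem Place.exists_valued_eq (v : Place K) {x : v.Completion} (hx : x ≠ 0) :
    ∃ y : K, y ≠ 0 ∧ Valued.v x = v.ring.valuation y := by
  obtain ⟨y, hy⟩ := v.ring.valuation_surjective (Valued.v x)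
  refine ⟨y, fun h => ?_, hy.symm⟩
  rw [h, map_zero] at hy
  exact hx ((map_eq_zero (Valued.v : Valuation v.Completion v.ring.ValueGroup)).1 hy.symm)

theorem ne_zero_apply (a : (AdeleRing K)ˣ) (v : Place K) : a.val v ≠ 0 := by
  have h : a.val v * (a⁻¹).val v = 1 := congrFun (congrArg Subtype.val a.mul_inv) v
  exact left_ne_zero_of_mul_eq_one h

theorem valued_eq_one_of_mem (a : (AdeleRing K)ˣ) {v : Place K} (h : a.val v ∈ v.integers)
    (h' : (a⁻¹).val v ∈ v.integers) : Valued.v (a.val v) = 1 := by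
  have h1 : a.val v * (a⁻¹).val v = 1 := congrFun (congrArg Subtype.val a.mul_inv) v
  have h2 : Valued.v (a.val v) * Valued.v ((a⁻¹).val v) = (1 : v.ring.ValueGroup) := by
    rw [← map_mul, h1, map_one]
  refine le_antisymm h ?_
  rw [← h2]
  exact mul_le_of_le_one_right' h'

variable [HasDiscretePlaces K]

theorem Place.ord_zpow (v : Place K) (x : K) (n : ℤ) : v.ord (x ^ n) = n * v.ord x := by
  rcases n with n | n
  · simpa using v.ord_pow x n
  · rw [zpow_negSucc, v.ord_inv, v.ord_pow, Int.negSucc_eq]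
    push_cast
    ring

theorem Place.valuation_eq_iff_ord (v : Place K) {x y : K} (hx : x ≠ 0) (hy : y ≠ 0) :
    v.ring.valuation x = v.ring.valuation y ↔ v.ord x = v.ord y := by
  rw [ValuationSubring.valuation_eq_iff]
  constructor
  · rintro ⟨a, rfl⟩
    have ha : ((a : v.ring) : K) ≠ 0 := left_ne_zero_of_mul hx
    rw [v.ord_mul ha hy, v.ord_isUnit a.isUnit, zero_add]
  · intro h
    have h1 : v.ord (x / y) = 0 := by
      rw [div_eq_mul_inv, v.ord_mul hx (inv_ne_zero hy), v.ord_inv, h, add_neg_cancel]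
    have h2 : v.ord (y / x) = 0 := by
      rw [div_eq_mul_inv, v.ord_mul hy (inv_ne_zero hx), v.ord_inv, h, add_neg_cancel]
    have h3 := (v.ord_nonneg_iff (div_ne_zero hx hy)).1 h1.ge
    have h4 := (v.ord_nonneg_iff (div_ne_zero hy hx)).1 h2.ge
    refine ⟨⟨⟨_, h3⟩, ⟨_, h4⟩, Subtype.ext (div_mul_div_cancel₀ hy |>.trans (div_self hx)),
      Subtype.ext (div_mul_div_cancel₀ hx |>.trans (div_self hy))⟩, div_mul_cancel₀ x hy⟩

theorem Place.isOrd_iff (v : Place K) {x : v.Completion} {y : K} (hy : y ≠ 0)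
    (hxy : Valued.v x = v.ring.valuation y) (n : ℤ) : v.IsOrd x n ↔ n = v.ord y := by
  have key : ∀ ϖ : v.ring, Irreducible ϖ →
      (Valued.v x = v.ring.valuation (ϖ : K) ^ n ↔ n = v.ord y) := fun ϖ hϖ => by
    have h0 : (ϖ : K) ≠ 0 := fun h => hϖ.ne_zero (Subtype.ext h)
    rw [hxy, ← map_zpow₀, v.valuation_eq_iff_ord hy (zpow_ne_zero n h0), v.ord_zpow,
      v.ord_irreducible hϖ, mul_one, eq_comm]
  constructor
  · rintro ⟨ϖ, hϖ, h⟩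
    exact (key ϖ hϖ).1 h
  · intro h
    obtain ⟨ϖ, hϖ⟩ := IsDiscreteValuationRing.exists_irreducible v.ring
    exact ⟨ϖ, hϖ, (key ϖ hϖ).2 h⟩

theorem Place.abv_eq (v : Place K) {x : v.Completion} {y : K} (hy : y ≠ 0)
    (hxy : Valued.v x = v.ring.valuation y) :
    v.abv x = (v.residueCard : ℝ) ^ (-v.ord y) := by
  have hx : x ≠ 0 := by
    rintro rfl
    rw [map_zero] at hxy
    exact hy ((map_eq_zero _).1 hxy.symm)
  have h := Classical.epsilon_spec (p := v.IsOrd x) ⟨v.ord y, (v.isOrd_iff hy hxy _).2 rfl⟩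
  rw [Place.abv, if_neg hx, (v.isOrd_iff hy hxy _).1 h]

theorem Place.residueCard_ne_zero (v : Place K) : (v.residueCard : ℝ) ≠ 0 :=
  Nat.cast_ne_zero.2 Nat.card_pos.ne'

theorem Place.abv_mul (v : Place K) {x x' : v.Completion} (hx : x ≠ 0) (hx' : x' ≠ 0) :
    v.abv (x * x') = v.abv x * v.abv x' := by
  obtain ⟨y, hy, h⟩ := v.exists_valued_eq hx
  obtain ⟨y', hy', h'⟩ := v.exists_valued_eq hx'
  rw [v.abv_eq hy h, v.abv_eq hy' h', v.abv_eq (mul_ne_zero hy hy') (by rw [map_mul, map_mul, h, h']),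
    v.ord_mul hy hy', neg_add, zpow_add₀ v.residueCard_ne_zero]

theorem Place.abv_eq_one (v : Place K) {x : v.Completion} (hx : Valued.v x = 1) : v.abv x = 1 := by
  rw [v.abv_eq one_ne_zero (by rw [hx, map_one]), v.ord_one, neg_zero, zpow_zero]

theorem Place.abv_coe (v : Place K) {y : K} (hy : y ≠ 0) :
    v.abv (y : v.Completion) = (v.residueCard : ℝ) ^ (-v.ord y) :=
  v.abv_eq hy (v.valued_coe y)

theorem finite_mulSupport_abv (a : (AdeleRing K)ˣ) :
    (Function.mulSupport fun v : Place K => v.abv (a.val v)).Finite := by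
  have h1 := a.val.2
  have h2 := (a⁻¹).val.2
  refine ((h1.and h2).mono fun v hv => ?_ : ∀ᶠ v : Place K in Filter.cofinite, v.abv (a.val v) = 1)
  exact v.abv_eq_one (valued_eq_one_of_mem a hv.1 hv.2)

theorem ideleModulus_mul (a b : (AdeleRing K)ˣ) :
    ideleModulus (a * b) = ideleModulus a * ideleModulus b := by
  rw [ideleModulus, ideleModulus, ideleModulus,
    ← finprod_mul_distrib (finite_mulSupport_abv a) (finite_mulSupport_abv b)]
  exact finprod_congr fun v => v.abv_mul (ne_zero_apply a v) (ne_zero_apply b v)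

variable (k : Type*) [Field k] [Finite k] [Algebra k K]

theorem exists_ideleModulus_eq (a : (AdeleRing K)ˣ) :
    ∃ n : ℤ, ideleModulus a = (Nat.card k : ℝ) ^ n := by
  have hk : (Nat.card k : ℝ) ≠ 0 := Nat.cast_ne_zero.2 Nat.card_pos.ne'
  refine finprod_induction (fun x => ∃ n : ℤ, x = (Nat.card k : ℝ) ^ n) ⟨0, (zpow_zero _).symm⟩ ?_ ?_
  · rintro _ _ ⟨m, rfl⟩ ⟨n, rfl⟩
    exact ⟨m + n, (zpow_add₀ hk m n).symm⟩
  · intro v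
    obtain ⟨y, hy, h⟩ := v.exists_valued_eq (ne_zero_apply a v)
    refine ⟨v.degree k * -v.ord y, ?_⟩
    rw [v.abv_eq hy h, v.residueCard_eq k, Nat.cast_pow, zpow_mul, zpow_natCast]

end

section


theorem ideleModulus_eq_one (k : Type*) {K : Type*} [Field k] [Finite k] [Field K]
    [Algebra k K] [HasDiscretePlaces K] [IsFunctionField k K] {a : (AdeleRing K)ˣ} (ha : a ∈ principalIdeles K) :
    ideleModulus a = 1 := by
  obtain ⟨x, hx⟩ := ha
  have hk : (Nat.card k : ℝ) ≠ 0 := Nat.cast_ne_zero.2 Nat.card_pos.ne'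
  have h1 : ∀ v : Place K, v.abv (a.val v) =
      (Nat.card k : ℝ) ^ (-(principalDivisor k (x : K) v * v.degree k)) := fun v => by
    rw [hx v, v.abv_coe x.ne_zero, v.residueCard_eq k, Nat.cast_pow, principalDivisor_apply,
      ← zpow_natCast, ← zpow_mul, mul_comm, neg_mul]
  rw [ideleModulus, finprod_eq_prod_of_mulSupport_subset (s := (principalDivisor k (x : K)).support)]
  · have h2 : ∀ S : Finset (Place K), ∏ v ∈ S, v.abv (a.val v) =
        (Nat.card k : ℝ) ^ (-∑ v ∈ S, principalDivisor k (x : K) v * v.degree k) := fun S => by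
      classical
      induction S using Finset.induction_on with
      | empty => simp
      | insert v S hv ih =>
        rw [Finset.prod_insert hv, Finset.sum_insert hv, ih, h1, neg_add, zpow_add₀ hk]
    rw [h2, ← Divisor.deg_eq_sum k _ subset_rfl, deg_principalDivisor, neg_zero, zpow_zero]
  · intro v hv
    rw [Finset.mem_coe, Finsupp.mem_support_iff]
    intro h
    exact hv ((h1 v).trans (by rw [h, zero_mul, neg_zero, zpow_zero]))

theorem ideleModulus_pos (k : Type*) {K : Type*} [Field k] [Finite k] [Field K]
    [Algebra k K] [HasDiscretePlaces K] [IsFunctionField k K] (a : (AdeleRing K)ˣ) : 0 < ideleModulus a := by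
  obtain ⟨n, hn⟩ := exists_ideleModulus_eq k a
  rw [hn]
  have : 0 < Nat.card k := Nat.card_pos
  positivity

/-- The modulus as a homomorphism. -/
noncomputable def ideleModulusHom (k : Type*) {K : Type*} [Field k] [Finite k] [Field K]
    [Algebra k K] [HasDiscretePlaces K] [IsFunctionField k K] : (AdeleRing K)ˣ →* ℝ where
  toFun := ideleModulus
  map_one' := (mul_eq_left₀ (ideleModulus_pos k 1).ne').1 (by rw [← ideleModulus_mul, one_mul])
  map_mul' := ideleModulus_mul

theorem classModulus_mk (k : Type*) {K : Type*} [Field k] [Finite k] [Field K]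
    [Algebra k K] [HasDiscretePlaces K] [IsFunctionField k K] (a : (AdeleRing K)ˣ) :
    classModulus (QuotientGroup.mk a : (AdeleRing K)ˣ ⧸ principalIdeles K) = ideleModulus a :=
  QuotientGroup.map_out_eq (f := ideleModulusHom k) (fun _ => ideleModulus_eq_one k) a

theorem classModulus_mul (k : Type*) {K : Type*} [Field k] [Finite k] [Field K]
    [Algebra k K] [HasDiscretePlaces K] [IsFunctionField k K] (u w : IdeleClassGroup K) :
    classModulus (u * w) = classModulus u * classModulus w := by
  obtain ⟨u, rfl⟩ := QuotientGroup.mk_surjective u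
  obtain ⟨w, rfl⟩ := QuotientGroup.mk_surjective w
  exact (classModulus_mk k (u * w)).trans
    ((ideleModulus_mul u w).trans (by rw [← classModulus_mk k, ← classModulus_mk k]))

theorem isOpen_classModulus_eq_one (k : Type*) {K : Type*} [Field k] [Finite k] [Field K]
    [Algebra k K] [HasDiscretePlaces K] [IsFunctionField k K] : IsOpen {u : IdeleClassGroup K | classModulus u = 1} := by
  have hU : IsOpen {a : AdeleRing K | ∀ v, a v ∈ (v.integers : Set v.Completion)} :=
    RestrictedProduct.isOpen_forall_mem fun v => Valued.isOpen_valuationSubring _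
  have hU' : IsOpen {a : (AdeleRing K)ˣ | (∀ v, a.val v ∈ (v.integers : Set v.Completion)) ∧
      ∀ v, (a⁻¹).val v ∈ (v.integers : Set v.Completion)} :=
    (hU.preimage Units.continuous_val).inter
      (hU.preimage (Units.continuous_val.comp continuous_inv))
  have hopen : IsOpen ((ideleModulusHom k (K := K)).ker : Set (AdeleRing K)ˣ) := by
    refine Subgroup.isOpen_of_mem_nhds _ (g := 1) (Filter.mem_of_superset (hU'.mem_nhds ?_) ?_)
    · simp only [Set.mem_ofPred_eq, inv_one]
      exact ⟨fun v => one_mem v.integers, fun v => one_mem v.integers⟩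
    · intro a ha
      refine MonoidHom.mem_ker.2 (finprod_eq_one_of_forall_eq_one fun v => ?_)
      exact v.abv_eq_one (valued_eq_one_of_mem a (ha.1 v) (ha.2 v))
  refine (QuotientGroup.isQuotientMap_mk (principalIdeles K)).isOpen_preimage.1 ?_
  convert! hopen using 1
  ext a
  exact Eq.congr_left (classModulus_mk k a)

theorem coe_mul_coe_eq_one {K : Type*} [Field K] (v : Place K) {x y : K} (h : x * y = 1) :
    (x : v.Completion) * (y : v.Completion) = 1 := by
  rw [← UniformSpace.Completion.coe_mul, ← map_mul, h, map_one]
  exact UniformSpace.Completion.coe_one _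

open Classical in
/-- The idele with component `y` at the place `v` and `1` elsewhere. -/
noncomputable def singleIdele {K : Type*} [Field K] (v : Place K) (y : Kˣ) : (AdeleRing K)ˣ where
  val := RestrictedProduct.mulSingle (fun v : Place K => v.integers) v ((y : K) : v.Completion)
  inv := RestrictedProduct.mulSingle (fun v : Place K => v.integers) v
    (((y⁻¹ : Kˣ) : K) : v.Completion)
  val_inv := by
    classical
    rw [← RestrictedProduct.mulSingle_mul, coe_mul_coe_eq_one v y.mul_inv,
      RestrictedProduct.mulSingle_one]
  inv_val := by
    classical
    rw [← RestrictedProduct.mulSingle_mul, coe_mul_coe_eq_one v y.inv_mul,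
      RestrictedProduct.mulSingle_one]

theorem ideleModulus_singleIdele (k : Type*) {K : Type*} [Field k] [Finite k] [Field K]
    [Algebra k K] [HasDiscretePlaces K] (v : Place K) (y : Kˣ) :
    ideleModulus (singleIdele v y) = (Nat.card k : ℝ) ^ (-(v.ord (y : K) * v.degree k)) := by
  rw [ideleModulus, finprod_eq_single _ v]
  · classical
    have h1 : (singleIdele v y).val v = ((y : K) : v.Completion) :=
      RestrictedProduct.mulSingle_eq_same _ _ _
    rw [h1, v.abv_coe y.ne_zero, v.residueCard_eq k, Nat.cast_pow, ← zpow_natCast, ← zpow_mul,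
      mul_comm, neg_mul]
  · intro w hw
    classical
    have h1 : (singleIdele v y).val w = 1 := RestrictedProduct.mulSingle_eq_of_ne _ _ hw
    rw [h1]
    exact w.abv_eq_one (map_one _)

theorem exists_classModulus_eq (k : Type*) {K : Type*} [Field k] [Finite k] [Field K]
    [Algebra k K] [HasDiscretePlaces K] [IsFunctionField k K] (hk : ∀ x : K, IsAlgebraic k x → x ∈ (algebraMap k K).range) :
    ∃ u : IdeleClassGroup K, classModulus u = Nat.card k := by
  have hk0 : (Nat.card k : ℝ) ≠ 0 := Nat.cast_ne_zero.2 Nat.card_pos.ne'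
  let H : AddSubgroup ℤ :=
    { carrier := {n | ∃ a : (AdeleRing K)ˣ, ideleModulus a = (Nat.card k : ℝ) ^ n}
      zero_mem' := ⟨1, (ideleModulusHom k).map_one⟩
      add_mem' := by
        rintro m n ⟨a, ha⟩ ⟨b, hb⟩
        exact ⟨a * b, by rw [ideleModulus_mul, ha, hb, zpow_add₀ hk0]⟩
      neg_mem' := by
        rintro n ⟨a, ha⟩
        refine ⟨a⁻¹, ?_⟩
        rw [zpow_neg, ← ha]
        refine eq_inv_of_mul_eq_one_left ?_
        rw [← ideleModulus_mul, inv_mul_cancel]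
        exact (ideleModulusHom k).map_one }
  have hdeg : ∀ v : Place K, (v.degree k : ℤ) ∈ H := fun v => by
    obtain ⟨y, hy0, hy⟩ := v.exists_ord_eq_one
    rw [← neg_mem_iff]
    exact ⟨singleIdele v (Units.mk0 y hy0), by
      rw [ideleModulus_singleIdele k, Units.val_mk0, hy, one_mul]⟩
  obtain ⟨d, hd⟩ := Int.subgroup_cyclic H
  have hmem : ∀ n, n ∈ H ↔ d ∣ n := fun n => by
    rw [hd, ← AddSubgroup.zmultiples_eq_closure, Int.mem_zmultiples_iff]
  have hd1 : d.natAbs = 1 := by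
    by_contra h
    obtain ⟨l, hl, hld⟩ := Nat.exists_prime_and_dvd h
    obtain ⟨v, hv⟩ := exists_not_dvd_degree k K hk hl
    exact hv (hld.trans (Int.natAbs_dvd_natAbs.2 ((hmem _).1 (hdeg v))))
  obtain ⟨a, ha⟩ : (1 : ℤ) ∈ H := (hmem 1).2 (Int.natAbs_dvd_natAbs.1 (by rw [hd1]; exact one_dvd _))
  exact ⟨QuotientGroup.mk a, by rw [← zpow_one (Nat.card k : ℝ), ← ha]; exact classModulus_mk k a⟩

/-- The constant field extension to the full field of constants. -/
theorem isFunctionField_algebraicClosure (k K : Type*) [Field k] [Field K] [Algebra k K]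
    [IsFunctionField k K] : IsFunctionField (algebraicClosure k K) K where
  essFiniteType :=
    have := IsFunctionField.essFiniteType (k := k) (F := K)
    Algebra.EssFiniteType.of_comp k (algebraicClosure k K) K
  trdeg_eq_one := by
    rw [← IsFunctionField.trdeg_eq_one (k := k) (F := K),
      ← trdeg_add_eq k (algebraicClosure k K) (A := K),
      trdeg_eq_zero (R := k) (A := algebraicClosure k K), zero_add]

theorem exists_convolutionOperator (k K : Type*) [Field k] [Finite k] [Field K] [Algebra k K]
    [Algebra.EssFiniteType k K] (htr : Algebra.trdeg k K = 1) (q : ℕ)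
    (hq : q = Nat.card (algebraicClosure k K)) (μ : Measure (IdeleClassGroup K)) [μ.IsHaarMeasure]
    (hμ : IsNormalized μ) :
    ∃ A V : Lp ℂ 2 μ →L[ℂ] Lp ℂ 2 μ,
      IsConvolutionOperator μ (functionFieldKernel q GlobalFunctionField.classModulus) A ∧
      V = 1 - A ∧
      V ∈ unitary (Lp ℂ 2 μ →L[ℂ] Lp ℂ 2 μ) ∧
      (∀ (g : GlobalFunctionField.IdeleClassGroup K) (f : Lp ℂ 2 μ),
        V (regularAction μ g f) = regularAction μ g (V f)) ∧
      (∀ f ∈ hardySpace μ GlobalFunctionField.classModulus,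
        V f ∈ hardySpace μ GlobalFunctionField.classModulus) ∧
      ∃ m : PontryaginDual (GlobalFunctionField.IdeleClassGroup K) → ℂ,
        HasSpectralMultiplier μ V m ∧
        (∀ ψ, (∃ u, GlobalFunctionField.classModulus u = 1 ∧ ψ u ≠ 1) → m ψ = 1) ∧
        (∀ ψ (s z : ℂ), s.re = 1 / 2 → z = (q : ℂ) ^ (-(s - 1 / 2)) →
          (∀ u, (ψ u : ℂ) = (GlobalFunctionField.classModulus u : ℂ) ^ (s - 1 / 2)) →
          m ψ = (1 - (√(q : ℝ) : ℂ) * z) / ((√(q : ℝ) : ℂ) - z)) := by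
  have : IsFunctionField k K := ⟨inferInstance, htr⟩
  have : HasDiscretePlaces K := IsFunctionField.hasDiscretePlaces k K
  have := isFunctionField_algebraicClosure k K
  have : Finite (algebraicClosure k K) := finite_algebraicClosure k K
  have hq1 : (1 : ℝ) < q := by
    rw [hq]
    exact_mod_cast Finite.one_lt_card (α := algebraicClosure k K)
  obtain ⟨u, hu⟩ := exists_classModulus_eq (algebraicClosure k K) (K := K) fun x hx =>
    ⟨⟨x, mem_algebraicClosure_iff.2 (hx.restrictScalars k)⟩, rfl⟩
  rw [← hq] at hu
  have hpow : ∀ x : IdeleClassGroup K, ∃ n : ℤ, classModulus x = (q : ℝ) ^ n := fun x => by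
    rw [hq]
    exact exists_ideleModulus_eq (algebraicClosure k K) _
  obtain ⟨hmeas, hmap⟩ := map_eq_zpowMeasure hq1 (classModulus_mul k) hpow hu
    (isOpen_classModulus_eq_one k) hμ
  have h : IsModulus μ classModulus :=
    { map_mul := classModulus_mul k
      pos := fun x => ideleModulus_pos k _
      aemeasurable := hmeas.aemeasurable
      map_inv := by rw [hmap, map_inv_zpowMeasure] }
  have : SigmaFinite μ :=
    SigmaFinite.of_map μ h.aemeasurable (hmap ▸ sigmaFinite_zpowMeasure hq1)
  obtain ⟨A, V, hA, hV, hun, hc, hh, m, hm, hm1, hm2⟩ :=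
    h.exists_convolutionOperator (measurable_stepKernel q) (hmap ▸ integrable_stepKernel hq1)
    (hmap ▸ memLp_stepKernel hq1) (fun t ht => stepKernel_of_one_lt ht)
    (hmap ▸ ae_zpowMeasure (integral_stepKernel_mul_stepKernel hq1))
    (a := functionFieldKernel q classModulus) (fun w => rfl)
  refine ⟨A, V, hA, hV, hun, hc, hh, m, hm, hm1, fun ψ s z hs hz hψ => ?_⟩
  rw [hm2 ψ _ hψ, hmap, integral_stepKernel_cpow hq1 (by rw [Complex.sub_re, hs]; norm_num), hz]
  simp

end

end GlobalFunctionField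

theorem lemma1p10 :
    -- number fields
    (∀ (K : Type*) [Field K] [NumberField K]
      (μ : MeasureTheory.Measure (NumberField.IdeleClassGroup K)) [μ.IsHaarMeasure],
      NumberField.IsNormalized μ →
      ∃ A V : Lp ℂ 2 μ →L[ℂ] Lp ℂ 2 μ,
        IsConvolutionOperator μ (numberFieldKernel NumberField.classModulus) A ∧
        V = 1 - A ∧
        V ∈ unitary (Lp ℂ 2 μ →L[ℂ] Lp ℂ 2 μ) ∧
        (∀ (g : NumberField.IdeleClassGroup K) (f : Lp ℂ 2 μ),
          V (regularAction μ g f) = regularAction μ g (V f)) ∧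
        (∀ f ∈ hardySpace μ NumberField.classModulus,
          V f ∈ hardySpace μ NumberField.classModulus) ∧
        ∃ m : PontryaginDual (NumberField.IdeleClassGroup K) → ℂ,
          HasSpectralMultiplier μ V m ∧
          (∀ ψ, (∃ u, NumberField.classModulus u = 1 ∧ ψ u ≠ 1) → m ψ = 1) ∧
          (∀ ψ (s : ℂ), s.re = 1 / 2 →
            (∀ u, (ψ u : ℂ) = (NumberField.classModulus u : ℂ) ^ (s - 1 / 2)) →
            m ψ = (s - 1) / s)) ∧
    -- function fields in one variable over a finite field, with constant field of `q` elements
    (∀ (k K : Type*) [Field k] [Finite k] [Field K] [Algebra k K] [Algebra.EssFiniteType k K]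
      (_ : Algebra.trdeg k K = 1) (q : ℕ) (_ : q = Nat.card (algebraicClosure k K))
      (μ : MeasureTheory.Measure (GlobalFunctionField.IdeleClassGroup K)) [μ.IsHaarMeasure],
      GlobalFunctionField.IsNormalized μ →
      ∃ A V : Lp ℂ 2 μ →L[ℂ] Lp ℂ 2 μ,
        IsConvolutionOperator μ (functionFieldKernel q GlobalFunctionField.classModulus) A ∧
        V = 1 - A ∧
        V ∈ unitary (Lp ℂ 2 μ →L[ℂ] Lp ℂ 2 μ) ∧
        (∀ (g : GlobalFunctionField.IdeleClassGroup K) (f : Lp ℂ 2 μ),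
          V (regularAction μ g f) = regularAction μ g (V f)) ∧
        (∀ f ∈ hardySpace μ GlobalFunctionField.classModulus,
          V f ∈ hardySpace μ GlobalFunctionField.classModulus) ∧
        ∃ m : PontryaginDual (GlobalFunctionField.IdeleClassGroup K) → ℂ,
          HasSpectralMultiplier μ V m ∧
          (∀ ψ, (∃ u, GlobalFunctionField.classModulus u = 1 ∧ ψ u ≠ 1) → m ψ = 1) ∧
          (∀ ψ (s z : ℂ), s.re = 1 / 2 → z = (q : ℂ) ^ (-(s - 1 / 2)) →
            (∀ u, (ψ u : ℂ) = (GlobalFunctionField.classModulus u : ℂ) ^ (s - 1 / 2)) →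
            m ψ = (1 - (√(q : ℝ) : ℂ) * z) / ((√(q : ℝ) : ℂ) - z))) := by
  exact ⟨fun K _ _ μ _ hμ => NumberField.exists_convolutionOperator μ hμ,
    fun k K _ _ _ _ _ htr q hq μ _ hμ =>
      GlobalFunctionField.exists_convolutionOperator k K htr q hq μ hμ⟩
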